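/- **Conventions.** A *dynamical theory* consists of a one-sorted signature and a set of axioms which are *dynamical rules* $\Gamma\vdash \exists \underline y^1\,\Delta_1\ \text{or}\ \cdots\ \text{or}\ \exists\underline y^m\,\Delta_m$, where $\Gamma,\Delta_1,\dots,\Delta_m$ are finite lists of atomic formulas. A rule is *valid* in (proved by) the theory if it has a dynamical proof: a finite tree, starting from the hypotheses $\Gamma$, in which one applies axioms to terms, opening one branch for each disjunct of the conclusion of the axiom, introducing fresh variables for its existential variables and adding its atomic formulas; at every leaf one of the desired disjuncts must have been obtained, with terms in place of its existential variables. Substitution of equals for equals is always allowed. A rule is *algebraic* if "or", $\exists$ and $\bot$ do not occur in its right-hand side. A theory $T'$ *extends* $T$ if its signature contains that of $T$ and the axioms of $T$ are valid in $T'$; $T$ is *intermediate* between $T_1$ and $T_2$ if $T$ extends $T_1$ and $T_2$ extends $T$. The atomic formulas are $t=0$, $t\ge 0$ and possibly $t>0$; $a=b$, $a\ge b$, $a>b$ stand for $a-b=0$, $a-b\ge0$, $a-b>0$. Write $a\wedge b=-(-a\vee -b)$, $|a|=a\vee -a$, $a^+=a\vee 0$. **Rules.** Ring rules: the identities of commutative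 rings, $\vdash 0=0$; $x=0\vdash xy=0$; $x=0,y=0\vdash x+y=0$. Order rules: $x=0\vdash x\ge0$; $x\ge0,y\ge0\vdash x+y\ge0$; $\vdash x^2\ge0$; $x\ge0,y\ge0\vdash xy\ge0$. Strict order rules: $\vdash1>0$; $x>0\vdash x\ge0$; $x>0,y\ge0\vdash x+y>0$; $x>0,y>0\vdash xy>0$. Further: $\mathbf{col}$: $0>0\vdash1=0$; $\mathbf{Gao}$: $x\ge0,x\le0\vdash x=0$; $\mathbf{Anz}$: $x^2=0\vdash x=0$; $\mathbf{Aonz}$: $c\ge0,\ x(x^2+c)\ge0\vdash x\ge0$; $\mathbf{lv}$: $xy=1\vdash x^2>0$; $\mathbf{Aso1}$: $x>0,xy\ge0\vdash y\ge0$; $\mathbf{Aso2}$: $x\ge0,xy>0\vdash y>0$; $\mathbf{IV}$: $x>0\vdash\exists y\ xy=1$; $\mathbf{OT}$: $\vdash x\ge0$ or $x\le0$; $\mathbf{ED}$: $\vdash x=0$ or $x^2>0$; $\mathbf{OTF}$: $x+y>0\vdash x>0$ or $y>0$; $\mathbf{RCF}_n$: $a<b,\ P(a)P(b)<0\vdash\exists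 x\,(P(x)=0,\ a<x<b)$ with $P(x)=\sum_{k\le n}a_kx^k$. Sup rules: $\vdash x\vee y\ge x$; $\vdash x\vee y\ge y$; $z\ge x,z\ge y\vdash z\ge x\vee y$. $\mathbf{grl}$: $\vdash x+(y\vee z)=(x+y)\vee(x+z)$; $\mathbf{afr}$: $\vdash x^+(y\vee z)=(x^+y)\vee(x^+z)$. Fr rules: $\vdash\mathrm{Fr}(a,b)|b|=(|a|\wedge|b|)^2$; $\vdash 0\le\mathrm{Fr}(a,b)\le|a|\wedge|b|$. **Theories.** - $\mathcal{A}onz$ (strictly reduced ordered rings): ring and order rules, $\mathbf{Gao}$, $\mathbf{Aonz}$. $\mathcal{A}tonz$ (reduced totally ordered rings): ring and order rules, $\mathbf{Gao}$, $\mathbf{OT}$, $\mathbf{Anz}$. Predicates $=0,\ge0$. - With the predicate $>0$ added: $\mathcal{A}sonz$ (reduced strictly ordered rings): ring, order and strict order rules, $\mathbf{col}$, $\mathbf{Gao}$, $\mathbf{Aso1}$, $\mathbf{Aso2}$, $\mathbf{Aonz}$. $\mathcal{C}od$ (discrete ordered fields): ring, order and strict order rules, $\mathbf{col}$, $\mathbf{Gao}$,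 $\mathbf{lv}$, $\mathbf{IV}$, $\mathbf{OT}$, $\mathbf{ED}$. - $\mathcal{A}frnz$ (reduced strongly lattice-ordered rings, i.e. reduced f-rings; predicates $=0,\ge0$ and symbol $\vee$): ring rules; $\vee$ is compatible with equality, idempotent, commutative and associative; $\mathbf{grl}$, $\mathbf{afr}$, $\mathbf{Anz}$; $x\ge0$ is equivalent to $x\vee0=x$. - $\mathcal{A}srnz$ (reduced strictly lattice-ordered rings; predicates $=0,\ge0,>0$ and symbol $\vee$): $\mathcal{A}frnz$ with the strict order rules, $\mathbf{col}$, $\mathbf{lv}$, $\mathbf{Aso1}$, $\mathbf{Aso2}$ and the sup rules. On the same signature, $\mathcal{C}o0$: ring, order, strict order and sup rules, $\mathbf{grl}$, $\mathbf{afr}$, $\mathbf{Gao}$, $\mathbf{Anz}$, $\mathbf{Aonz}$, $\mathbf{lv}$, $\mathbf{Aso1}$, $\mathbf{Aso2}$, $\mathbf{IV}$, $\mathbf{OTF}$; $\mathcal{C}odsup$ (discrete ordered fields with sup): $\mathcal{C}od$ with the sup rules; $\mathcal{C}rcdsup$ (discrete real closed fields with sup): $\mathcal{C}odsup$ with all $\mathbf{RCF}_n$.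 - With the binary symbol $\mathrm{Fr}$ added: $\mathcal{A}ftr$ (strongly real rings): $\mathcal{A}frnz$, the rules making $x>0$ equivalent to $x\ge0\wedge\exists z\,zx=1$, and the Fr rules; $\mathcal{C}o$ (non-discrete ordered fields): $\mathcal{C}o0$ with the Fr rules; $\mathcal{C}odsup^{\mathrm{Fr}}$ and $\mathcal{C}rcdsup^{\mathrm{Fr}}$: $\mathcal{C}odsup$ and $\mathcal{C}rcdsup$ with the Fr rules. **Theorem.** In each of the following items, all the theories listed prove exactly the same algebraic rules formulated in the indicated signature. 1. Signature $(\cdot=0,\cdot\ge0;+,\times,-,0,1)$: $\mathcal{A}onz$, $\mathcal{C}rcdsup$ and the intermediate theories, for example $\mathcal{A}frnz$, $\mathcal{A}tonz$, $\mathcal{C}od$, $\mathcal{C}o0$. 2. Signature $(\cdot=0,\cdot\ge0,\cdot>0;+,\times,-,0,1)$: $\mathcal{A}sonz$, $\mathcal{C}rcdsup$ and the intermediate theories, for example $\mathcal{A}srnz$, $\mathcal{C}od$, $\mathcal{C}o0$. 3. Signature $(\cdot=0,\cdot\ge0;+,\times,\vee,-,0,1)$: $\mathcal{A}frnz$, $\mathcal{C}rcdsup$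 and the intermediate theories, for example $\mathcal{A}srnz$, $\mathcal{C}o0$. 4. Signature $(\cdot=0,\cdot\ge0,\cdot>0;+,\times,\vee,-,0,1)$: $\mathcal{A}srnz$, $\mathcal{C}rcdsup$ and the intermediate theories, for example $\mathcal{C}o0$, $\mathcal{C}o$, $\mathcal{C}odsup$. 5. Signature $(\cdot=0,\cdot\ge0;+,\times,\vee,-,\mathrm{Fr},0,1)$, and also this signature with $\cdot>0$ added: $\mathcal{A}ftr$, $\mathcal{C}rcdsup^{\mathrm{Fr}}$ and the intermediate theories, for example $\mathcal{C}o$ and $\mathcal{C}odsup^{\mathrm{Fr}}$. In items 1 to 4 "intermediate" means intermediate between the first theory of the item and $\mathcal{C}rcdsup$ or $\mathcal{C}rcdsup^{\mathrm{Fr}}$. -/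

import Mathlib

namespace DynAlg

/-! ### Signatures, terms, atomic formulas -/

/-- A signature containing the unary predicates `· = 0`, `· ≥ 0` and the function symbols
`+`, `×`, `-`, `0`, `1`; the three flags say whether the predicate `· > 0`, the binary function
symbol `∨` and the binary function symbol `Fr` are present as well. There is one sort. -/
structure Sig where
  hasPos : Bool
  hasSup : Bool
  hasFr : Bool

/-- Inclusion of signatures. -/
instance : LE Sig where
  le S S' := (S.hasPos = true → S'.hasPos = true) ∧ (S.hasSup = true → S'.hasSup = true) ∧
    (S.hasFr = true → S'.hasFr = true)

/-- Terms of the signature `S` with variables in `V`. -/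
inductive Term (S : Sig) (V : Type) : Type where
  | var (v : V) : Term S V
  | zero : Term S V
  | one : Term S V
  | neg (a : Term S V) : Term S V
  | add (a b : Term S V) : Term S V
  | mul (a b : Term S V) : Term S V
  | sup (h : S.hasSup = true) (a b : Term S V) : Term S V
  | fr (h : S.hasFr = true) (a b : Term S V) : Term S V

namespace Term

variable {S S' : Sig} {V W : Type}

instance : Zero (Term S V) := ⟨zero⟩
instance : One (Term S V) := ⟨one⟩
instance : Neg (Term S V) := ⟨neg⟩
instance : Add (Term S V) := ⟨add⟩
instance : Mul (Term S V) := ⟨mul⟩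
/-- `a - b` abbreviates `a + (-b)`. -/
instance : Sub (Term S V) := ⟨fun a b => a + -b⟩

/-- Simultaneous substitution of terms for the variables. -/
def subst (σ : V → Term S W) : Term S V → Term S W
  | var v => σ v
  | zero => zero
  | one => one
  | neg a => neg (a.subst σ)
  | add a b => add (a.subst σ) (b.subst σ)
  | mul a b => mul (a.subst σ) (b.subst σ)
  | sup h a b => sup h (a.subst σ) (b.subst σ)
  | fr h a b => fr h (a.subst σ) (b.subst σ)

/-- A term of `S` read as a term of a larger signature `S'`. -/
def map (h : S ≤ S') : Term S V → Term S' V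
  | var v => var v
  | zero => zero
  | one => one
  | neg a => neg (a.map h)
  | add a b => add (a.map h) (b.map h)
  | mul a b => mul (a.map h) (b.map h)
  | sup k a b => sup (h.2.1 k) (a.map h) (b.map h)
  | fr k a b => fr (h.2.2 k) (a.map h) (b.map h)

/-- `a ∧ b` abbreviates `-(-a ∨ -b)`. -/
def inf (h : S.hasSup = true) (a b : Term S V) : Term S V := -(sup h (-a) (-b))

/-- `|a|` abbreviates `a ∨ -a`. -/
def abs (h : S.hasSup = true) (a : Term S V) : Term S V := sup h a (-a)

/-- `a⁺` abbreviates `a ∨ 0`. -/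
def pos (h : S.hasSup = true) (a : Term S V) : Term S V := sup h a 0

/-- `a ^ n`. -/
def npow (a : Term S V) : ℕ → Term S V
  | 0 => 1
  | n + 1 => npow a n * a

/-- `c 0 + c 1 * t + ⋯ + c n * t ^ n`. -/
def poly (c : ℕ → Term S V) (t : Term S V) : ℕ → Term S V
  | 0 => c 0
  | n + 1 => poly c t n + c (n + 1) * npow t (n + 1)

end Term

/-- Atomic formulas `t = 0`, `t ≥ 0`, and `t > 0` if this predicate is in the signature. -/
inductive Atom (S : Sig) (V : Type) : Type where
  | eqZero (t : Term S V) : Atom S V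
  | nonneg (t : Term S V) : Atom S V
  | pos (h : S.hasPos = true) (t : Term S V) : Atom S V

namespace Atom

variable {S S' : Sig} {V W : Type}

def subst (σ : V → Term S W) : Atom S V → Atom S W
  | eqZero t => eqZero (t.subst σ)
  | nonneg t => nonneg (t.subst σ)
  | pos h t => pos h (t.subst σ)

def map (h : S ≤ S') : Atom S V → Atom S' V
  | eqZero t => eqZero (t.map h)
  | nonneg t => nonneg (t.map h)
  | pos k t => pos (h.1 k) (t.map h)

/-- `a = b` abbreviates `a - b = 0`. -/
def eq (a b : Term S V) : Atom S V := eqZero (a - b)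

/-- `a ≥ b` abbreviates `a - b ≥ 0`. -/
def ge (a b : Term S V) : Atom S V := nonneg (a - b)

/-- `a ≤ b` abbreviates `b ≥ a`. -/
def le (a b : Term S V) : Atom S V := ge b a

/-- `a < b` abbreviates `b - a > 0`. -/
def lt (h : S.hasPos = true) (a b : Term S V) : Atom S V := pos h (b - a)

end Atom

/-! ### Dynamical rules, dynamical theories, dynamical proofs -/

/-- A disjunct `∃ y₁, …, yₖ Δ` of the right-hand side of a dynamical rule: the bound variables
are `Sum.inr i`, the free ones `Sum.inl v`. -/
structure Branch (S : Sig) (V : Type) where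
  k : ℕ
  atoms : List (Atom S (V ⊕ Fin k))

/-- A dynamical rule `Γ ⊢ ∃ y¹ Δ₁ or … or ∃ yᵐ Δₘ`; the empty disjunction is `⊥`. -/
structure Rule (S : Sig) (V : Type) where
  hyps : List (Atom S V)
  concl : List (Branch S V)

namespace Branch

variable {S S' : Sig} {V W : Type}

/-- The atomic formulas of a disjunct after substitution for the free variables; the bound
variables are left alone. -/
def inst (σ : V → Term S W) (B : Branch S V) : List (Atom S (W ⊕ Fin B.k)) :=
  B.atoms.map (Atom.subst
    (Sum.elim (fun v => (σ v).subst (fun u => Term.var (Sum.inl u)))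
      (fun i => Term.var (Sum.inr i))))

/-- Substitution for the free variables of a disjunct. -/
abbrev subst (σ : V → Term S W) (B : Branch S V) : Branch S W := ⟨B.k, B.inst σ⟩

def map (h : S ≤ S') (B : Branch S V) : Branch S' V where
  k := B.k
  atoms := B.atoms.map (Atom.map h)

end Branch

namespace Rule

variable {S S' : Sig} {V : Type}

def map (h : S ≤ S') (r : Rule S V) : Rule S' V where
  hyps := r.hyps.map (Atom.map h)
  concl := r.concl.map (Branch.map h)

/-- A rule is algebraic if neither "or", nor `∃`, nor `⊥` occurs in its right-hand side. -/
def IsAlgebraic (r : Rule S V) : Prop := ∃ B : Branch S V, r.concl = [B] ∧ B.k = 0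

/-- The disjunct consisting of the list `Δ`, without bound variables. -/
def plain (Δ : List (Atom S V)) : Branch S V :=
  ⟨0, Δ.map (Atom.subst (fun v => Term.var (Sum.inl v)))⟩

/-- The algebraic rule `Γ ⊢ Δ`. -/
def alg (Γ Δ : List (Atom S V)) : Rule S V := ⟨Γ, [plain Δ]⟩

/-- The rule `Γ ⊢ Δ₁ or Δ₂`. -/
def disj (Γ Δ₁ Δ₂ : List (Atom S V)) : Rule S V := ⟨Γ, [plain Δ₁, plain Δ₂]⟩

/-- The rule `Γ ⊢ ∃ y Δ(y)`. The argument of `Δ` stands for the bound variable, and its first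
argument makes terms in the free variables available in the scope of `∃ y`. -/
def ex (Γ : List (Atom S V))
    (Δ : (Term S V → Term S (V ⊕ Fin 1)) → Term S (V ⊕ Fin 1) → List (Atom S (V ⊕ Fin 1))) :
    Rule S V :=
  ⟨Γ, [⟨1, Δ (Term.subst (fun v => Term.var (Sum.inl v))) (Term.var (Sum.inr 0))⟩]⟩

end Rule

/-- The variables used to write down axioms. -/
def x {S : Sig} : Term S ℕ := .var 0
def y {S : Sig} : Term S ℕ := .var 1
def z {S : Sig} : Term S ℕ := .var 2
def w {S : Sig} : Term S ℕ := .var 3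

open Atom Rule

/-- The rules for equality, present in every theory: equality is an equivalence relation which is
compatible with all function symbols and predicates of the signature. -/
def eqRules (S : Sig) : Set (Rule S ℕ) :=
  {alg [] [eq x x],
   alg [eq x y] [eq y x],
   alg [eq x y, eq y z] [eq x z],
   alg [eq x y] [eq (-x) (-y)],
   alg [eq x y, eq z w] [eq (x + z) (y + w)],
   alg [eq x y, eq z w] [eq (x * z) (y * w)],
   alg [eq x y, eqZero x] [eqZero y],
   alg [eq x y, nonneg x] [nonneg y]} ∪
  {r | ∃ h : S.hasSup = true, r = alg [eq x y, eq z w] [eq (.sup h x z) (.sup h y w)]} ∪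
  {r | ∃ h : S.hasFr = true, r = alg [eq x y, eq z w] [eq (.fr h x z) (.fr h y w)]} ∪
  {r | ∃ h : S.hasPos = true, r = alg [eq x y, pos h x] [pos h y]}

/-- A dynamical theory: a signature and a set of dynamical rules in it, the axioms. -/
structure Theory where
  sig : Sig
  axioms : Set (Rule sig ℕ)

namespace Theory

/-- `T.Derives Γ C`: there is a dynamical proof, in the theory `T`, of the rule `Γ ⊢ C`.
A dynamical proof is a finite tree whose nodes carry lists of atomic formulas, with `Γ` at the
root. At a node one applies an axiom, with terms substituted for its free variables, whose
hypotheses all occur in the list of the node: one branch is opened for every disjunct of the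
conclusion of the axiom, fresh variables are introduced for the bound variables of this disjunct
and its atomic formulas are appended to the list. (An axiom with conclusion `⊥` closes the node.)
A node is a leaf if its list contains one of the disjuncts of `C`, with suitable terms
substituted for the bound variables of this disjunct. -/
inductive Derives (T : Theory) :
    {V : Type} → List (Atom T.sig V) → List (Branch T.sig V) → Prop where
  | leaf {V : Type} {Γ : List (Atom T.sig V)} {C : List (Branch T.sig V)}
      (B : Branch T.sig V) (hB : B ∈ C) (t : Fin B.k → Term T.sig V)
      (h : ∀ A ∈ B.atoms, A.subst (Sum.elim Term.var t) ∈ Γ) : Derives T Γ C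
  | step {V : Type} {Γ : List (Atom T.sig V)} {C : List (Branch T.sig V)}
      (r : Rule T.sig ℕ) (hr : r ∈ T.axioms ∪ eqRules T.sig) (σ : ℕ → Term T.sig V)
      (h : ∀ A ∈ r.hyps, A.subst σ ∈ Γ)
      (next : ∀ B ∈ r.concl, Derives T (V := V ⊕ Fin B.k)
        (Γ.map (Atom.subst (fun v => Term.var (Sum.inl v))) ++ B.inst σ)
        (C.map (Branch.subst (fun v => Term.var (Sum.inl v))))) : Derives T Γ C

/-- The rule `r` is valid (i.e. provable) in the theory `T`. -/
def Proves (T : Theory) (r : Rule T.sig ℕ) : Prop := T.Derives r.hyps r.concl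

/-- `T₁ ≤ T₂`: the theory `T₂` extends `T₁`, i.e. it has a larger signature and it proves the
axioms of `T₁`. -/
instance : LE Theory where
  le T₁ T₂ := ∃ h : T₁.sig ≤ T₂.sig, ∀ r ∈ T₁.axioms, T₂.Proves (r.map h)

end Theory

/-- The theories in the family `F` all prove the same algebraic rules formulated in the
signature `S` (which is contained in the signature of each of them). -/
def ProveSameAlgebraicRules (S : Sig) (F : Set Theory) : Prop :=
  ∀ T₁ ∈ F, ∀ T₂ ∈ F, ∃ (h₁ : S ≤ T₁.sig) (h₂ : S ≤ T₂.sig),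
    ∀ r : Rule S ℕ, r.IsAlgebraic → (T₁.Proves (r.map h₁) ↔ T₂.Proves (r.map h₂))

/-- The theories intermediate between `T₁` and `T₂`: they extend `T₁` and are extended by `T₂`. -/
def between (T₁ T₂ : Theory) : Set Theory := {T | T₁ ≤ T ∧ T ≤ T₂}

/-! ### Lists of axioms -/

section Axioms

variable (S : Sig)

/-- Commutative rings: the identities of commutative rings, and the rules **ac0**, **ac1**,
**ac2** for `· = 0`. -/
def acAx : Set (Rule S ℕ) :=
  {alg [] [eq ((x + y) + z) (x + (y + z))],
   alg [] [eq (x + y) (y + x)],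
   alg [] [eq (x + 0) x],
   alg [] [eq (x + -x) 0],
   alg [] [eq ((x * y) * z) (x * (y * z))],
   alg [] [eq (x * y) (y * x)],
   alg [] [eq (x * 1) x],
   alg [] [eq (x * (y + z)) (x * y + x * z)],
   alg [] [eqZero 0],
   alg [eqZero x] [eqZero (x * y)],
   alg [eqZero x, eqZero y] [eqZero (x + y)]}

/-- Preordered rings: **gao1**, **gao2**, **ao1**, **ao2**. -/
def apoAx : Set (Rule S ℕ) := acAx S ∪
  {alg [eqZero x] [nonneg x],
   alg [nonneg x, nonneg y] [nonneg (x + y)],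
   alg [] [nonneg (x * x)],
   alg [nonneg x, nonneg y] [nonneg (x * y)]}

/-- **Gao**: `x ≥ 0, x ≤ 0 ⊢ x = 0`. -/
def ruleGao : Rule S ℕ := alg [nonneg x, le x 0] [eqZero x]

/-- **Anz**: `x² = 0 ⊢ x = 0`. -/
def ruleAnz : Rule S ℕ := alg [eqZero (x * x)] [eqZero x]

/-- **Aonz**: `c ≥ 0, x(x² + c) ≥ 0 ⊢ x ≥ 0`. -/
def ruleAonz : Rule S ℕ := alg [nonneg y, nonneg (x * (x * x + y))] [nonneg x]

/-- **OT**: `⊢ x ≥ 0 or x ≤ 0`. -/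
def ruleOT : Rule S ℕ := disj [] [nonneg x] [le x 0]

/-- Ordered rings. -/
def aoAx : Set (Rule S ℕ) := apoAx S ∪ {ruleGao S}

section Pos

variable (p : S.hasPos = true)

/-- **aso1** to **aso4**. -/
def asoDirect : Set (Rule S ℕ) :=
  {alg [] [pos p 1],
   alg [pos p x] [nonneg x],
   alg [pos p x, nonneg y] [pos p (x + y)],
   alg [pos p x, pos p y] [pos p (x * y)]}

/-- **col**: `0 > 0 ⊢ 1 = 0`. -/
def ruleCol : Rule S ℕ := alg [pos p 0] [eq 1 0]

/-- **lv**: `xy = 1 ⊢ x² > 0`. -/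
def ruleLv : Rule S ℕ := alg [eq (x * y) 1] [pos p (x * x)]

/-- **Aso1**: `x > 0, xy ≥ 0 ⊢ y ≥ 0`. -/
def ruleAso1 : Rule S ℕ := alg [pos p x, nonneg (x * y)] [nonneg y]

/-- **Aso2**: `x ≥ 0, xy > 0 ⊢ y > 0`. -/
def ruleAso2 : Rule S ℕ := alg [nonneg x, pos p (x * y)] [pos p y]

/-- **IV**: `x > 0 ⊢ ∃ y, xy = 1`. -/
def ruleIV : Rule S ℕ := ex [pos p x] fun ι t => [eq (ι x * t) 1]

/-- **ED**: `⊢ x = 0 or x² > 0`. -/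
def ruleED : Rule S ℕ := disj [] [eqZero x] [pos p (x * x)]

/-- **OTF**: `x + y > 0 ⊢ x > 0 or y > 0`. -/
def ruleOTF : Rule S ℕ := disj [pos p (x + y)] [pos p x] [pos p y]

/-- **RCF**, degree `n`: `a < b, P(a)P(b) < 0 ⊢ ∃ t (P(t) = 0, a < t < b)`, where
`P(t) = c₀ + c₁ t + ⋯ + cₙ tⁿ`; here `a`, `b`, `cₖ` are the variables `0`, `1`, `k + 2`. -/
def ruleRCF (n : ℕ) : Rule S ℕ :=
  let c : ℕ → Term S ℕ := fun k => .var (k + 2)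
  ex [lt p x y, lt p (Term.poly c x n * Term.poly c y n) 0] fun ι t =>
    [eqZero (Term.poly (fun k => ι (c k)) t n), lt p (ι x) t, lt p t (ι y)]

/-- Strictly ordered rings: the direct rules for ordered rings with `· > 0`, the collapse rule,
**Gao**, **Aso1** and **Aso2**. -/
def asoAx : Set (Rule S ℕ) :=
  apoAx S ∪ asoDirect S p ∪ {ruleCol S p, ruleGao S, ruleAso1 S p, ruleAso2 S p}

/-- Discrete ordered fields. -/
def codAx : Set (Rule S ℕ) :=
  apoAx S ∪ asoDirect S p ∪
    {ruleCol S p, ruleGao S, ruleLv S p, ruleIV S p, ruleOT S, ruleED S p}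

/-- Discrete real closed fields. -/
def crcdAx : Set (Rule S ℕ) := codAx S p ∪ Set.range (ruleRCF S p)

end Pos

section Sup

variable (s : S.hasSup = true)

/-- **sup1**, **sup2**, **Sup**. -/
def supAx : Set (Rule S ℕ) :=
  {alg [] [ge (.sup s x y) x],
   alg [] [ge (.sup s x y) y],
   alg [ge z x, ge z y] [ge z (.sup s x y)]}

/-- **grl**: `⊢ x + (y ∨ z) = (x + y) ∨ (x + z)`. -/
def ruleGrl : Rule S ℕ := alg [] [eq (x + .sup s y z) (.sup s (x + y) (x + z))]

/-- **afr**: `⊢ x⁺ (y ∨ z) = (x⁺ y) ∨ (x⁺ z)`. -/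
def ruleAfr : Rule S ℕ :=
  alg [] [eq (Term.pos s x * .sup s y z) (.sup s (Term.pos s x * y) (Term.pos s x * z))]

/-- Strongly lattice-ordered rings (f-rings): commutative rings, the lattice-ordered group
identities, **afr**, and the two rules which make `x ≥ 0` an abbreviation of `x ∨ 0 = x`. -/
def afrAx : Set (Rule S ℕ) := acAx S ∪
  {alg [eqZero x] [eq (.sup s (x + y) z) (.sup s y z)],
   alg [eqZero x] [eq (.sup s y (x + z)) (.sup s y z)],
   alg [] [eq (.sup s x x) x],
   alg [] [eq (.sup s x y) (.sup s y x)],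
   alg [] [eq (.sup s (.sup s x y) z) (.sup s x (.sup s y z))],
   ruleGrl S s,
   ruleAfr S s,
   alg [nonneg x] [eq (.sup s x 0) x],
   alg [eq (.sup s x 0) x] [nonneg x]}

/-- Reduced strongly lattice-ordered rings. -/
def afrnzAx : Set (Rule S ℕ) := afrAx S s ∪ {ruleAnz S}

/-- **fr1**: `⊢ Fr(a, b)|b| = (|a| ∧ |b|)²` and **fr2**: `⊢ 0 ≤ Fr(a, b) ≤ |a| ∧ |b|`. -/
def frAx (f : S.hasFr = true) : Set (Rule S ℕ) :=
  let m : Term S ℕ := Term.inf s (Term.abs s x) (Term.abs s y)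
  {alg [] [eq (.fr f x y * Term.abs s y) (m * m)],
   alg [] [le 0 (.fr f x y), le (.fr f x y) m]}

variable (p : S.hasPos = true)

/-- Strictly lattice-ordered rings. -/
def asrAx : Set (Rule S ℕ) :=
  afrAx S s ∪ asoDirect S p ∪ {ruleCol S p, ruleLv S p, ruleAso1 S p, ruleAso2 S p} ∪ supAx S s

/-- The minimal theory of non-discrete ordered fields. -/
def co0Ax : Set (Rule S ℕ) :=
  apoAx S ∪ asoDirect S p ∪ supAx S s ∪
    {ruleGrl S s, ruleAfr S s, ruleGao S, ruleAnz S, ruleAonz S, ruleLv S p, ruleAso1 S p,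
      ruleAso2 S p, ruleIV S p, ruleOTF S p}

/-- Strongly real rings: reduced strongly lattice-ordered rings, the rules which make `x > 0` an
abbreviation of `x ≥ 0 ∧ ∃ z, zx = 1`, **fr1** and **fr2**. -/
def aftrAx (f : S.hasFr = true) : Set (Rule S ℕ) :=
  afrnzAx S s ∪
    {alg [pos p x] [nonneg x],
     ex [pos p x] fun ι t => [eq (t * ι x) 1],
     alg [nonneg x, eq (z * x) 1] [pos p x]} ∪ frAx S s f

end Sup

end Axioms

/-! ### The signatures and the theories -/

/-- `(· = 0, · ≥ 0 ; +, ×, -, 0, 1)` -/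
def sigA : Sig := ⟨false, false, false⟩
/-- `(· = 0, · ≥ 0, · > 0 ; +, ×, -, 0, 1)` -/
def sigAPos : Sig := ⟨true, false, false⟩
/-- `(· = 0, · ≥ 0 ; +, ×, ∨, -, 0, 1)` -/
def sigASup : Sig := ⟨false, true, false⟩
/-- `(· = 0, · ≥ 0, · > 0 ; +, ×, ∨, -, 0, 1)` -/
def sigAPosSup : Sig := ⟨true, true, false⟩
/-- `(· = 0, · ≥ 0 ; +, ×, ∨, -, Fr, 0, 1)` -/
def sigASupFr : Sig := ⟨false, true, true⟩
/-- `(· = 0, · ≥ 0, · > 0 ; +, ×, ∨, -, Fr, 0, 1)` -/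
def sigAPosSupFr : Sig := ⟨true, true, true⟩

/-- Strictly reduced ordered rings. -/
def Aonz : Theory := ⟨sigA, aoAx sigA ∪ {ruleAonz sigA}⟩

/-- Reduced totally ordered rings. -/
def Atonz : Theory := ⟨sigA, aoAx sigA ∪ {ruleOT sigA, ruleAnz sigA}⟩

/-- Reduced strictly ordered rings. -/
def Asonz : Theory := ⟨sigAPos, asoAx sigAPos rfl ∪ {ruleAonz sigAPos}⟩

/-- Discrete ordered fields. -/
def Cod : Theory := ⟨sigAPos, codAx sigAPos rfl⟩

/-- Reduced strongly lattice-ordered rings. -/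
def Afrnz : Theory := ⟨sigASup, afrnzAx sigASup rfl⟩

/-- Reduced strictly lattice-ordered rings. -/
def Asrnz : Theory := ⟨sigAPosSup, asrAx sigAPosSup rfl rfl ∪ {ruleAnz sigAPosSup}⟩

/-- The minimal theory of non-discrete ordered fields. -/
def Co0 : Theory := ⟨sigAPosSup, co0Ax sigAPosSup rfl rfl⟩

/-- Discrete ordered fields with sup. -/
def Codsup : Theory := ⟨sigAPosSup, codAx sigAPosSup rfl ∪ supAx sigAPosSup rfl⟩

/-- Discrete real closed fields with sup. -/
def Crcdsup : Theory := ⟨sigAPosSup, crcdAx sigAPosSup rfl ∪ supAx sigAPosSup rfl⟩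

/-- Strongly real rings. -/
def Aftr : Theory := ⟨sigAPosSupFr, aftrAx sigAPosSupFr rfl rfl rfl⟩

/-- Non-discrete ordered fields. -/
def Co : Theory := ⟨sigAPosSupFr, co0Ax sigAPosSupFr rfl rfl ∪ frAx sigAPosSupFr rfl rfl⟩

/-- Discrete ordered fields with sup and `Fr`. -/
def CodsupFr : Theory :=
  ⟨sigAPosSupFr, codAx sigAPosSupFr rfl ∪ supAx sigAPosSupFr rfl ∪ frAx sigAPosSupFr rfl rfl⟩

/-- Discrete real closed fields with sup and `Fr`. -/
def CrcdsupFr : Theory :=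
  ⟨sigAPosSupFr, crcdAx sigAPosSupFr rfl ∪ supAx sigAPosSupFr rfl ∪ frAx sigAPosSupFr rfl rfl⟩

end DynAlg

/-! Everything rests on one completeness statement: an algebraic rule that holds in every ordered
field with the intermediate value property for polynomials is provable in the weakest theory of its
item. All theories of an item extend that weakest one and have axioms true in those fields. So a
rule provable in any of them is true in the fields, hence provable in the weakest theory, and proofs
there translate upwards. `proveSameAlgebraicRules` is this sandwich.

Completeness has a syntactic half. The terms modulo equality provable from `Γ` form a commutative
ring, in which an atomic formula holds at the tautological valuation exactly when it is derivable.
This structure satisfies every algebraic rule valid in the theory, though possibly not the axioms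
with "or" or `∃`. Hence semantic reasoning in such structures yields dynamical proofs
(`derives_of_models`).

The algebraic half starts from a reduced structure in which `a ≥ 0` fails. The cone of nonnegative
elements, enlarged by `-a`, contains no `-s * a ^ (2 * m)` with `s > 0`, because an identity `s * a
^ (2 * m) + p = q * a` would force `a ≥ 0` by **Aonz** and **Aso1** (`Preord.nonneg_of_mul_eq`). The
prime cone theorem enlarges it to a prime cone, which orders the fraction field of a residue domain.
A maximal ordered subfield of the algebraic closure has the intermediate value property, and `a` is
negative in it (`exists_hom_neg`). A failure of `a > 0` is treated likewise with **Aso2**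
(`exists_hom_nonpos`), and `a = 0` splits into two inequalities by **Gao**. These homomorphisms send
`∨` to the maximum, since `(a ∨ b - a)(a ∨ b - b) = 0` in an f-ring, and the Fr rules determine
`Fr`.

It remains to see that the models of the algebraic rules of each theory are reduced. Where the
axioms contain "or" or `∃`, short dynamical proofs by cases or with inverses supply the missing
algebraic rules. -/

section

/-! ### Cones and prime cones in commutative rings -/

open Polynomial

/-- A subset of a commutative ring containing the squares, closed under sums and products. -/
structure IsCone {R : Type*} [CommRing R] (T : Set R) : Prop where
  add : ∀ {a b}, a ∈ T → b ∈ T → a + b ∈ T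
  mul : ∀ {a b}, a ∈ T → b ∈ T → a * b ∈ T
  sq : ∀ a, a * a ∈ T

namespace IsCone

variable {R : Type*} [CommRing R] {T : Set R}

theorem zero (hT : IsCone T) : (0 : R) ∈ T := by simpa using hT.sq 0

theorem one (hT : IsCone T) : (1 : R) ∈ T := by simpa using hT.sq 1

/-- The cone generated by a cone and one further element. -/
theorem adjoin (hT : IsCone T) (b : R) : IsCone {x | ∃ p ∈ T, ∃ q ∈ T, x = p + q * b} where
  add := by
    rintro _ _ ⟨p, hp, q, hq, rfl⟩ ⟨p', hp', q', hq', rfl⟩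
    exact ⟨p + p', hT.add hp hp', q + q', hT.add hq hq', by ring⟩
  mul := by
    rintro _ _ ⟨p, hp, q, hq, rfl⟩ ⟨p', hp', q', hq', rfl⟩
    exact ⟨p * p' + q * q' * (b * b),
      hT.add (hT.mul hp hp') (hT.mul (hT.mul hq hq') (hT.sq b)), p * q' + q * p',
      hT.add (hT.mul hp hq') (hT.mul hq hp'), by ring⟩
  sq := fun a => ⟨a * a, hT.sq a, 0, hT.zero, by ring⟩

theorem subset_adjoin (hT : IsCone T) (b : R) : T ⊆ {x | ∃ p ∈ T, ∃ q ∈ T, x = p + q * b} :=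
  fun p hp => ⟨p, hp, 0, hT.zero, by ring⟩

theorem mem_adjoin (hT : IsCone T) (b : R) : b ∈ {x | ∃ p ∈ T, ∃ q ∈ T, x = p + q * b} :=
  ⟨0, hT.zero, 1, hT.one, by ring⟩

theorem sUnion {c : Set (Set R)} (hc : IsChain (· ⊆ ·) c) (hne : c.Nonempty)
    (h : ∀ T ∈ c, IsCone T) : IsCone (⋃₀ c) where
  add := by
    rintro a b ⟨S, hS, ha⟩ ⟨S', hS', hb⟩
    rcases hc.total hS hS' with hl | hl
    · exact ⟨S', hS', (h _ hS').add (hl ha) hb⟩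
    · exact ⟨S, hS, (h _ hS).add ha (hl hb)⟩
  mul := by
    rintro a b ⟨S, hS, ha⟩ ⟨S', hS', hb⟩
    rcases hc.total hS hS' with hl | hl
    · exact ⟨S', hS', (h _ hS').mul (hl ha) hb⟩
    · exact ⟨S, hS, (h _ hS).mul ha (hl hb)⟩
  sq := fun a => by
    obtain ⟨S, hS⟩ := hne
    exact ⟨S, hS, (h _ hS).sq a⟩

end IsCone

/-- A cone containing `x` or `-x` for each `x`, with a prime support. -/
structure IsPrimeCone {R : Type*} [CommRing R] (T : Set R) : Prop extends IsCone T where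
  total : ∀ x, x ∈ T ∨ -x ∈ T
  neg_one : (-1 : R) ∉ T
  prime : ∀ {x y}, x * y ∈ T → -(x * y) ∈ T → (x ∈ T ∧ -x ∈ T) ∨ (y ∈ T ∧ -y ∈ T)

/-- The prime cone theorem: a cone which avoids the opposites of a submonoid contained in it can
be enlarged to a prime cone with the same property. -/
theorem exists_isPrimeCone {R : Type*} [CommRing R] {T : Set R} (hT : IsCone T)
    (N : Submonoid R) (hN : ∀ n ∈ N, n ∈ T) (hneg : ∀ n ∈ N, -n ∉ T) :
    ∃ M, T ⊆ M ∧ IsPrimeCone M ∧ ∀ n ∈ N, -n ∉ M := by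
  obtain ⟨M, hTM, hM⟩ := zorn_subset_nonempty {M : Set R | IsCone M ∧ ∀ n ∈ N, -n ∉ M}
    (by
      intro c hc hch hne
      refine ⟨⋃₀ c, ⟨IsCone.sUnion hch hne fun S hS => (hc hS).1, ?_⟩,
        fun S hS => Set.subset_sUnion_of_mem hS⟩
      rintro n hn ⟨S, hS, h⟩
      exact (hc hS).2 n hn h) T ⟨hT, hneg⟩
  have hC : IsCone M := hM.prop.1
  have hNM : ∀ n ∈ N, n ∈ M := fun n hn => hTM (hN n hn)
  -- By maximality, adjoining an element outside `M` must produce the opposite of some element of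
  -- `N`.
  have key : ∀ b, b ∉ M → ∃ n ∈ N, ∃ p ∈ M, ∃ q ∈ M, -n = p + q * b := by
    intro b hb
    by_contra hcon
    push Not at hcon
    have h := hM.eq_of_subset (t := {x | ∃ p ∈ M, ∃ q ∈ M, x = p + q * b})
      ⟨hC.adjoin b, fun n hn => by
        rintro ⟨p, hp, q, hq, h⟩
        exact hcon n hn p hp q hq h⟩ (hC.subset_adjoin b)
    exact hb (h ▸ hC.mem_adjoin b)
  have htot : ∀ x, x ∈ M ∨ -x ∈ M := by
    intro x
    by_contra hcon
    push Not at hcon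
    obtain ⟨n, hn, p, hp, q, hq, h⟩ := key _ hcon.1
    obtain ⟨n', hn', p', hp', q', hq', h'⟩ := key _ hcon.2
    refine hM.prop.2 (n * n') (N.mul_mem hn hn') ?_
    -- Multiply `n + p = -(q * x)` by `n' + p' = q' * x`.
    have : -(n * n') = (n * p' + p * n' + p * p') + q * q' * (x * x) := by
      linear_combination (n' + p') * h - q * x * h'
    rw [this]
    exact hC.add (hC.add (hC.add (hC.mul (hNM n hn) hp') (hC.mul hp (hNM n' hn')))
      (hC.mul hp hp')) (hC.mul (hC.mul hq hq') (hC.sq x))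
  refine ⟨M, hTM, ⟨hC, htot, by simpa using hM.prop.2 1 N.one_mem, ?_⟩, hM.prop.2⟩
  -- Here `n + p = q * x` and `n' + p' = q' * y`; their product expresses `-(n * n')` through
  -- elements of `M` and `-(x * y)`.
  have aux : ∀ x y, x * y ∈ M → -x ∉ M → -y ∉ M → -(x * y) ∉ M := by
    intro x y _ hx hy hxy
    obtain ⟨n, hn, p, hp, q, hq, h⟩ := key _ hx
    obtain ⟨n', hn', p', hp', q', hq', h'⟩ := key _ hy
    refine hM.prop.2 (n * n') (N.mul_mem hn hn') ?_
    have : -(n * n') = (n * p' + p * n' + p * p') + q * q' * (-(x * y)) := by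
      linear_combination (n' + p') * h + q * x * h'
    rw [this]
    exact hC.add (hC.add (hC.add (hC.mul (hNM n hn) hp') (hC.mul hp (hNM n' hn')))
      (hC.mul hp hp')) (hC.mul (hC.mul hq hq') hxy)
  intro x y h1 h2
  by_contra hcon
  -- Off the support one of `±z` is missing from `M`, so signs can be changed in `x` and `y` until
  -- `aux` applies.
  have sgn : ∀ z, ¬ (z ∈ M ∧ -z ∈ M) → (-z ∉ M ∨ - -z ∉ M) := by
    intro z hz
    by_contra h
    push Not at h
    exact hz ⟨by simpa using h.2, h.1⟩
  rw [not_or] at hcon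
  rcases sgn x hcon.1 with hx | hx <;> rcases sgn y hcon.2 with hy | hy
  · exact aux x y h1 hx hy h2
  · exact aux x (-y) (by simpa using h2) hx hy (by simpa using h1)
  · exact aux (-x) y (by simpa using h2) hx hy (by simpa using h1)
  · exact aux (-x) (-y) (by simpa using h1) hx hy (by simpa using h2)

/-! ### Polynomials changing sign in an ordered field -/

/-- The intermediate value property for polynomials. -/
def PolyIVT (E : Type*) [Field E] [LinearOrder E] : Prop :=
  ∀ (p : E[X]) (a b : E), a < b → p.eval a * p.eval b < 0 → ∃ t, p.eval t = 0 ∧ a < t ∧ t < b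

section IVT

variable {E : Type*} [Field E] [LinearOrder E] [IsStrictOrderedRing E]

/-- The sums of squares of polynomials with nonnegative coefficients. -/
noncomputable def weightedSquares (E : Type*) [Field E] [LinearOrder E] : AddSubmonoid E[X] :=
  AddSubmonoid.closure {f | ∃ c : E, 0 ≤ c ∧ ∃ g : E[X], f = C c * (g * g)}

/-- This is the smallest cone containing the nonnegative constants and the multiples of `p`. A prime
cone above it orders the quotient by an irreducible `p`, compatibly with `E`. -/
theorem isCone_weightedSquares_add (p : E[X]) :
    IsCone {f : E[X] | ∃ s ∈ weightedSquares E, ∃ h, f = s + p * h} where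
  add := by
    rintro _ _ ⟨s, hs, h, rfl⟩ ⟨s', hs', h', rfl⟩
    exact ⟨s + s', add_mem hs hs', h + h', by ring⟩
  mul := by
    rintro _ _ ⟨s, hs, h, rfl⟩ ⟨s', hs', h', rfl⟩
    refine ⟨s * s', ?_, s * h' + h * s' + p * h * h', by ring⟩
    induction hs, hs' using AddSubmonoid.closure_induction₂ with
    | mem f g hf hg =>
      obtain ⟨c, hc, u, rfl⟩ := hf
      obtain ⟨d, hd, v, rfl⟩ := hg
      exact AddSubmonoid.subset_closure ⟨c * d, mul_nonneg hc hd, u * v, by rw [C_mul]; ring⟩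
    | zero_left => simp
    | zero_right => simp
    | add_left f g k _ _ _ h1 h2 => rw [add_mul]; exact add_mem h1 h2
    | add_right f g k _ _ _ h1 h2 => rw [mul_add]; exact add_mem h1 h2
  sq := fun a => ⟨a * a, AddSubmonoid.subset_closure ⟨1, zero_le_one, a, by simp⟩, 0, by simp⟩

/-- Each square is replaced by the square of a remainder modulo `p`. The degree bound makes the
cofactor of `p` in a representation of `-1` smaller than `p`, which feeds the induction below. -/
theorem weightedSquares_mod {p : E[X]} (hp : p.natDegree ≠ 0) {s : E[X]}
    (hs : s ∈ weightedSquares E) :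
    ∃ s' h, s = s' + p * h ∧ s'.natDegree ≤ 2 * (p.natDegree - 1) ∧ ∀ t, 0 ≤ s'.eval t := by
  induction hs using AddSubmonoid.closure_induction with
  | mem f hf =>
    obtain ⟨c, hc, g, rfl⟩ := hf
    refine ⟨C c * ((g % p) * (g % p)), C c * (2 * (g % p) * (g / p) + p * (g / p) * (g / p)),
      ?_, ?_, fun t => ?_⟩
    · have := EuclideanDomain.mod_add_div g p
      calc C c * (g * g) = C c * ((g % p + p * (g / p)) * (g % p + p * (g / p))) := by rw [this]
        _ = _ := by ring
    · have h1 : (g % p).natDegree ≤ p.natDegree - 1 :=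
        Nat.le_sub_one_of_lt (natDegree_mod_lt g hp)
      calc _ ≤ ((g % p) * (g % p)).natDegree := natDegree_C_mul_le _ _
        _ ≤ (g % p).natDegree + (g % p).natDegree := natDegree_mul_le
        _ ≤ _ := by omega
    · simpa using mul_nonneg hc (mul_self_nonneg ((g % p).eval t))
  | zero => exact ⟨0, 0, by simp, by simp, by simp⟩
  | add f g _ _ hf hg =>
    obtain ⟨s, h, rfl, h1, h2⟩ := hf
    obtain ⟨s', h', rfl, h1', h2'⟩ := hg
    refine ⟨s + s', h + h', by ring, (natDegree_add_le _ _).trans (max_le h1 h1'), fun t => ?_⟩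
    simpa using add_nonneg (h2 t) (h2' t)

/-- Induction on the degree. If `p` factors, one factor changes sign. If `p` is irreducible and `-1`
is a weighted sum of squares modulo `p`, then `p * q = -1 - s'` with `s'` nonnegative everywhere. So
`q` has no root, has smaller degree than `p`, and still changes sign, against the induction
hypothesis. Otherwise a prime cone exists, the hypothesis gives a root, and `p` is linear. -/
theorem polyIVT_of_irreducible
    (H : ∀ p : E[X], Irreducible p → ∀ M : Set E[X], IsPrimeCone M →
      (∀ c : E, 0 ≤ c → C c ∈ M) → (∀ h, p * h ∈ M) → ∃ t, p.eval t = 0) : PolyIVT E := by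
  suffices ∀ n, ∀ p : E[X], p.natDegree = n → ∀ a b, a < b → p.eval a * p.eval b < 0 →
      ∃ t, p.eval t = 0 ∧ a < t ∧ t < b from fun p => this _ p rfl
  intro n
  induction n using Nat.strong_induction_on with
  | _ n ih =>
  intro p hpn a b hab hsgn
  have hp0 : p ≠ 0 := by rintro rfl; simp at hsgn
  have hdeg : p.natDegree ≠ 0 := by
    intro h0
    rw [eq_C_of_natDegree_eq_zero h0] at hsgn
    simp only [eval_C] at hsgn
    exact absurd hsgn (not_lt.2 (mul_self_nonneg _))
  have hunit : ¬ IsUnit p := fun h => hdeg (natDegree_eq_zero_of_isUnit h)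
  by_cases hirr : Irreducible p
  · by_cases hneg : (-1 : E[X]) ∈ {f : E[X] | ∃ s ∈ weightedSquares E, ∃ h, f = s + p * h}
    · obtain ⟨s, hs, h, hsh⟩ := hneg
      obtain ⟨s', h', rfl, hd, hpos⟩ := weightedSquares_mod hdeg hs
      have heq : p * (h + h') = -1 - s' := by linear_combination -hsh
      have hev : ∀ t, p.eval t * (h + h').eval t = -1 - s'.eval t := fun t => by
        rw [← eval_mul, heq]; simp
      have hlt : ∀ t, p.eval t * (h + h').eval t < 0 := fun t => by
        rw [hev]; linarith [hpos t]
      have hq0 : h + h' ≠ 0 := by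
        intro h0
        have := hlt a
        simp [h0] at this
      have hdq : (h + h').natDegree < n := by
        have h1 : (p * (h + h')).natDegree ≤ 2 * (p.natDegree - 1) := by
          rw [heq]
          refine (natDegree_sub_le _ _).trans (max_le ?_ hd)
          simp
        rw [natDegree_mul hp0 hq0] at h1
        omega
      obtain ⟨t, ht, -, -⟩ := ih _ hdq (h + h') rfl a b hab (by
        have h1 := mul_pos_of_neg_of_neg (hlt a) (hlt b)
        by_contra hcon
        have := mul_nonpos_of_nonpos_of_nonneg hsgn.le (not_lt.1 hcon)
        nlinarith)
      have := hlt t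
      simp [ht] at this
    · have hC := isCone_weightedSquares_add p
      -- With the trivial submonoid, only `-1` has to be avoided.
      obtain ⟨M, hTM, hM, -⟩ := exists_isPrimeCone hC ⊥
        (by rintro n hn; rw [Submonoid.mem_bot.1 hn]; exact hC.one)
        (by rintro n hn; rw [Submonoid.mem_bot.1 hn]; exact hneg)
      obtain ⟨t, ht⟩ := H p hirr M hM
        (fun c hc => hTM ⟨C c, AddSubmonoid.subset_closure ⟨c, hc, 1, by simp⟩, 0, by simp⟩)
        (fun h => hTM ⟨0, zero_mem _, h, by simp⟩)
      obtain ⟨q, rfl⟩ := dvd_iff_isRoot.2 ht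
      have hq : IsUnit q := (hirr.isUnit_or_isUnit rfl).resolve_left (not_isUnit_X_sub_C t)
      obtain ⟨c, -, rfl⟩ := Polynomial.isUnit_iff.1 hq
      refine ⟨t, ht, ?_⟩
      simp only [eval_mul, eval_sub, eval_X, eval_C] at hsgn
      have h2 : (a - t) * (b - t) < 0 := by
        by_contra hcon
        nlinarith [mul_nonneg (not_lt.1 hcon) (mul_self_nonneg c)]
      rcases mul_neg_iff.1 h2 with h | h
      · exact absurd hab (by linarith)
      · exact ⟨by linarith, by linarith⟩
  · obtain ⟨q, r, hq, hr, rfl⟩ : ∃ q r, ¬ IsUnit q ∧ ¬ IsUnit r ∧ p = q * r := by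
      by_contra hcon
      push Not at hcon
      exact hirr ⟨hunit, fun q r h => by
        by_contra h'
        rw [not_or] at h'
        exact hcon q r h'.1 h'.2 h⟩
    obtain ⟨hq0, hr0⟩ := mul_ne_zero_iff.1 hp0
    have hdq := natDegree_pos_iff_degree_pos.2 (degree_pos_of_ne_zero_of_nonunit hq0 hq)
    have hdr := natDegree_pos_iff_degree_pos.2 (degree_pos_of_ne_zero_of_nonunit hr0 hr)
    rw [natDegree_mul hq0 hr0] at hpn
    have h3 : (q.eval a * q.eval b) * (r.eval a * r.eval b) < 0 := by
      simp only [eval_mul] at hsgn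
      linarith
    rcases mul_neg_iff.1 h3 with h | h
    · obtain ⟨t, ht, h'⟩ := ih _ (by omega) r rfl a b hab h.2
      exact ⟨t, by simp [ht], h'⟩
    · obtain ⟨t, ht, h'⟩ := ih _ (by omega) q rfl a b hab h.1
      exact ⟨t, by simp [ht], h'⟩

end IVT

end

/-! ### Maximal ordered subfields of an algebraically closed field -/

section

open Polynomial

/-- The nonnegative cone of a subfield of `L` with a linear order. -/
structure IsFieldCone {L : Type*} [Field L] (P : Set L) : Prop where
  zero : 0 ∈ P
  one : 1 ∈ P
  add : ∀ {a b}, a ∈ P → b ∈ P → a + b ∈ P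
  mul : ∀ {a b}, a ∈ P → b ∈ P → a * b ∈ P
  inv : ∀ {a}, a ∈ P → a⁻¹ ∈ P
  eq_zero : ∀ {a}, a ∈ P → -a ∈ P → a = 0
  sub : ∀ {a b}, a ∈ P → b ∈ P → a - b ∈ P ∨ b - a ∈ P

namespace IsFieldCone

variable {L : Type*} [Field L] {P : Set L}

theorem sUnion {c : Set (Set L)} (hc : IsChain (· ⊆ ·) c) (hne : c.Nonempty)
    (h : ∀ T ∈ c, IsFieldCone T) : IsFieldCone (⋃₀ c) := by
  have two : ∀ {a b}, a ∈ ⋃₀ c → b ∈ ⋃₀ c → ∃ S ∈ c, a ∈ S ∧ b ∈ S := by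
    rintro a b ⟨S, hS, ha⟩ ⟨S', hS', hb⟩
    rcases hc.total hS hS' with hl | hl
    · exact ⟨S', hS', hl ha, hb⟩
    · exact ⟨S, hS, ha, hl hb⟩
  obtain ⟨S₀, hS₀⟩ := hne
  refine ⟨⟨S₀, hS₀, (h _ hS₀).zero⟩, ⟨S₀, hS₀, (h _ hS₀).one⟩, ?_, ?_, ?_, ?_, ?_⟩
  · intro a b ha hb
    obtain ⟨S, hS, ha, hb⟩ := two ha hb
    exact ⟨S, hS, (h _ hS).add ha hb⟩
  · intro a b ha hb
    obtain ⟨S, hS, ha, hb⟩ := two ha hb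
    exact ⟨S, hS, (h _ hS).mul ha hb⟩
  · rintro a ⟨S, hS, ha⟩
    exact ⟨S, hS, (h _ hS).inv ha⟩
  · intro a ha hb
    obtain ⟨S, hS, ha, hb⟩ := two ha hb
    exact (h _ hS).eq_zero ha hb
  · intro a b ha hb
    obtain ⟨S, hS, ha, hb⟩ := two ha hb
    exact ((h _ hS).sub ha hb).imp (fun h => ⟨S, hS, h⟩) (fun h => ⟨S, hS, h⟩)

/-- The subfield whose nonnegative cone is given. -/
def subfield (hP : IsFieldCone P) : Subfield L where
  carrier := {x | x ∈ P ∨ -x ∈ P}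
  zero_mem' := Or.inl hP.zero
  one_mem' := Or.inl hP.one
  neg_mem' := by
    rintro x (h | h)
    · exact Or.inr (by simpa using h)
    · exact Or.inl h
  inv_mem' := by
    rintro x (h | h)
    · exact Or.inl (hP.inv h)
    · exact Or.inr (by simpa [inv_neg] using hP.inv h)
  add_mem' := by
    rintro x y (hx | hx) (hy | hy)
    · exact Or.inl (hP.add hx hy)
    · simpa [add_comm, sub_eq_add_neg] using hP.sub hx hy
    · simpa [add_comm, sub_eq_add_neg] using hP.sub hy hx
    · exact Or.inr (by simpa [add_comm] using hP.add hx hy)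
  mul_mem' := by
    rintro x y (hx | hx) (hy | hy)
    · exact Or.inl (hP.mul hx hy)
    · exact Or.inr (by simpa using hP.mul hx hy)
    · exact Or.inr (by simpa using hP.mul hx hy)
    · exact Or.inl (by simpa using hP.mul hx hy)

/-- The order of the subfield. -/
noncomputable abbrev linearOrder (hP : IsFieldCone P) : LinearOrder hP.subfield where
  le x y := (y : L) - x ∈ P
  le_refl x := by simpa using hP.zero
  le_trans x y z h h' := by simpa using hP.add h' h
  le_antisymm x y h h' := by
    have h0 := hP.eq_zero h (by simpa using h')
    exact Subtype.ext (sub_eq_zero.1 h0).symm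
  le_total x y := by
    have := (y - x).2
    rcases this with h | h
    · exact Or.inl h
    · exact Or.inr (by simpa using h)
  toDecidableLE := Classical.decRel _

theorem isStrictOrderedRing (hP : IsFieldCone P) :
    letI := hP.linearOrder
    IsStrictOrderedRing hP.subfield := by
  let := hP.linearOrder
  have : IsOrderedAddMonoid hP.subfield :=
    { add_le_add_left := fun a b h c => by
        change ((b + c : hP.subfield) : L) - (a + c : hP.subfield) ∈ P
        have h' : (b : L) - a ∈ P := h
        simpa using h' }
  have : ZeroLEOneClass hP.subfield :=
    ⟨by change ((1 : hP.subfield) : L) - (0 : hP.subfield) ∈ P; simpa using hP.one⟩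
  refine IsStrictOrderedRing.of_mul_pos fun a b ha hb => ?_
  have ha' : ((a : hP.subfield) : L) - (0 : hP.subfield) ∈ P := ha.le
  have hb' : ((b : hP.subfield) : L) - (0 : hP.subfield) ∈ P := hb.le
  have : (0 : hP.subfield) ≤ a * b := by
    change ((a * b : hP.subfield) : L) - (0 : hP.subfield) ∈ P
    simpa using hP.mul ha' hb'
  exact lt_of_le_of_ne this (mul_ne_zero ha.ne' hb.ne').symm

theorem nonneg_iff (hP : IsFieldCone P) (a : hP.subfield) :
    letI := hP.linearOrder
    0 ≤ a ↔ (a : L) ∈ P := by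
  let := hP.linearOrder
  change ((a : hP.subfield) : L) - (0 : hP.subfield) ∈ P ↔ _
  simp

/-- A field cone which is maximal among those of an algebraically closed field is the cone of a
subfield with the intermediate value property. -/
theorem polyIVT [IsAlgClosed L] (hP : IsFieldCone P) (hmax : ∀ Q, IsFieldCone Q → P ⊆ Q → Q = P) :
    letI := hP.linearOrder
    PolyIVT hP.subfield := by
  let := hP.linearOrder
  have := hP.isStrictOrderedRing
  -- `M` orders the extension of the subfield by a root `α` of `p`. The image of `M` in `L` is thus
  -- a field cone containing `P`, and maximality forces `α` into the subfield already.
  refine polyIVT_of_irreducible fun p hirr M hM hconst hpM => ?_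
  obtain ⟨α, hα⟩ := IsAlgClosed.exists_aeval_eq_zero L p hirr.degree_pos.ne'
  have hdvd : ∀ f, aeval α f = 0 → p ∣ f := by
    intro f hf
    by_contra hnd
    obtain ⟨u, v, huv⟩ := (EuclideanDomain.dvd_or_coprime p f hirr).resolve_left hnd
    have := congrArg (aeval α) huv
    simp [hα, hf] at this
  have hsupp : ∀ f, aeval α f = 0 → f ∈ M := by
    intro f hf
    obtain ⟨h, rfl⟩ := hdvd f hf
    exact hpM h
  have hcongr : ∀ f g, aeval α f = aeval α g → f ∈ M → g ∈ M := by
    intro f g h hf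
    have := hM.add hf (hsupp (g - f) (by simp [h]))
    simpa using this
  -- The support of `M` is no larger than the ideal of `p`: a Bézout relation with an `f` coprime to
  -- `p` would put `-1` into `M`.
  have hzero : ∀ f, f ∈ M → -f ∈ M → aeval α f = 0 := by
    intro f h1 h2
    by_contra hne
    have hnd : ¬ p ∣ f := by
      rintro ⟨h, rfl⟩
      simp [hα] at hne
    obtain ⟨u, v, huv⟩ := (EuclideanDomain.dvd_or_coprime p f hirr).resolve_left hnd
    refine hM.neg_one ?_
    have : (-1 : hP.subfield[X]) = p * (-u) + (-v) * f := by linear_combination huv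
    rw [this]
    refine hM.add (hpM _) ?_
    rcases hM.total v with hv | hv
    · simpa using hM.mul hv h2
    · exact hM.mul hv h1
  have hQ : IsFieldCone ((fun f => aeval α f) '' M) := by
    refine ⟨⟨0, hM.zero, by simp⟩, ⟨1, hM.one, by simp⟩, ?_, ?_, ?_, ?_, ?_⟩
    · rintro _ _ ⟨f, hf, rfl⟩ ⟨g, hg, rfl⟩
      exact ⟨f + g, hM.add hf hg, by simp⟩
    · rintro _ _ ⟨f, hf, rfl⟩ ⟨g, hg, rfl⟩
      exact ⟨f * g, hM.mul hf hg, by simp⟩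
    · rintro _ ⟨f, hf, rfl⟩
      by_cases hnd : p ∣ f
      · obtain ⟨h, rfl⟩ := hnd
        exact ⟨0, hM.zero, by simp [hα]⟩
      · obtain ⟨u, v, huv⟩ := (EuclideanDomain.dvd_or_coprime p f hirr).resolve_left hnd
        have h1 := congrArg (aeval α) huv
        simp only [map_add, map_mul, hα, mul_zero, zero_add, map_one] at h1
        -- `v` inverts `f` modulo `p`, and it is congruent to `v² f`, a square times an element of
        -- `M`.
        refine ⟨v * v * f, hM.mul (hM.sq v) hf, ?_⟩
        simp only [map_mul]
        rw [mul_assoc, h1, mul_one]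
        exact eq_inv_of_mul_eq_one_left h1
    · rintro _ ⟨f, hf, rfl⟩ ⟨g, hg, h⟩
      refine hzero f hf (hcongr g (-f) ?_ hg)
      simpa using h
    · rintro _ _ ⟨f, hf, rfl⟩ ⟨g, hg, rfl⟩
      rcases hM.total (f - g) with h | h
      · exact Or.inl ⟨_, h, by simp⟩
      · exact Or.inr ⟨_, h, by simp⟩
  have hPQ : P ⊆ (fun f => aeval α f) '' M := fun c hc =>
    ⟨C ⟨c, Or.inl hc⟩, hconst _ ((hP.nonneg_iff _).2 hc), by simp; rfl⟩
  have hEq := hmax _ hQ hPQ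
  have hmem : α ∈ hP.subfield := by
    rcases hM.total X with h | h
    · exact Or.inl (hEq ▸ ⟨X, h, by simp⟩)
    · exact Or.inr (hEq ▸ ⟨-X, h, by simp⟩)
  refine ⟨⟨α, hmem⟩, ?_⟩
  have : aeval (algebraMap hP.subfield L ⟨α, hmem⟩) p = 0 := hα
  rw [aeval_algebraMap_apply] at this
  simpa using this

end IsFieldCone

/-- A prime cone gives a homomorphism to an ordered field with the intermediate value property. -/
theorem IsPrimeCone.exists_hom {R : Type} [CommRing R] {M : Set R} (hM : IsPrimeCone M) :
    ∃ (K : Type) (_ : Field K) (_ : LinearOrder K) (_ : IsStrictOrderedRing K),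
      PolyIVT K ∧ ∃ φ : R →+* K, ∀ a, 0 ≤ φ a ↔ a ∈ M := by
  -- The support of `M`. Totality makes it an ideal, and it is prime because `M` is a prime cone.
  let I : Ideal R :=
    { carrier := {x | x ∈ M ∧ -x ∈ M}
      zero_mem' := ⟨hM.zero, by simpa using hM.zero⟩
      add_mem' := by
        rintro a b ⟨ha, ha'⟩ ⟨hb, hb'⟩
        exact ⟨hM.add ha hb, by rw [neg_add]; exact hM.add ha' hb'⟩
      smul_mem' := by
        rintro c a ⟨ha, ha'⟩
        rw [smul_eq_mul]
        rcases hM.total c with hc | hc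
        · exact ⟨hM.mul hc ha, by simpa using hM.mul hc ha'⟩
        · exact ⟨by simpa using hM.mul hc ha', by simpa using hM.mul hc ha⟩ }
  have hI : ∀ a, a ∈ I ↔ a ∈ M ∧ -a ∈ M := fun a => Iff.rfl
  have : I.IsPrime := by
    refine Ideal.isPrime_iff.2 ⟨fun h => hM.neg_one ((Ideal.eq_top_iff_one I).1 h).2, ?_⟩
    intro x y h
    exact hM.prime h.1 h.2
  let L := AlgebraicClosure (FractionRing (R ⧸ I))
  let ψ : R →+* L := (algebraMap (FractionRing (R ⧸ I)) L).comp
    ((algebraMap (R ⧸ I) (FractionRing (R ⧸ I))).comp (Ideal.Quotient.mk I))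
  have hψ : ∀ a, ψ a = 0 ↔ a ∈ M ∧ -a ∈ M := by
    intro a
    rw [← hI, ← Ideal.Quotient.eq_zero_iff_mem]
    simp [ψ]
  -- Fractions of elements of `M` are the nonnegative elements of the fraction field for the induced
  -- order; this is the starting point for Zorn's lemma among the field cones of `L`.
  have hdiv : IsFieldCone {x : L | ∃ a ∈ M, ∃ b ∈ M, ψ b ≠ 0 ∧ x = ψ a / ψ b} := by
    refine ⟨⟨0, hM.zero, 1, hM.one, by simp, by simp⟩, ⟨1, hM.one, 1, hM.one, by simp, by simp⟩,
      ?_, ?_, ?_, ?_, ?_⟩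
    · rintro _ _ ⟨a, ha, b, hb, h, rfl⟩ ⟨a', ha', b', hb', h', rfl⟩
      exact ⟨a * b' + b * a', hM.add (hM.mul ha hb') (hM.mul hb ha'), b * b', hM.mul hb hb',
        by simpa using ⟨h, h'⟩, by rw [div_add_div _ _ h h']; simp⟩
    · rintro _ _ ⟨a, ha, b, hb, h, rfl⟩ ⟨a', ha', b', hb', h', rfl⟩
      exact ⟨a * a', hM.mul ha ha', b * b', hM.mul hb hb', by simpa using ⟨h, h'⟩,
        by rw [div_mul_div_comm]; simp⟩
    · rintro _ ⟨a, ha, b, hb, h, rfl⟩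
      by_cases h0 : ψ a = 0
      · exact ⟨0, hM.zero, 1, hM.one, by simp, by simp [h0]⟩
      · exact ⟨b, hb, a, ha, h0, by simp⟩
    · rintro _ ⟨a, ha, b, hb, h, rfl⟩ ⟨a', ha', b', hb', h', h2⟩
      have h3 : ψ (a * b' + a' * b) = 0 := by
        rw [← neg_div, div_eq_div_iff h h'] at h2
        simp only [map_add, map_mul]
        linear_combination -h2
      have h4 : ψ (a * b') = 0 := by
        refine (hψ _).2 ⟨hM.mul ha hb', ?_⟩
        have := hM.add (hM.mul ha' hb) ((hψ _).1 h3).2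
        convert this using 1
        ring
      simp only [map_mul, mul_eq_zero, h', or_false] at h4
      simp [h4]
    · rintro _ _ ⟨a, ha, b, hb, h, rfl⟩ ⟨a', ha', b', hb', h', rfl⟩
      rcases hM.total (a * b' - b * a') with h2 | h2
      · exact Or.inl ⟨_, h2, b * b', hM.mul hb hb', by simpa using ⟨h, h'⟩,
          by rw [div_sub_div _ _ h h']; simp⟩
      · exact Or.inr ⟨_, h2, b * b', hM.mul hb hb', by simpa using ⟨h, h'⟩,
          by rw [div_sub_div _ _ h' h]; simp; ring⟩
  obtain ⟨P, hsub, hPmax⟩ := zorn_subset_nonempty {P : Set L | IsFieldCone P}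
    (fun c hc hch hne => ⟨⋃₀ c, IsFieldCone.sUnion hch hne hc,
      fun S hS => Set.subset_sUnion_of_mem hS⟩) _ hdiv
  have hP : IsFieldCone P := hPmax.prop
  have hMP : ∀ a ∈ M, ψ a ∈ P := fun a ha => hsub ⟨a, ha, 1, hM.one, by simp, by simp⟩
  have hmem : ∀ a, ψ a ∈ hP.subfield := fun a =>
    (hM.total a).imp (hMP a) (fun h => by simpa using hMP _ h)
  let := hP.linearOrder
  refine ⟨hP.subfield, inferInstance, inferInstance, hP.isStrictOrderedRing,
    hP.polyIVT fun Q hQ hPQ => (hPmax.eq_of_subset hQ hPQ).symm, ψ.codRestrict _ hmem, fun a => ?_⟩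
  rw [hP.nonneg_iff]
  refine ⟨fun h => ?_, hMP a⟩
  -- If `a ∉ M` then `-a ∈ M`, so `ψ a` has both signs and vanishes. Then `a` lies in the support,
  -- which is part of `M`.
  by_contra hna
  have h1 := (hM.total a).resolve_left hna
  have h2 : ψ a = 0 := hP.eq_zero h (by simpa using hMP _ h1)
  exact hna ((hψ a).1 h2).1

/-- Homomorphisms to ordered fields with the intermediate value property that are nonnegative on
a cone and do not vanish on a submonoid contained in it. -/
theorem IsCone.exists_hom {R : Type} [CommRing R] {T : Set R} (hT : IsCone T)
    (N : Submonoid R) (hN : ∀ n ∈ N, n ∈ T) (hneg : ∀ n ∈ N, -n ∉ T) :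
    ∃ (K : Type) (_ : Field K) (_ : LinearOrder K) (_ : IsStrictOrderedRing K),
      PolyIVT K ∧ ∃ φ : R →+* K, (∀ a ∈ T, 0 ≤ φ a) ∧ ∀ n ∈ N, 0 < φ n := by
  obtain ⟨M, hTM, hM, hNM⟩ := exists_isPrimeCone hT N hN hneg
  obtain ⟨K, i1, i2, i3, hK, φ, hφ⟩ := hM.exists_hom
  refine ⟨K, i1, i2, i3, hK, φ, fun a ha => (hφ a).2 (hTM ha), fun n hn => ?_⟩
  have h1 : ¬ 0 ≤ φ (-n) := fun h => hNM n hn ((hφ _).1 h)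
  simpa using h1

end

namespace DynAlg

open Atom Rule

/-! ### Substitution -/

section Subst

variable {S S' S'' : Sig} {V W U : Type}

/-- The variables read in a larger context. -/
@[simp]
abbrev lift {k : ℕ} : V → Term S (V ⊕ Fin k) := fun v => Term.var (Sum.inl v)

@[simp]
theorem Term.subst_var (t : Term S V) : t.subst Term.var = t := by
  induction t <;> simp_all [Term.subst]

theorem Term.subst_subst (t : Term S V) (σ : V → Term S W) (τ : W → Term S U) :
    (t.subst σ).subst τ = t.subst fun v => (σ v).subst τ := by
  induction t <;> simp_all [Term.subst]

@[simp]
theorem Atom.subst_var (A : Atom S V) : A.subst Term.var = A := by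
  cases A <;> simp [Atom.subst]

theorem Atom.subst_var' : Atom.subst (Term.var : V → Term S V) = id := funext Atom.subst_var

theorem Atom.subst_subst (A : Atom S V) (σ : V → Term S W) (τ : W → Term S U) :
    (A.subst σ).subst τ = A.subst fun v => (σ v).subst τ := by
  cases A <;> simp [Atom.subst, Term.subst_subst]

theorem Term.map_subst (h : S ≤ S') (t : Term S V) (σ : V → Term S W) :
    (t.subst σ).map h = (t.map h).subst fun v => (σ v).map h := by
  induction t <;> simp_all [Term.subst, Term.map]

theorem Atom.map_subst (h : S ≤ S') (A : Atom S V) (σ : V → Term S W) :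
    (A.subst σ).map h = (A.map h).subst fun v => (σ v).map h := by
  cases A <;> simp [Atom.subst, Atom.map, Term.map_subst]

theorem Term.map_map (h : S ≤ S') (h' : S' ≤ S'') (h'' : S ≤ S'') (t : Term S V) :
    (t.map h).map h' = t.map h'' := by
  induction t <;> simp_all [Term.map]

theorem Atom.map_map (h : S ≤ S') (h' : S' ≤ S'') (h'' : S ≤ S'') (A : Atom S V) :
    (A.map h).map h' = A.map h'' := by
  cases A <;> simp [Atom.map, Term.map_map h h' h'']

theorem Rule.map_map (h : S ≤ S') (h' : S' ≤ S'') (h'' : S ≤ S'') (r : Rule S V) :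
    (r.map h).map h' = r.map h'' := by
  simp [Rule.map, Branch.map, Function.comp_def, Atom.map_map h h' h'']

/-- The substitution induced on the context of a disjunct. -/
abbrev under (k : ℕ) (σ : V → Term S W) : V ⊕ Fin k → Term S (W ⊕ Fin k) :=
  Sum.elim (fun v => (σ v).subst lift) (fun i => Term.var (Sum.inr i))

theorem Branch.inst_eq (σ : V → Term S W) (B : Branch S V) :
    B.inst σ = B.atoms.map (Atom.subst (under B.k σ)) := rfl

theorem under_comp (k : ℕ) (σ : V → Term S W) (τ : W → Term S U) (i : V ⊕ Fin k) :
    (under k σ i).subst (under k τ) = under k (fun v => (σ v).subst τ) i := by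
  cases i <;> simp [Term.subst_subst, Term.subst]

@[simp]
theorem under_var (k : ℕ) : under k (Term.var : V → Term S V) = Term.var := by
  funext i
  cases i <;> rfl

theorem Branch.subst_subst (B : Branch S V) (σ : V → Term S W) (τ : W → Term S U) :
    (B.subst σ).subst τ = B.subst fun v => (σ v).subst τ := by
  simp [Branch.subst, Branch.inst_eq, Function.comp_def, Atom.subst_subst, under_comp]

@[simp]
theorem Branch.subst_var (B : Branch S V) : B.subst Term.var = B := by
  cases B
  simp [Branch.subst, Branch.inst_eq, Atom.subst_var']

theorem Branch.subst_var' : Branch.subst (Term.var : V → Term S V) = id :=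
  funext Branch.subst_var

theorem Branch.map_subst (h : S ≤ S') (B : Branch S V) (σ : V → Term S W) :
    (B.subst σ).map h = (B.map h).subst fun v => (σ v).map h := by
  have : ∀ i, (under B.k σ i).map h = under B.k (fun v => (σ v).map h) i := by
    rintro (v | i)
    · simp [Term.map_subst, Term.map]
    · rfl
  simp [Branch.subst, Branch.map, Branch.inst_eq, Function.comp_def, Atom.map_subst, this]

theorem plain_subst (Δ : List (Atom S V)) (σ : V → Term S W) :
    (plain Δ).subst σ = plain (Δ.map (Atom.subst σ)) := by
  simp [plain, Branch.subst, Branch.inst_eq, Function.comp_def, Atom.subst_subst, Term.subst]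

end Subst

/-! ### Structural rules for dynamical proofs -/

namespace Theory

variable {T : Theory} {V W : Type}

/-- Letting `Γ'` be any list that contains the images builds weakening into the statement. Under a
new branch the substitution is extended by `under`, which fixes the fresh variables. -/
theorem Derives.subst {Γ : List (Atom T.sig V)} {C : List (Branch T.sig V)} (h : T.Derives Γ C)
    (σ : V → Term T.sig W) {Γ' : List (Atom T.sig W)} (hΓ : ∀ A ∈ Γ, A.subst σ ∈ Γ') :
    T.Derives Γ' (C.map (Branch.subst σ)) := by
  induction h generalizing W with
  | leaf B hB t h =>
    refine .leaf (B.subst σ) (List.mem_map_of_mem hB) (fun i => (t i).subst σ) ?_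
    intro A hA
    obtain ⟨A, hA₀, rfl⟩ := List.mem_map.1 hA
    have := hΓ _ (h A hA₀)
    rw [Atom.subst_subst] at this ⊢
    convert this using 2
    funext i
    cases i <;> simp [Term.subst_subst, Term.subst]
  | @step V Γ C r hr τ h next ih =>
    refine .step r hr (fun i => (τ i).subst σ) (fun A hA => ?_) (fun B hB => ?_)
    · simpa [Atom.subst_subst] using hΓ _ (h A hA)
    · have := ih B hB (under B.k σ)
        (Γ' := Γ'.map (Atom.subst lift) ++ B.inst (fun i => (τ i).subst σ)) ?_
      · simpa [Function.comp_def, Branch.subst_subst, Term.subst] using this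
      · intro A hA
        rcases List.mem_append.1 hA with hA | hA
        · obtain ⟨A, hA₀, rfl⟩ := List.mem_map.1 hA
          refine List.mem_append_left _ (List.mem_map.2 ⟨_, hΓ A hA₀, ?_⟩)
          simp [Atom.subst_subst, Term.subst]
        · obtain ⟨A, hA₀, rfl⟩ := List.mem_map.1 hA
          refine List.mem_append_right _ (List.mem_map.2 ⟨A, hA₀, ?_⟩)
          rw [Atom.subst_subst]
          congr 1
          funext i
          exact (under_comp _ _ _ i).symm

theorem Derives.weaken {Γ Γ' : List (Atom T.sig V)} {C : List (Branch T.sig V)}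
    (h : T.Derives Γ C) (hΓ : ∀ A ∈ Γ, A ∈ Γ') : T.Derives Γ' C := by
  simpa [Branch.subst_var'] using h.subst Term.var (Γ' := Γ') (by simpa using hΓ)

/-- The given proofs of `C'` are grafted onto the leaves. At a leaf its witnesses replace the bound
variables of the disjunct; at a step the grafts are first moved to the larger context. -/
theorem Derives.cut {Γ : List (Atom T.sig V)} {C C' : List (Branch T.sig V)} (h : T.Derives Γ C)
    (h' : ∀ B ∈ C, T.Derives (V := V ⊕ Fin B.k) (Γ.map (Atom.subst lift) ++ B.atoms)
      (C'.map (Branch.subst lift))) : T.Derives Γ C' := by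
  induction h with
  | @leaf V Γ C B hB t h =>
    have := (h' B hB).subst (Sum.elim Term.var t) (Γ' := Γ) ?_
    · simpa [Function.comp_def, Branch.subst_subst, Term.subst] using this
    · intro A hA
      rcases List.mem_append.1 hA with hA | hA
      · obtain ⟨A, hA₀, rfl⟩ := List.mem_map.1 hA
        simpa [Atom.subst_subst, Term.subst, Atom.subst_var'] using hA₀
      · exact h A hA
  | @step V Γ C r hr τ h next ih =>
    refine .step r hr τ h fun B hB => ih B hB fun B' hB' => ?_
    obtain ⟨B₀, hB₀, rfl⟩ := List.mem_map.1 hB'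
    have := (h' B₀ hB₀).subst (under B₀.k (lift (k := B.k)))
      (Γ' := (Γ.map (Atom.subst lift) ++ B.inst τ).map (Atom.subst lift) ++ B₀.inst lift) ?_
    · simpa [Function.comp_def, Branch.subst_subst, Term.subst] using this
    · intro A hA
      rcases List.mem_append.1 hA with hA | hA
      · obtain ⟨A, hA₀, rfl⟩ := List.mem_map.1 hA
        refine List.mem_append_left _ (List.mem_map.2 ⟨A.subst lift, ?_, ?_⟩)
        · exact List.mem_append_left _ (List.mem_map_of_mem hA₀)
        · simp [Atom.subst_subst, Term.subst]
      · exact List.mem_append_right _ (List.mem_map_of_mem hA)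

theorem proves_of_mem {r : Rule T.sig ℕ} (hr : r ∈ T.axioms ∪ eqRules T.sig) : T.Proves r := by
  refine .step r hr Term.var (by simp) fun B hB => ?_
  refine .leaf (B.subst lift) (List.mem_map_of_mem hB) (fun i => Term.var (Sum.inr i)) ?_
  intro A hA
  obtain ⟨A, hA₀, rfl⟩ := List.mem_map.1 hA
  refine List.mem_append_right _ (List.mem_map.2 ⟨A, hA₀, ?_⟩)
  rw [Atom.subst_subst]
  congr 1
  funext i
  cases i <;> simp [Term.subst]

theorem Proves.inst {r : Rule T.sig ℕ} (h : T.Proves r) (σ : ℕ → Term T.sig V)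
    {Γ : List (Atom T.sig V)} (hΓ : ∀ A ∈ r.hyps, A.subst σ ∈ Γ) :
    T.Derives Γ (r.concl.map (Branch.subst σ)) := Derives.subst h σ hΓ

theorem map_mem_eqRules {S S' : Sig} (h : S ≤ S') {r : Rule S ℕ} (hr : r ∈ eqRules S) :
    r.map h ∈ eqRules S' := by
  rcases hr with ((hr | ⟨k, rfl⟩) | ⟨k, rfl⟩) | ⟨k, rfl⟩
  · refine Or.inl (Or.inl (Or.inl ?_))
    simp only [Set.mem_insert_iff, Set.mem_singleton_iff] at hr ⊢
    rcases hr with rfl | rfl | rfl | rfl | rfl | rfl | rfl | rfl <;> first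
      | exact Or.inl rfl
      | exact Or.inr (Or.inl rfl)
      | exact Or.inr (Or.inr (Or.inl rfl))
      | exact Or.inr (Or.inr (Or.inr (Or.inl rfl)))
      | exact Or.inr (Or.inr (Or.inr (Or.inr (Or.inl rfl))))
      | exact Or.inr (Or.inr (Or.inr (Or.inr (Or.inr (Or.inl rfl)))))
      | exact Or.inr (Or.inr (Or.inr (Or.inr (Or.inr (Or.inr (Or.inl rfl))))))
      | exact Or.inr (Or.inr (Or.inr (Or.inr (Or.inr (Or.inr (Or.inr rfl))))))
  · exact Or.inl (Or.inl (Or.inr ⟨h.2.1 k, rfl⟩))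
  · exact Or.inl (Or.inr ⟨h.2.2 k, rfl⟩)
  · exact Or.inr ⟨h.1 k, rfl⟩

/-- Each use of an axiom of `T` is replaced by its proof in `T'`, attached by `Derives.cut`. Uses of
equality rules translate into equality rules. -/
theorem Derives.translate {T' : Theory} (h : T.sig ≤ T'.sig)
    (hax : ∀ r ∈ T.axioms, T'.Proves (r.map h))
    {Γ : List (Atom T.sig V)} {C : List (Branch T.sig V)} (hd : T.Derives Γ C) :
    T'.Derives (Γ.map (Atom.map h)) (C.map (Branch.map h)) := by
  induction hd with
  | leaf B hB t hA =>
    refine .leaf (B.map h) (List.mem_map_of_mem hB) (fun i => (t i).map h) ?_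
    intro A hA'
    obtain ⟨A, hA₀, rfl⟩ := List.mem_map.1 hA'
    refine List.mem_map.2 ⟨_, hA A hA₀, ?_⟩
    rw [Atom.map_subst]
    congr 1
    funext i
    cases i <;> rfl
  | @step V Γ C r hr τ hA next ih =>
    have hr' : T'.Proves (r.map h) := hr.elim (hax r)
      fun hr => proves_of_mem (Or.inr (map_mem_eqRules h hr))
    refine (hr'.inst (fun i => (τ i).map h) (Γ := Γ.map (Atom.map h)) ?_).cut ?_
    · intro A hA'
      obtain ⟨A, hA₀, rfl⟩ := List.mem_map.1 hA'
      exact List.mem_map.2 ⟨_, hA A hA₀, Atom.map_subst ..⟩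
    · intro B hB
      simp only [Rule.map, List.map_map, List.mem_map, Function.comp_apply] at hB
      obtain ⟨B, hB, rfl⟩ := hB
      have := ih B hB
      have hl : ∀ k, (fun v : V => (lift v : Term T.sig (V ⊕ Fin k)).map h) = lift := fun _ => rfl
      have hi : (B.inst τ).map (Atom.map h) = (B.map h).inst fun v => (τ v).map h := by
        have := Branch.map_subst h B τ
        rw [Branch.mk.injEq] at this
        exact eq_of_heq this.2
      rw [List.map_append, hi] at this
      simp only [List.map_map, Function.comp_def, Branch.map_subst, Atom.map_subst, hl] at this ⊢
      exact this

theorem Proves.translate {T' : Theory} {h : T.sig ≤ T'.sig}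
    (hax : ∀ r ∈ T.axioms, T'.Proves (r.map h)) {r : Rule T.sig ℕ} (hr : T.Proves r) :
    T'.Proves (r.map h) := Derives.translate h hax hr

theorem mem_map_lift_append {S : Sig} {Γ Δ : List (Atom S V)} {A : Atom S V} (hA : A ∈ Γ ++ Δ) :
    A.subst (lift (k := 0)) ∈ Γ.map (Atom.subst lift) ++ (plain Δ).atoms :=
  List.mem_append.2 ((List.mem_append.1 hA).imp List.mem_map_of_mem List.mem_map_of_mem)

theorem Derives.cut_plain {Γ Δ : List (Atom T.sig V)} {C : List (Branch T.sig V)}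
    (h : T.Derives Γ [plain Δ]) (h' : T.Derives (Γ ++ Δ) C) : T.Derives Γ C := by
  refine h.cut fun B hB => ?_
  obtain rfl := List.mem_singleton.1 hB
  refine h'.subst lift fun A hA => ?_
  exact mem_map_lift_append hA

theorem Derives.cut_plain₂ {Γ Δ₁ Δ₂ : List (Atom T.sig V)} {C : List (Branch T.sig V)}
    (h : T.Derives Γ [plain Δ₁, plain Δ₂]) (h₁ : T.Derives (Γ ++ Δ₁) C)
    (h₂ : T.Derives (Γ ++ Δ₂) C) : T.Derives Γ C := by
  refine h.cut fun B hB => ?_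
  simp only [List.mem_cons, List.not_mem_nil, or_false] at hB
  rcases hB with rfl | rfl
  · refine h₁.subst lift fun A hA => ?_
    exact mem_map_lift_append hA
  · refine h₂.subst lift fun A hA => ?_
    exact mem_map_lift_append hA

/-- The atomic formula `A` is derivable from `Γ`. -/
def Thm (T : Theory) (Γ : List (Atom T.sig V)) (A : Atom T.sig V) : Prop :=
  T.Derives Γ [plain [A]]

theorem derives_plain_of_mem {Γ Δ : List (Atom T.sig V)} (h : ∀ A ∈ Δ, A ∈ Γ) :
    T.Derives Γ [plain Δ] := by
  refine .leaf _ (List.mem_singleton.2 rfl) Fin.elim0 fun A hA => ?_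
  obtain ⟨A, hA₀, rfl⟩ := List.mem_map.1 hA
  have key : (A.subst (lift (k := 0))).subst (Sum.elim Term.var Fin.elim0) = A := by
    rw [Atom.subst_subst]
    exact Atom.subst_var A
  have := h A hA₀
  rw [← key] at this
  exact this

theorem derives_plain_iff {Γ Δ : List (Atom T.sig V)} :
    T.Derives Γ [plain Δ] ↔ ∀ A ∈ Δ, T.Thm Γ A := by
  refine ⟨fun h A hA => h.cut_plain (derives_plain_of_mem (by simp [hA])), fun h => ?_⟩
  -- Stated for an arbitrary conclusion, so that the atoms can be added to the hypotheses one at a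
  -- time by cuts.
  suffices ∀ Δ' : List (Atom T.sig V), (∀ A ∈ Δ', T.Thm Γ A) → ∀ C, T.Derives (Γ ++ Δ') C →
      T.Derives Γ C from this Δ h _ (derives_plain_of_mem (by simp +contextual))
  intro Δ'
  induction Δ' with
  | nil => intro _ C hC; simpa using hC
  | cons A Δ' ih =>
    intro hA C hC
    refine ih (fun B hB => hA B (List.mem_cons_of_mem _ hB)) C ?_
    have h1 : T.Thm (Γ ++ Δ') A := (hA A List.mem_cons_self).weaken (by simp +contextual)
    refine h1.cut_plain (hC.weaken fun B hB => ?_)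
    simp only [List.mem_append, List.mem_cons, List.not_mem_nil, or_false] at hB ⊢
    tauto

theorem Derives.cut_list {Γ Γ' : List (Atom T.sig V)} {C : List (Branch T.sig V)}
    (hΓ : ∀ A ∈ Γ', T.Thm Γ A) (h : T.Derives Γ' C) : T.Derives Γ C :=
  (derives_plain_iff.2 hΓ).cut_plain (h.weaken (by simp +contextual))

/-- The hypotheses need only be derivable instead of occurring in `Γ`; derivable atoms are therefore
closed under valid algebraic rules. -/
theorem Proves.thm {Γ₀ Δ₀ : List (Atom T.sig ℕ)} (h : T.Proves (alg Γ₀ Δ₀))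
    {Γ : List (Atom T.sig V)} (σ : ℕ → Term T.sig V) (hΓ : ∀ A ∈ Γ₀, T.Thm Γ (A.subst σ)) :
    ∀ A ∈ Δ₀, T.Thm Γ (A.subst σ) := by
  have h1 := h.inst σ (Γ := Γ₀.map (Atom.subst σ)) (fun A hA => List.mem_map_of_mem hA)
  have h2 : T.Derives (Γ₀.map (Atom.subst σ)) [plain (Δ₀.map (Atom.subst σ))] := by
    simpa [alg, plain_subst] using h1
  have h3 := derives_plain_iff.1 (h2.cut_list (Γ := Γ) (by simpa using hΓ))
  simpa using h3

end Theory

end DynAlg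

namespace DynAlg

open Atom Rule

/-! ### Structures -/

/-- The interpretation, in a commutative ring, of the symbols which are not part of the ring
structure. -/
structure Str (K : Type) where
  nonneg : K → Prop
  pos : K → Prop
  sup : K → K → K
  fr : K → K → K

section Semantics

variable {S S' : Sig} {V W : Type} {K : Type} [CommRing K]

/-- The value of a term. -/
def Term.eval (M : Str K) (v : V → K) : Term S V → K
  | var i => v i
  | zero => 0
  | one => 1
  | neg a => -(a.eval M v)
  | add a b => a.eval M v + b.eval M v
  | mul a b => a.eval M v * b.eval M v
  | sup _ a b => M.sup (a.eval M v) (b.eval M v)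
  | fr _ a b => M.fr (a.eval M v) (b.eval M v)

/-- The truth of an atomic formula. -/
def Atom.Sat (M : Str K) (v : V → K) : Atom S V → Prop
  | eqZero t => t.eval M v = 0
  | nonneg t => M.nonneg (t.eval M v)
  | pos _ t => M.pos (t.eval M v)

/-- The truth of a dynamical rule in a structure. -/
def Str.Holds (M : Str K) (r : Rule S V) : Prop :=
  ∀ v : V → K, (∀ A ∈ r.hyps, A.Sat M v) →
    ∃ B ∈ r.concl, ∃ t : Fin B.k → K, ∀ A ∈ B.atoms, A.Sat M (Sum.elim v t)

variable (M : Str K) (v : V → K)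

namespace Term

@[simp] theorem eval_var (i : V) : (var i : Term S V).eval M v = v i := rfl
@[simp] theorem eval_zero : (0 : Term S V).eval M v = 0 := rfl
@[simp] theorem eval_one : (1 : Term S V).eval M v = 1 := rfl
@[simp] theorem eval_neg (a : Term S V) : (-a).eval M v = -a.eval M v := rfl
@[simp] theorem eval_add (a b : Term S V) : (a + b).eval M v = a.eval M v + b.eval M v := rfl
@[simp] theorem eval_mul (a b : Term S V) : (a * b).eval M v = a.eval M v * b.eval M v := rfl
@[simp] theorem eval_sub (a b : Term S V) : (a - b).eval M v = a.eval M v - b.eval M v :=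
  (sub_eq_add_neg _ _).symm
@[simp] theorem eval_sup (h : S.hasSup = true) (a b : Term S V) :
    (sup h a b).eval M v = M.sup (a.eval M v) (b.eval M v) := rfl
@[simp] theorem eval_fr (h : S.hasFr = true) (a b : Term S V) :
    (fr h a b).eval M v = M.fr (a.eval M v) (b.eval M v) := rfl
@[simp] theorem eval_inf (h : S.hasSup = true) (a b : Term S V) :
    (inf h a b).eval M v = -M.sup (-a.eval M v) (-b.eval M v) := rfl
@[simp] theorem eval_abs (h : S.hasSup = true) (a : Term S V) :
    (abs h a).eval M v = M.sup (a.eval M v) (-a.eval M v) := rfl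
@[simp] theorem eval_pos (h : S.hasSup = true) (a : Term S V) :
    (pos h a).eval M v = M.sup (a.eval M v) 0 := rfl

@[simp] theorem eval_npow (a : Term S V) (n : ℕ) : (npow a n).eval M v = a.eval M v ^ n := by
  induction n with
  | zero => simp [npow]
  | succ n ih => simp [npow, ih, pow_succ]

theorem eval_poly (c : ℕ → Term S V) (t : Term S V) (n : ℕ) :
    (poly c t n).eval M v =
      ∑ i ∈ Finset.range (n + 1), (c i).eval M v * (t.eval M v) ^ i := by
  induction n with
  | zero => simp [poly]
  | succ n ih => rw [Finset.sum_range_succ, ← ih]; simp [poly]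

@[simp] theorem eval_x (v : ℕ → K) : (x : Term S ℕ).eval M v = v 0 := rfl
@[simp] theorem eval_y (v : ℕ → K) : (y : Term S ℕ).eval M v = v 1 := rfl
@[simp] theorem eval_z (v : ℕ → K) : (z : Term S ℕ).eval M v = v 2 := rfl
@[simp] theorem eval_w (v : ℕ → K) : (w : Term S ℕ).eval M v = v 3 := rfl

theorem eval_subst (t : Term S V) (σ : V → Term S W) (v : W → K) :
    (t.subst σ).eval M v = t.eval M fun i => (σ i).eval M v := by
  induction t <;> simp_all [eval, subst]

theorem eval_map (h : S ≤ S') (t : Term S V) : (t.map h).eval M v = t.eval M v := by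
  induction t <;> simp_all [eval, map]

end Term

namespace Atom

@[simp] theorem sat_eqZero (t : Term S V) : (eqZero t).Sat M v ↔ t.eval M v = 0 := Iff.rfl
@[simp] theorem sat_nonneg (t : Term S V) : (nonneg t).Sat M v ↔ M.nonneg (t.eval M v) := Iff.rfl
@[simp] theorem sat_pos (h : S.hasPos = true) (t : Term S V) :
    (pos h t).Sat M v ↔ M.pos (t.eval M v) := Iff.rfl
@[simp] theorem sat_eq (a b : Term S V) : (eq a b).Sat M v ↔ a.eval M v = b.eval M v := by
  simp [eq, sub_eq_zero]
@[simp] theorem sat_ge (a b : Term S V) :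
    (ge a b).Sat M v ↔ M.nonneg (a.eval M v - b.eval M v) := by simp [ge]
@[simp] theorem sat_le (a b : Term S V) :
    (le a b).Sat M v ↔ M.nonneg (b.eval M v - a.eval M v) := by simp [le]
@[simp] theorem sat_lt (h : S.hasPos = true) (a b : Term S V) :
    (lt h a b).Sat M v ↔ M.pos (b.eval M v - a.eval M v) := by simp [lt]

theorem sat_subst (A : Atom S V) (σ : V → Term S W) (v : W → K) :
    (A.subst σ).Sat M v ↔ A.Sat M fun i => (σ i).eval M v := by
  cases A <;> simp [subst, Term.eval_subst]

theorem sat_map (h : S ≤ S') (A : Atom S V) : (A.map h).Sat M v ↔ A.Sat M v := by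
  cases A <;> simp [map, Term.eval_map]

end Atom

namespace Str

theorem exists_plain (Δ : List (Atom S V)) :
    (∃ t : Fin (plain Δ).k → K, ∀ A ∈ (plain Δ).atoms, A.Sat M (Sum.elim v t)) ↔
      ∀ A ∈ Δ, A.Sat M v := by
  have : ∀ t : Fin (plain Δ).k → K, (∀ A ∈ (plain Δ).atoms, A.Sat M (Sum.elim v t)) ↔
      ∀ A ∈ Δ, A.Sat M v := by
    intro t
    refine List.forall_mem_map.trans (forall₂_congr fun A _ => ?_)
    exact Atom.sat_subst M A _ _
  simp only [this]
  exact ⟨fun ⟨_, h⟩ => h, fun h => ⟨fun _ => 0, h⟩⟩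

@[simp]
theorem holds_alg (Γ Δ : List (Atom S V)) :
    M.Holds (alg Γ Δ) ↔ ∀ v : V → K, (∀ A ∈ Γ, A.Sat M v) → ∀ A ∈ Δ, A.Sat M v := by
  simp only [Holds, alg, List.mem_singleton, exists_eq_left, exists_plain]

@[simp]
theorem holds_disj (Γ Δ₁ Δ₂ : List (Atom S V)) :
    M.Holds (disj Γ Δ₁ Δ₂) ↔ ∀ v : V → K, (∀ A ∈ Γ, A.Sat M v) →
      (∀ A ∈ Δ₁, A.Sat M v) ∨ (∀ A ∈ Δ₂, A.Sat M v) := by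
  simp only [Holds, disj, List.mem_cons, List.not_mem_nil, or_false, exists_eq_or_imp,
    exists_eq_left, exists_plain]

theorem holds_ex (Γ : List (Atom S V))
    (Δ : (Term S V → Term S (V ⊕ Fin 1)) → Term S (V ⊕ Fin 1) → List (Atom S (V ⊕ Fin 1))) :
    M.Holds (ex Γ Δ) ↔ ∀ v : V → K, (∀ A ∈ Γ, A.Sat M v) →
      ∃ a : K, ∀ A ∈ Δ (Term.subst (fun v => Term.var (Sum.inl v))) (Term.var (Sum.inr 0)),
        A.Sat M (Sum.elim v fun _ => a) := by
  simp only [Holds, ex, List.mem_singleton, exists_eq_left]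
  refine forall_congr' fun v => imp_congr_right fun _ => ⟨fun ⟨t, h⟩ => ⟨t 0, ?_⟩,
    fun ⟨a, h⟩ => ⟨fun _ => a, h⟩⟩
  have : t = fun _ => t 0 := funext fun i => congrArg t (Subsingleton.elim _ _)
  rwa [← this]

theorem holds_map (h : S ≤ S') (r : Rule S V) : M.Holds (r.map h) ↔ M.Holds r := by
  simp [Holds, Rule.map, Branch.map, Atom.sat_map]

theorem holds_eqRules {r : Rule S ℕ} (hr : r ∈ eqRules S) : M.Holds r := by
  rcases hr with ((hr | ⟨k, rfl⟩) | ⟨k, rfl⟩) | ⟨k, rfl⟩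
  · simp only [Set.mem_insert_iff, Set.mem_singleton_iff] at hr
    rcases hr with rfl | rfl | rfl | rfl | rfl | rfl | rfl | rfl <;>
      simp +contextual [eq_comm]
  all_goals simp +contextual

theorem holds_acAx {r : Rule S ℕ} (hr : r ∈ acAx S) : M.Holds r := by
  simp only [acAx, Set.mem_insert_iff, Set.mem_singleton_iff] at hr
  rcases hr with rfl | rfl | rfl | rfl | rfl | rfl | rfl | rfl | rfl | rfl | rfl <;>
    simp +contextual [add_assoc, mul_assoc, mul_add] <;> (try intros; ring)

/-- Soundness of dynamical proofs. -/
theorem sound {T : Theory} {M : Str K} (hM : ∀ r ∈ T.axioms, M.Holds r)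
    {Γ : List (Atom T.sig V)} {C : List (Branch T.sig V)} (h : T.Derives Γ C) :
    M.Holds (⟨Γ, C⟩ : Rule T.sig V) := by
  induction h with
  | @leaf V Γ C B hB t h =>
    intro v hv
    refine ⟨B, hB, fun i => (t i).eval M v, fun A hA => ?_⟩
    have := hv _ (h A hA)
    rw [Atom.sat_subst] at this
    convert this using 1
    funext i
    cases i <;> rfl
  | @step V Γ C r hr τ h next ih =>
    intro v hv
    have hr' : M.Holds r := hr.elim (hM r) (M.holds_eqRules)
    obtain ⟨B, hB, t, ht⟩ := hr' (fun i => (τ i).eval M v) fun A hA => by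
      have := hv _ (h A hA)
      rwa [Atom.sat_subst] at this
    obtain ⟨B', hB', t', ht'⟩ := ih B hB (Sum.elim v t) (by
      intro A hA
      rcases List.mem_append.1 hA with hA | hA
      · obtain ⟨A, hA₀, rfl⟩ := List.mem_map.1 hA
        rw [Atom.sat_subst]
        exact hv A hA₀
      · obtain ⟨A, hA₀, rfl⟩ := List.mem_map.1 hA
        rw [Atom.sat_subst]
        convert ht A hA₀ using 1
        funext i
        cases i
        · simp only [Sum.elim_inl, Term.eval_subst]; rfl
        · rfl)
    obtain ⟨B₀, hB₀, rfl⟩ := List.mem_map.1 hB'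
    refine ⟨B₀, hB₀, t', fun A hA => ?_⟩
    have := ht' _ (List.mem_map_of_mem hA)
    rw [Atom.sat_subst] at this
    convert this using 1
    funext i
    cases i <;> rfl

end Str

end Semantics

/-! ### The structure of terms modulo provable equality -/

namespace Theory

variable (T : Theory) {V W : Type}

/-- `M` is a model of the algebraic rules which are valid in `T`; if the predicate `· > 0` is not
in the signature, it is interpreted as equality with `1`. -/
structure AlgModel {K : Type} [CommRing K] (M : Str K) : Prop where
  holds_alg : ∀ Γ Δ : List (Atom T.sig ℕ), T.Proves (alg Γ Δ) → M.Holds (alg Γ Δ)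
  pos_iff : ¬ T.sig.hasPos = true → ∀ a, M.pos a ↔ a = 1

variable {T}

/-- A valuation of the variables occurring in axioms. -/
def val {K : Type} (a b c d : K) : ℕ → K
  | 0 => a
  | 1 => b
  | 2 => c
  | _ => d

section
variable {K : Type} (a b c d : K)
@[simp] theorem val_zero : val a b c d 0 = a := rfl
@[simp] theorem val_one : val a b c d 1 = b := rfl
@[simp] theorem val_two : val a b c d 2 = c := rfl
@[simp] theorem val_three : val a b c d 3 = d := rfl
end

section Quotient

theorem thm_eqRules {Γ : List (Atom T.sig V)} {Γ₀ : List (Atom T.sig ℕ)} {A : Atom T.sig ℕ}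
    (h : alg Γ₀ [A] ∈ eqRules T.sig) (σ : ℕ → Term T.sig V)
    (hΓ : ∀ A ∈ Γ₀, T.Thm Γ (A.subst σ)) : T.Thm Γ (A.subst σ) :=
  (proves_of_mem (Or.inr h)).thm σ hΓ _ (List.mem_singleton.2 rfl)

variable (T) in
/-- Provable equality of terms. -/
def termSetoid (Γ : List (Atom T.sig V)) : Setoid (Term T.sig V) where
  r a b := T.Thm Γ (eq a b)
  iseqv :=
    { refl := fun a => thm_eqRules (T := T) (Γ₀ := []) (A := eq x x)
        (Or.inl (Or.inl (Or.inl (by simp)))) (val a a a a) (by simp)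
      symm := fun {a b} h => thm_eqRules (T := T) (Γ₀ := [eq x y]) (A := eq y x)
        (Or.inl (Or.inl (Or.inl (by simp)))) (val a b a a)
        (List.forall_mem_cons.2 ⟨h, by simp⟩)
      trans := fun {a b c} h h' => thm_eqRules (T := T) (Γ₀ := [eq x y, eq y z]) (A := eq x z)
        (Or.inl (Or.inl (Or.inl (by simp)))) (val a b c c)
        (List.forall_mem_cons.2 ⟨h, List.forall_mem_cons.2 ⟨h', by simp⟩⟩) }

variable {Γ : List (Atom T.sig V)} {a a' b b' : Term T.sig V}

theorem thm_neg_congr (h : T.Thm Γ (eq a a')) : T.Thm Γ (eq (-a) (-a')) :=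
  thm_eqRules (T := T) (Γ₀ := [eq x y]) (A := eq (-x) (-y)) (Or.inl (Or.inl (Or.inl (by simp))))
    (val a a' a a) (List.forall_mem_cons.2 ⟨h, by simp⟩)

theorem thm_add_congr (h : T.Thm Γ (eq a a')) (h' : T.Thm Γ (eq b b')) :
    T.Thm Γ (eq (a + b) (a' + b')) :=
  thm_eqRules (T := T) (Γ₀ := [eq x y, eq z w])
    (A := eq (x (S := T.sig) + z (S := T.sig)) (y (S := T.sig) + w (S := T.sig)))
    (Or.inl (Or.inl (Or.inl (by simp)))) (val a a' b b')
    (List.forall_mem_cons.2 ⟨h, List.forall_mem_cons.2 ⟨h', by simp⟩⟩)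

theorem thm_mul_congr (h : T.Thm Γ (eq a a')) (h' : T.Thm Γ (eq b b')) :
    T.Thm Γ (eq (a * b) (a' * b')) :=
  thm_eqRules (T := T) (Γ₀ := [eq x y, eq z w])
    (A := eq (x (S := T.sig) * z (S := T.sig)) (y (S := T.sig) * w (S := T.sig)))
    (Or.inl (Or.inl (Or.inl (by simp)))) (val a a' b b')
    (List.forall_mem_cons.2 ⟨h, List.forall_mem_cons.2 ⟨h', by simp⟩⟩)

theorem thm_sup_congr (s : T.sig.hasSup = true) (h : T.Thm Γ (eq a a'))
    (h' : T.Thm Γ (eq b b')) : T.Thm Γ (eq (.sup s a b) (.sup s a' b')) :=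
  thm_eqRules (T := T) (Γ₀ := [eq x y, eq z w]) (A := eq (.sup s x z) (.sup s y w))
    (Or.inl (Or.inl (Or.inr ⟨s, rfl⟩))) (val a a' b b')
    (List.forall_mem_cons.2 ⟨h, List.forall_mem_cons.2 ⟨h', by simp⟩⟩)

theorem thm_fr_congr (s : T.sig.hasFr = true) (h : T.Thm Γ (eq a a'))
    (h' : T.Thm Γ (eq b b')) : T.Thm Γ (eq (.fr s a b) (.fr s a' b')) :=
  thm_eqRules (T := T) (Γ₀ := [eq x y, eq z w]) (A := eq (.fr s x z) (.fr s y w))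
    (Or.inl (Or.inr ⟨s, rfl⟩)) (val a a' b b')
    (List.forall_mem_cons.2 ⟨h, List.forall_mem_cons.2 ⟨h', by simp⟩⟩)

theorem thm_eqZero_congr (h : T.Thm Γ (eq a a')) (h' : T.Thm Γ (eqZero a)) :
    T.Thm Γ (eqZero a') :=
  thm_eqRules (T := T) (Γ₀ := [eq x y, eqZero x]) (A := eqZero y)
    (Or.inl (Or.inl (Or.inl (by simp))))
    (val a a' a a) (List.forall_mem_cons.2 ⟨h, List.forall_mem_cons.2 ⟨h', by simp⟩⟩)

theorem thm_nonneg_congr (h : T.Thm Γ (eq a a')) (h' : T.Thm Γ (nonneg a)) :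
    T.Thm Γ (nonneg a') :=
  thm_eqRules (T := T) (Γ₀ := [eq x y, nonneg x]) (A := nonneg y)
    (Or.inl (Or.inl (Or.inl (by simp))))
    (val a a' a a) (List.forall_mem_cons.2 ⟨h, List.forall_mem_cons.2 ⟨h', by simp⟩⟩)

theorem thm_pos_congr (p : T.sig.hasPos = true) (h : T.Thm Γ (eq a a'))
    (h' : T.Thm Γ (pos p a)) : T.Thm Γ (pos p a') :=
  thm_eqRules (T := T) (Γ₀ := [eq x y, pos p x]) (A := pos p y) (Or.inr ⟨p, rfl⟩)
    (val a a' a a) (List.forall_mem_cons.2 ⟨h, List.forall_mem_cons.2 ⟨h', by simp⟩⟩)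

theorem thm_eq_symm (h : T.Thm Γ (eq a a')) : T.Thm Γ (eq a' a) :=
  (T.termSetoid Γ).symm h

/-- The ring of terms modulo provable equality. -/
def TermRing (_ : ∀ r ∈ acAx T.sig, T.Proves r) (Γ : List (Atom T.sig V)) : Type :=
  Quotient (T.termSetoid Γ)

variable (hT : ∀ r ∈ acAx T.sig, T.Proves r)

/-- The class of a term. -/
def TermRing.mk (a : Term T.sig V) : TermRing hT Γ := Quotient.mk (T.termSetoid Γ) a

theorem TermRing.ind {p : TermRing hT Γ → Prop} (h : ∀ a, p (TermRing.mk hT a)) : ∀ q, p q :=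
  Quotient.ind h

theorem TermRing.mk_eq : (TermRing.mk hT a : TermRing hT Γ) = TermRing.mk hT b ↔
    T.Thm Γ (eq a b) := Quotient.eq (r := T.termSetoid Γ)

instance : Zero (TermRing hT Γ) := ⟨TermRing.mk hT 0⟩
instance : One (TermRing hT Γ) := ⟨TermRing.mk hT 1⟩
instance : Neg (TermRing hT Γ) :=
  ⟨Quotient.map (sa := T.termSetoid Γ) (sb := T.termSetoid Γ) (fun a => -a)
    fun _ _ h => thm_neg_congr h⟩
instance : Add (TermRing hT Γ) :=
  ⟨Quotient.map₂ (sa := T.termSetoid Γ) (sb := T.termSetoid Γ) (sc := T.termSetoid Γ)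
    (fun a b => a + b) fun _ _ h _ _ h' => thm_add_congr h h'⟩
instance : Mul (TermRing hT Γ) :=
  ⟨Quotient.map₂ (sa := T.termSetoid Γ) (sb := T.termSetoid Γ) (sc := T.termSetoid Γ)
    (fun a b => a * b) fun _ _ h _ _ h' => thm_mul_congr h h'⟩

theorem TermRing.mk_eq_of_acAx {a b : Term T.sig ℕ} (h : alg [] [eq a b] ∈ acAx T.sig)
    (σ : ℕ → Term T.sig V) :
    (TermRing.mk hT (a.subst σ) : TermRing hT Γ) = TermRing.mk hT (b.subst σ) :=
  (TermRing.mk_eq hT).2 ((hT _ h).thm σ (by simp) _ (List.mem_singleton.2 rfl))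

instance : CommRing (TermRing hT Γ) :=
  have add_comm' : ∀ p q : TermRing hT Γ, p + q = q + p :=
    TermRing.ind hT fun a => TermRing.ind hT fun b =>
      TermRing.mk_eq_of_acAx hT (a := (x (S := T.sig) + y (S := T.sig)))
        (b := (y (S := T.sig) + x (S := T.sig))) (by simp [acAx]) (val a b a b)
  have mul_comm' : ∀ p q : TermRing hT Γ, p * q = q * p :=
    TermRing.ind hT fun a => TermRing.ind hT fun b =>
      TermRing.mk_eq_of_acAx hT (a := (x (S := T.sig) * y (S := T.sig)))
        (b := (y (S := T.sig) * x (S := T.sig))) (by simp [acAx]) (val a b a b)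
  have add_zero' : ∀ p : TermRing hT Γ, p + 0 = p :=
    TermRing.ind hT fun a =>
      TermRing.mk_eq_of_acAx hT (a := (x (S := T.sig) + 0))
        (b := (x (S := T.sig))) (by simp [acAx]) (val a a a a)
  have mul_one' : ∀ p : TermRing hT Γ, p * 1 = p :=
    TermRing.ind hT fun a =>
      TermRing.mk_eq_of_acAx hT (a := (x (S := T.sig) * 1))
        (b := (x (S := T.sig))) (by simp [acAx]) (val a a a a)
  have mul_add' : ∀ p q r : TermRing hT Γ, p * (q + r) = p * q + p * r :=
    TermRing.ind hT fun a => TermRing.ind hT fun b => TermRing.ind hT fun c =>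
      TermRing.mk_eq_of_acAx hT (a := (x (S := T.sig) * (y (S := T.sig) + z (S := T.sig))))
        (b := (x (S := T.sig) * y (S := T.sig) + x (S := T.sig) * z (S := T.sig))) (by simp [acAx])
        (val a b c c)
  have add_neg' : ∀ p : TermRing hT Γ, p + -p = 0 :=
    TermRing.ind hT fun a =>
      TermRing.mk_eq_of_acAx hT (a := (x (S := T.sig) + -x (S := T.sig)))
        (b := (0)) (by simp [acAx]) (val a a a a)
  have add_assoc' : ∀ p q r : TermRing hT Γ, p + q + r = p + (q + r) :=
    TermRing.ind hT fun a => TermRing.ind hT fun b => TermRing.ind hT fun c =>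
      TermRing.mk_eq_of_acAx hT (a := ((x (S := T.sig) + y (S := T.sig)) + z (S := T.sig)))
        (b := (x (S := T.sig) + (y (S := T.sig) + z (S := T.sig)))) (by simp [acAx])
        (val a b c c)
  have mul_assoc' : ∀ p q r : TermRing hT Γ, p * q * r = p * (q * r) :=
    TermRing.ind hT fun a => TermRing.ind hT fun b => TermRing.ind hT fun c =>
      TermRing.mk_eq_of_acAx hT (a := ((x (S := T.sig) * y (S := T.sig)) * z (S := T.sig)))
        (b := (x (S := T.sig) * (y (S := T.sig) * z (S := T.sig)))) (by simp [acAx])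
        (val a b c c)
  { add_assoc := add_assoc'
    zero_add := fun p => by rw [add_comm', add_zero']
    add_zero := add_zero'
    add_comm := add_comm'
    left_distrib := mul_add'
    right_distrib := fun p q r => by rw [mul_comm', mul_add', mul_comm' r p, mul_comm' r q]
    zero_mul := fun p => by
      have h : p * 0 + p * 0 = p * 0 := by rw [← mul_add', add_zero']
      have h2 : p * 0 = 0 := by
        calc p * 0 = p * 0 + (p * 0 + -(p * 0)) := by rw [add_neg', add_zero']
          _ = p * 0 + p * 0 + -(p * 0) := (add_assoc' _ _ _).symm
          _ = 0 := by rw [h, add_neg']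
      rw [mul_comm', h2]
    mul_zero := fun p => by
      have h : p * 0 + p * 0 = p * 0 := by rw [← mul_add', add_zero']
      calc p * 0 = p * 0 + (p * 0 + -(p * 0)) := by rw [add_neg', add_zero']
        _ = p * 0 + p * 0 + -(p * 0) := (add_assoc' _ _ _).symm
        _ = 0 := by rw [h, add_neg']
    mul_assoc := mul_assoc'
    one_mul := fun p => by rw [mul_comm', mul_one']
    mul_one := mul_one'
    neg_add_cancel := fun p => by rw [add_comm', add_neg']
    mul_comm := mul_comm'
    nsmul := nsmulRec
    zsmul := zsmulRec }

open Classical in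
/-- The ring of terms as a structure. -/
noncomputable def termStr (Γ : List (Atom T.sig V)) : Str (TermRing hT Γ) where
  nonneg := Quotient.lift (s := T.termSetoid Γ) (fun a => T.Thm Γ (nonneg a)) fun _ _ h =>
    propext ⟨thm_nonneg_congr h, thm_nonneg_congr (thm_eq_symm h)⟩
  pos := if p : T.sig.hasPos = true then
      Quotient.lift (s := T.termSetoid Γ) (fun a => T.Thm Γ (pos p a)) fun _ _ h =>
        propext ⟨thm_pos_congr p h, thm_pos_congr p (thm_eq_symm h)⟩
    else fun a => a = 1
  sup := if s : T.sig.hasSup = true then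
      Quotient.map₂ (sa := T.termSetoid Γ) (sb := T.termSetoid Γ) (sc := T.termSetoid Γ)
        (fun a b => .sup s a b) fun _ _ h _ _ h' => thm_sup_congr s h h'
    else fun _ _ => 0
  fr := if s : T.sig.hasFr = true then
      Quotient.map₂ (sa := T.termSetoid Γ) (sb := T.termSetoid Γ) (sc := T.termSetoid Γ)
        (fun a b => .fr s a b) fun _ _ h _ _ h' => thm_fr_congr s h h'
    else fun _ _ => 0

theorem termStr_nonneg : (termStr hT Γ).nonneg (TermRing.mk hT a) ↔ T.Thm Γ (nonneg a) := Iff.rfl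

theorem termStr_pos (p : T.sig.hasPos = true) :
    (termStr hT Γ).pos (TermRing.mk hT a) ↔ T.Thm Γ (pos p a) :=
  iff_of_eq (congrFun (dif_pos p) (TermRing.mk hT a))

theorem termStr_pos_of_not (p : ¬ T.sig.hasPos = true) (q : TermRing hT Γ) :
    (termStr hT Γ).pos q ↔ q = 1 :=
  iff_of_eq (congrFun (dif_neg p) q)

theorem termStr_sup (h : T.sig.hasSup = true) :
    (termStr hT Γ).sup (TermRing.mk hT a) (TermRing.mk hT b) = TermRing.mk hT (.sup h a b) := by
  have e : (termStr hT Γ).sup = Quotient.map₂ (sa := T.termSetoid Γ) (sb := T.termSetoid Γ)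
      (sc := T.termSetoid Γ) (fun a b => .sup h a b) fun _ _ u _ _ u' => thm_sup_congr h u u' :=
    dif_pos h
  rw [e]
  rfl

theorem termStr_fr (h : T.sig.hasFr = true) :
    (termStr hT Γ).fr (TermRing.mk hT a) (TermRing.mk hT b) = TermRing.mk hT (.fr h a b) := by
  have e : (termStr hT Γ).fr = Quotient.map₂ (sa := T.termSetoid Γ) (sb := T.termSetoid Γ)
      (sc := T.termSetoid Γ) (fun a b => .fr h a b) fun _ _ u _ _ u' => thm_fr_congr h u u' :=
    dif_pos h
  rw [e]
  rfl

/-- A valuation by classes of terms is a substitution, so truth in the term structure can be read as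
derivability. -/
theorem eval_termStr (t : Term T.sig W) (σ : W → Term T.sig V) :
    t.eval (termStr hT Γ) (fun i => TermRing.mk hT (σ i)) = TermRing.mk hT (t.subst σ) := by
  induction t with
  | sup h a b iha ihb => simp only [Term.eval, Term.subst, iha, ihb, termStr_sup hT h]
  | fr h a b iha ihb => simp only [Term.eval, Term.subst, iha, ihb, termStr_fr hT h]
  | neg a iha => simp only [Term.eval, Term.subst, iha]; rfl
  | add a b iha ihb => simp only [Term.eval, Term.subst, iha, ihb]; rfl
  | mul a b iha ihb => simp only [Term.eval, Term.subst, iha, ihb]; rfl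
  | _ => rfl

/-- The two atoms differ syntactically: `eq a 0` is `eqZero (a + -0)`. The ring identities bridge
the gap. -/
theorem thm_eqZero_iff (hT : ∀ r ∈ acAx T.sig, T.Proves r) :
    T.Thm Γ (eqZero a) ↔ T.Thm Γ (eq a 0) := by
  have h0 : T.Thm Γ (eq (a + -0) a) := by
    rw [← TermRing.mk_eq hT]
    change (TermRing.mk hT a + -(0 : TermRing hT Γ) : TermRing hT Γ) = TermRing.mk hT a
    rw [neg_zero, add_zero]
  exact ⟨fun h => thm_eqZero_congr (thm_eq_symm h0) h, fun h => thm_eqZero_congr h0 h⟩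

theorem sat_termStr (A : Atom T.sig W) (σ : W → Term T.sig V) :
    A.Sat (termStr hT Γ) (fun i => TermRing.mk hT (σ i)) ↔ T.Thm Γ (A.subst σ) := by
  cases A with
  | eqZero t =>
    simp only [Atom.Sat, eval_termStr, Atom.subst]
    exact (TermRing.mk_eq hT (b := 0)).trans (thm_eqZero_iff hT).symm
  | nonneg t => simp only [Atom.Sat, eval_termStr, Atom.subst, termStr_nonneg]
  | pos p t => simp only [Atom.Sat, eval_termStr, Atom.subst, termStr_pos hT p]

/-- Choosing representatives turns a valuation into a substitution, and `Proves.thm` applies.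
Nothing similar is available for "or" or `∃`: a derivable disjunction need not have a derivable
member. -/
theorem algModel_termStr (Γ : List (Atom T.sig V)) : T.AlgModel (termStr hT Γ) := by
  refine ⟨?_, termStr_pos_of_not hT⟩
  intro Γ₀ Δ₀ h
  rw [Str.holds_alg]
  intro v hv A hA
  obtain ⟨σ, hσ⟩ : ∃ σ : ℕ → Term T.sig V, v = fun i => TermRing.mk hT (σ i) :=
    ⟨fun i => Quotient.out (s := T.termSetoid Γ) (v i),
      funext fun i => (Quotient.out_eq (s := T.termSetoid Γ) (v i)).symm⟩
  subst hσ
  rw [sat_termStr]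
  exact h.thm σ (fun B hB => (sat_termStr hT B σ).1 (hv B hB)) A hA

/-- The canonical valuation satisfies exactly the derivable atomic formulas. -/
theorem sat_termStr_var (A : Atom T.sig V) :
    A.Sat (termStr hT Γ) (fun i => TermRing.mk hT (Term.var i)) ↔ T.Thm Γ A := by
  rw [sat_termStr, Atom.subst_var]

end Quotient

/-- To derive atomic formulas it is enough to verify them in the models of the valid algebraic
rules. -/
theorem derives_of_models (hT : ∀ r ∈ acAx T.sig, T.Proves r) {Γ Δ : List (Atom T.sig V)}
    (h : ∀ (K : Type) [CommRing K] (M : Str K), T.AlgModel M → ∀ v : V → K,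
      (∀ A ∈ Γ, A.Sat M v) → ∀ A ∈ Δ, A.Sat M v) : T.Derives Γ [plain Δ] := by
  rw [derives_plain_iff]
  intro A hA
  rw [← sat_termStr_var hT]
  refine h _ _ (algModel_termStr hT Γ) _ (fun B hB => ?_) A hA
  rw [sat_termStr_var]
  exact derives_plain_iff.1 (derives_plain_of_mem (by simpa using hB)) B
    (List.mem_singleton.2 rfl)

end Theory

end DynAlg

namespace DynAlg

open Atom Rule Theory

/-! ### Properties of structures -/

namespace Str

variable {K : Type} [CommRing K] (M : Str K)

/-- Preordered rings. -/
structure Preord : Prop where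
  zero : M.nonneg 0
  add : ∀ {a b}, M.nonneg a → M.nonneg b → M.nonneg (a + b)
  sq : ∀ a, M.nonneg (a * a)
  mul : ∀ {a b}, M.nonneg a → M.nonneg b → M.nonneg (a * b)

/-- The rule **Gao**. -/
def Gao : Prop := ∀ {a}, M.nonneg a → M.nonneg (-a) → a = 0

/-- The rule **Anz**. -/
def Anz (_ : Str K) : Prop := ∀ {a : K}, a * a = 0 → a = 0

/-- The rule **Aonz**. -/
def Aonz : Prop := ∀ {c a}, M.nonneg c → M.nonneg (a * (a * a + c)) → M.nonneg a

/-- The direct rules for `· > 0`. -/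
structure Strict : Prop where
  one : M.pos 1
  nonneg : ∀ {a}, M.pos a → M.nonneg a
  add : ∀ {a b}, M.pos a → M.nonneg b → M.pos (a + b)
  mul : ∀ {a b}, M.pos a → M.pos b → M.pos (a * b)

/-- The rule **col**. -/
def Col : Prop := M.pos 0 → (1 : K) = 0

/-- The rule **lv**. -/
def Lv : Prop := ∀ {a b : K}, a * b = 1 → M.pos (a * a)

/-- The rule **Aso1**. -/
def Aso1 : Prop := ∀ {a b}, M.pos a → M.nonneg (a * b) → M.nonneg b

/-- The rule **Aso2**. -/
def Aso2 : Prop := ∀ {a b}, M.nonneg a → M.pos (a * b) → M.pos b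

/-- The sup rules. -/
structure IsSup : Prop where
  left : ∀ a b, M.nonneg (M.sup a b - a)
  right : ∀ a b, M.nonneg (M.sup a b - b)
  le : ∀ {a b c}, M.nonneg (c - a) → M.nonneg (c - b) → M.nonneg (c - M.sup a b)

/-- The rule **grl**. -/
def Grl : Prop := ∀ a b c, a + M.sup b c = M.sup (a + b) (a + c)

/-- The rule **afr**. -/
def Afr : Prop := ∀ a b c, M.sup a 0 * M.sup b c = M.sup (M.sup a 0 * b) (M.sup a 0 * c)

/-- Strongly lattice-ordered rings. -/
structure FRing : Prop where
  idem : ∀ a, M.sup a a = a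
  comm : ∀ a b, M.sup a b = M.sup b a
  assoc : ∀ a b c, M.sup (M.sup a b) c = M.sup a (M.sup b c)
  grl : M.Grl
  afr : M.Afr
  nonneg_iff : ∀ a, M.nonneg a ↔ M.sup a 0 = a

/-- The infimum of two absolute values. -/
def infAbs (a b : K) : K := -M.sup (-M.sup a (-a)) (-M.sup b (-b))

/-- The Fr rules. -/
structure IsFr : Prop where
  mul : ∀ a b, M.fr a b * M.sup b (-b) = M.infAbs a b * M.infAbs a b
  nonneg : ∀ a b, M.nonneg (M.fr a b)
  le : ∀ a b, M.nonneg (M.infAbs a b - M.fr a b)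

variable (S : Sig)

/-- The rules `acAx` leave no trace on the right, since they hold in every commutative ring. -/
theorem forall_apoAx : (∀ r ∈ apoAx S, M.Holds r) ↔ M.Preord := by
  simp only [apoAx, Set.mem_union, Set.mem_insert_iff, Set.mem_singleton_iff, or_imp, forall_and,
    forall_eq, holds_alg]
  constructor
  · rintro ⟨-, h1, h2, h3, h4⟩
    refine ⟨?_, fun {a b} => ?_, fun a => ?_, fun {a b} => ?_⟩
    · simpa using h1 (val 0 0 0 0)
    · simpa using h2 (val a b 0 0)
    · simpa using h3 (val a a a a)
    · simpa using h4 (val a b 0 0)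
  · intro h
    refine ⟨fun _ => M.holds_acAx, fun v hv => ?_, fun v => ?_, fun v => ?_, fun v => ?_⟩
    · have h0 : v 0 = 0 := by simpa using hv
      simpa [h0] using h.zero
    · simpa using h.add
    · simpa using h.sq (v 0)
    · simpa using h.mul

theorem holds_ruleGao : M.Holds (ruleGao S) ↔ M.Gao := by
  simp only [ruleGao, holds_alg]
  constructor
  · intro h a
    simpa using h (val a a a a)
  · intro h v
    simpa using h (a := v 0)

theorem holds_ruleAnz : M.Holds (ruleAnz S) ↔ M.Anz := by
  simp only [ruleAnz, holds_alg]
  constructor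
  · intro h a
    have := h (val a a a a)
    simpa only [List.forall_mem_singleton, sat_eqZero, Term.eval_mul, Term.eval_x, val_zero]
      using this
  · intro h v
    have := h (a := v 0)
    simpa only [List.forall_mem_singleton, sat_eqZero, Term.eval_mul, Term.eval_x] using this

theorem holds_ruleAonz : M.Holds (ruleAonz S) ↔ M.Aonz := by
  simp only [ruleAonz, holds_alg]
  constructor
  · intro h c a
    simpa using h (val a c c c)
  · intro h v
    simpa using h (c := v 1) (a := v 0)

variable (p : S.hasPos = true)

theorem forall_asoDirect : (∀ r ∈ asoDirect S p, M.Holds r) ↔ M.Strict := by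
  simp only [asoDirect, Set.mem_insert_iff, Set.mem_singleton_iff, or_imp, forall_and,
    forall_eq, holds_alg]
  constructor
  · rintro ⟨h1, h2, h3, h4⟩
    refine ⟨?_, fun {a} => ?_, fun {a b} => ?_, fun {a b} => ?_⟩
    · simpa using h1 (val 0 0 0 0)
    · simpa using h2 (val a a a a)
    · simpa using h3 (val a b a a)
    · simpa using h4 (val a b 0 0)
  · intro h
    refine ⟨fun v => ?_, fun v => ?_, fun v => ?_, fun v => ?_⟩
    · simpa using h.one
    · simpa using h.nonneg
    · simpa using h.add
    · simpa using h.mul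

theorem holds_ruleCol : M.Holds (ruleCol S p) ↔ M.Col := by
  simp only [ruleCol, holds_alg]
  constructor
  · intro h
    simpa [Col] using h (val 0 0 0 0)
  · intro h v
    simpa [Col] using h

theorem holds_ruleLv : M.Holds (ruleLv S p) ↔ M.Lv := by
  simp only [ruleLv, holds_alg]
  constructor
  · intro h a b
    simpa using h (val a b a a)
  · intro h v
    simpa using h (a := v 0) (b := v 1)

theorem holds_ruleAso1 : M.Holds (ruleAso1 S p) ↔ M.Aso1 := by
  simp only [ruleAso1, holds_alg]
  constructor
  · intro h a b
    simpa using h (val a b a a)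
  · intro h v
    simpa using h (a := v 0) (b := v 1)

theorem holds_ruleAso2 : M.Holds (ruleAso2 S p) ↔ M.Aso2 := by
  simp only [ruleAso2, holds_alg]
  constructor
  · intro h a b
    simpa using h (val a b a a)
  · intro h v
    simpa using h (a := v 0) (b := v 1)

variable (s : S.hasSup = true)

theorem forall_supAx : (∀ r ∈ supAx S s, M.Holds r) ↔ M.IsSup := by
  simp only [supAx, Set.mem_insert_iff, Set.mem_singleton_iff, or_imp, forall_and,
    forall_eq, holds_alg]
  constructor
  · rintro ⟨h1, h2, h3⟩
    refine ⟨fun a b => ?_, fun a b => ?_, fun {a b c} => ?_⟩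
    · simpa using h1 (val a b a a)
    · simpa using h2 (val a b a a)
    · simpa using h3 (val a b c a)
  · intro h
    refine ⟨fun v => ?_, fun v => ?_, fun v => ?_⟩
    · simpa using h.left (v 0) (v 1)
    · simpa using h.right (v 0) (v 1)
    · simpa using h.le

theorem holds_ruleGrl : M.Holds (ruleGrl S s) ↔ M.Grl := by
  simp only [ruleGrl, holds_alg]
  constructor
  · intro h a b c
    simpa using h (val a b c a)
  · intro h v
    simpa using h (v 0) (v 1) (v 2)

theorem holds_ruleAfr : M.Holds (ruleAfr S s) ↔ M.Afr := by
  simp only [ruleAfr, holds_alg]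
  constructor
  · intro h a b c
    simpa using h (val a b c a)
  · intro h v
    simpa using h (v 0) (v 1) (v 2)

theorem forall_afrAx : (∀ r ∈ afrAx S s, M.Holds r) ↔ M.FRing := by
  simp only [afrAx, Set.mem_union, Set.mem_insert_iff, Set.mem_singleton_iff, or_imp, forall_and,
    forall_eq, holds_alg, holds_ruleGrl, holds_ruleAfr]
  constructor
  · rintro ⟨-, -, -, h3, h4, h5, h6, h7, h8, h9⟩
    refine ⟨fun a => ?_, fun a b => ?_, fun a b c => ?_, h6, h7, fun a => ⟨?_, ?_⟩⟩
    · simpa using h3 (val a a a a)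
    · simpa using h4 (val a b a a)
    · simpa using h5 (val a b c a)
    · simpa using h8 (val a a a a)
    · simpa using h9 (val a a a a)
  · intro h
    refine ⟨fun _ => M.holds_acAx, fun v hv => ?_, fun v hv => ?_, fun v => ?_, fun v => ?_,
      fun v => ?_, h.grl, h.afr, fun v => ?_, fun v => ?_⟩
    · have h0 : v 0 = 0 := by simpa using hv
      simp [h0]
    · have h0 : v 0 = 0 := by simpa using hv
      simp [h0]
    · simpa using h.idem (v 0)
    · simpa using h.comm (v 0) (v 1)
    · simpa using h.assoc (v 0) (v 1) (v 2)
    · simpa using (h.nonneg_iff (v 0)).1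
    · simpa using (h.nonneg_iff (v 0)).2

variable (f : S.hasFr = true)

theorem forall_frAx : (∀ r ∈ frAx S s f, M.Holds r) ↔ M.IsFr := by
  simp only [frAx, Set.mem_insert_iff, Set.mem_singleton_iff, or_imp, forall_and,
    forall_eq, holds_alg]
  constructor
  · rintro ⟨h1, h2⟩
    refine ⟨fun a b => ?_, fun a b => ?_, fun a b => ?_⟩
    · simpa [infAbs] using h1 (val a b a a)
    · have := h2 (val a b a a)
      simp at this
      exact this.1
    · have := h2 (val a b a a)
      simp at this
      simpa [infAbs] using this.2
  · intro h
    refine ⟨fun v => ?_, fun v => ?_⟩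
    · simpa [infAbs] using h.mul (v 0) (v 1)
    · simpa using ⟨h.nonneg (v 0) (v 1), h.le (v 0) (v 1)⟩

end Str

end DynAlg

namespace DynAlg

open Atom Rule Theory

namespace Str

variable {K : Type} [CommRing K] {M : Str K}

/-! ### Lattice-ordered rings -/

theorem Gao.sub {a b : K} (h : M.Gao) (h1 : M.nonneg (a - b)) (h2 : M.nonneg (b - a)) : a = b :=
  sub_eq_zero.1 (h h1 (by rwa [neg_sub]))

/-- Translations preserve the order, hence least upper bounds; the reverse inequality comes from
translating back by `-a`. -/
theorem IsSup.grl (hS : M.IsSup) (hG : M.Gao) : M.Grl := by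
  have mono : ∀ a b c, M.nonneg (a + M.sup b c - M.sup (a + b) (a + c)) := fun a b c => by
    refine hS.le ?_ ?_
    · convert hS.left b c using 1; ring
    · convert hS.right b c using 1; ring
  intro a b c
  refine hG.sub (mono a b c) ?_
  have h := hS.le (a := b) (b := c) (c := M.sup (a + b) (a + c) - a)
    (by convert hS.left (a + b) (a + c) using 1; ring)
    (by convert hS.right (a + b) (a + c) using 1; ring)
  convert h using 1
  ring

theorem IsSup.fRing (hS : M.IsSup) (hG : M.Gao) (hP : M.Preord) (hA : M.Afr) : M.FRing where
  idem a := hG.sub (hS.left a a) (hS.le (by simpa using hP.zero) (by simpa using hP.zero))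
  comm a b := hG.sub (hS.le (hS.right a b) (hS.left a b)) (hS.le (hS.right b a) (hS.left b a))
  assoc a b c := by
    have trans : ∀ {a b c}, M.nonneg (b - a) → M.nonneg (c - b) → M.nonneg (c - a) := by
      intro a b c h h'
      simpa using hP.add h' h
    exact hG.sub
      (hS.le (trans (hS.left a b) (hS.left _ c))
        (hS.le (trans (hS.right a b) (hS.left _ c)) (hS.right _ c)))
      (hS.le (hS.le (hS.left a _) (trans (hS.left b c) (hS.right a _)))
        (trans (hS.right b c) (hS.right a _)))
  grl := hS.grl hG
  afr := hA
  nonneg_iff a := by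
    refine ⟨fun h => hG.sub (hS.left a 0) (hS.le (by simpa using hP.zero) (by simpa using h)),
      fun h => ?_⟩
    have := hS.right a 0
    rwa [h, sub_zero] at this

namespace FRing

variable (h : M.FRing)
include h

theorem le_iff (a b : K) : M.nonneg (b - a) ↔ M.sup b a = b := by
  rw [h.nonneg_iff]
  have := h.grl a (b - a) 0
  rw [add_sub_cancel, add_zero] at this
  rw [← this]
  constructor
  · intro h; rw [h]; ring
  · intro h; linear_combination h

theorem gao : M.Gao := by
  intro a h1 h2
  rw [h.nonneg_iff] at h1 h2
  have := h.grl a (-a) 0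
  rw [h2, add_neg_cancel, add_zero, h.comm, h1] at this
  exact this.symm

theorem isSup : M.IsSup where
  left a b := by rw [h.le_iff, h.comm a b, h.assoc, h.idem]
  right a b := by rw [h.le_iff, h.assoc, h.idem]
  le {a b c} h1 h2 := by
    rw [h.le_iff] at *
    rw [← h.assoc, h1, h2]

theorem add_nonneg {a b : K} (ha : M.nonneg a) (hb : M.nonneg b) : M.nonneg (a + b) := by
  have h1 := (h.le_iff a (a + b)).1 (by simpa using hb)
  rw [h.nonneg_iff] at *
  calc M.sup (a + b) 0 = M.sup (M.sup (a + b) a) 0 := by rw [h1]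
    _ = a + b := by rw [h.assoc, ha, h1]

theorem mul_sup {a : K} (ha : M.nonneg a) (b c : K) : a * M.sup b c = M.sup (a * b) (a * c) := by
  have := h.afr a b c
  rwa [(h.nonneg_iff a).1 ha] at this

theorem mul_nonneg {a b : K} (ha : M.nonneg a) (hb : M.nonneg b) : M.nonneg (a * b) := by
  have := h.mul_sup ha b 0
  rw [(h.nonneg_iff b).1 hb, mul_zero] at this
  exact (h.nonneg_iff _).2 this.symm

/-- `a` and `b` are disjoint if `-a ∨ -b = 0`. -/
theorem mul_disjoint_mul {p a b : K} (hp : M.nonneg p) (hab : M.sup (-a) (-b) = 0) :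
    M.sup (-(p * a)) (-(p * b)) = 0 := by
  have := h.mul_sup hp (-a) (-b)
  rw [hab, mul_zero] at this
  rw [← mul_neg, ← mul_neg, ← this]

theorem nonneg_of_disjoint {a b : K} (hab : M.sup (-a) (-b) = 0) : M.nonneg a ∧ M.nonneg b := by
  have h1 := h.isSup.left (-a) (-b)
  have h2 := h.isSup.right (-a) (-b)
  rw [hab] at h1 h2
  exact ⟨by simpa using h1, by simpa using h2⟩

/-- When `b ≤ a`, the infimum of `a` and `b` is `b`, and disjointness says that it is zero. -/
theorem eq_zero_of_disjoint {a b : K} (hab : M.sup (-a) (-b) = 0) (hle : M.nonneg (a - b)) :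
    b = 0 := by
  have h1 : M.nonneg (-b - 0) := by
    rw [← hab]
    exact h.isSup.le (by convert hle using 1; ring) (by
      have := (h.nonneg_iff 0).2 (h.idem 0)
      simpa using this)
  exact h.gao (h.nonneg_of_disjoint hab).2 (by simpa using h1)

theorem pos_disjoint_neg (a : K) : M.sup (-M.sup a 0) (-M.sup (-a) 0) = 0 := by
  have h1 := h.grl (-a) a 0
  have h2 := h.grl (-M.sup a 0) 0 a
  rw [h.comm 0 a, neg_add_cancel, add_zero] at h2
  rw [neg_add_cancel, add_zero, h.comm 0] at h1
  rw [← h1]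
  convert h2.symm using 2
  ring

theorem pos_sub_neg (a : K) : M.sup a 0 - M.sup (-a) 0 = a := by
  have h1 := h.grl (-a) a 0
  rw [neg_add_cancel, add_zero, h.comm 0] at h1
  linear_combination h1

/-- Let `e = 1⁺` and `f = (-1)⁺`, so `e - f = 1`. The elements `e * e` and `e * f` are disjoint and
differ by `e ≥ 0`, so `e * f = 0`. Then `-f = f * f ≥ 0` gives `f = 0`, and `1 = e`. -/
theorem one_nonneg : M.nonneg 1 := by
  have hd := h.pos_disjoint_neg 1
  obtain ⟨he, hf⟩ := h.nonneg_of_disjoint hd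
  have hs := h.pos_sub_neg 1
  set e := M.sup 1 0
  set f := M.sup (-1) 0
  have h1 := h.eq_zero_of_disjoint (h.mul_disjoint_mul he hd) (by
    convert he using 1
    linear_combination e * hs)
  have h2 : f = 0 := h.gao hf (by
    convert h.mul_nonneg hf hf using 1
    linear_combination f * hs - h1)
  rw [← hs, h2, sub_zero]
  exact he

/-- Multiplying both elements by `1 + p` keeps them disjoint, and the results dominate `p * a` and
`b`. This is where `1 ≥ 0` is needed. -/
theorem mul_disjoint {p a b : K} (hp : M.nonneg p) (hab : M.sup (-a) (-b) = 0) :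
    M.sup (-(p * a)) (-b) = 0 := by
  obtain ⟨ha, hb⟩ := h.nonneg_of_disjoint hab
  have h1 := h.mul_disjoint_mul (h.add_nonneg h.one_nonneg hp) hab
  refine Gao.sub h.gao ?_ ?_
  · rw [← h1]
    refine h.isSup.le ?_ ?_
    · convert h.add_nonneg (h.isSup.left (-(p * a)) (-b)) ha using 1
      ring
    · convert h.add_nonneg (h.isSup.right (-(p * a)) (-b)) (h.mul_nonneg hp hb) using 1
      ring
  · refine h.isSup.le ?_ ?_
    · simpa using h.mul_nonneg hp ha
    · simpa using hb

/-- Multiplying one member by `b`, then the other by `a`, makes `a * b` disjoint from itself. -/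
theorem mul_eq_zero_of_disjoint {a b : K} (hab : M.sup (-a) (-b) = 0) : a * b = 0 := by
  obtain ⟨ha, hb⟩ := h.nonneg_of_disjoint hab
  have h1 := h.mul_disjoint hb hab
  have h2 := h.mul_disjoint ha ((h.comm _ _).trans h1)
  rw [mul_comm b a, h.idem, neg_eq_zero] at h2
  exact h2

theorem pos_mul_neg (a : K) : M.sup a 0 * M.sup (-a) 0 = 0 :=
  h.mul_eq_zero_of_disjoint (h.pos_disjoint_neg a)

theorem preord : M.Preord where
  zero := (h.nonneg_iff 0).2 (h.idem 0)
  add := h.add_nonneg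
  mul := h.mul_nonneg
  sq a := by
    obtain ⟨he, hf⟩ := h.nonneg_of_disjoint (h.pos_disjoint_neg a)
    convert h.add_nonneg (h.mul_nonneg he he) (h.mul_nonneg hf hf) using 1
    have h1 := h.pos_sub_neg a
    have h2 := h.pos_mul_neg a
    set e := M.sup a 0
    set f := M.sup (-a) 0
    rw [← h1]
    linear_combination -2 * h2

/-- The factors are the positive parts of `b - a` and `a - b`. In a field the identity says that the
supremum is one of its arguments, which is how homomorphisms come to respect `∨`. -/
theorem sup_sub_mul (a b : K) : (M.sup a b - a) * (M.sup a b - b) = 0 := by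
  have h1 := h.grl (-a) a b
  have h2 := h.grl (-b) a b
  have h3 := h.pos_mul_neg (b - a)
  rw [neg_add_cancel, neg_add_eq_sub, neg_add_eq_sub, h.comm 0] at h1
  rw [neg_add_cancel, neg_add_eq_sub, neg_add_eq_sub] at h2
  rw [neg_sub, ← h2, ← h1] at h3
  exact h3

/-- With `f` the negative part of `a`, multiplying the hypothesis by `f` gives `-f⁴ - c f² ≥ 0`.
Hence `f⁴ = 0`, and `f = 0` by **Anz**. -/
theorem aonz (hA : M.Anz) : M.Aonz := by
  intro c a hc ha
  have hP := h.preord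
  obtain ⟨he, hf⟩ := h.nonneg_of_disjoint (h.pos_disjoint_neg a)
  have h1 := h.pos_sub_neg a
  have h2 := h.pos_mul_neg a
  set e := M.sup a 0
  set f := M.sup (-a) 0
  have h3 : M.nonneg (-(f * f * (f * f)) - c * (f * f)) := by
    convert h.mul_nonneg hf ha using 1
    rw [← h1]
    linear_combination (-e ^ 2 + 3 * e * f - 3 * f ^ 2 - c) * h2
  have h4 : f * f * (f * f) = 0 := by
    refine h.gao (hP.sq _) ?_
    convert h.add_nonneg h3 (h.mul_nonneg hc (hP.sq f)) using 1
    ring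
  have h5 : f = 0 := hA (hA h4)
  rw [← h1, h5, sub_zero]
  exact he

end FRing

end Str

end DynAlg

namespace DynAlg

open Atom Rule Theory

namespace Str

/-! ### Positivity certificates and homomorphisms to ordered fields -/

section Hom

variable {R : Type} [CommRing R] {M : Str R}

theorem Preord.isCone (hP : M.Preord) : IsCone {a | M.nonneg a} := ⟨hP.add, hP.mul, hP.sq⟩

theorem Preord.nonneg_of_add_self (hP : M.Preord) (hA : M.Aonz) {a : R}
    (h : M.nonneg (a + a)) : M.nonneg a := by
  -- **Aonz** with `c = a²`: here `a (a² + c) = (a + a) a²`.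
  refine hA (hP.sq a) ?_
  convert hP.mul h (hP.sq a) using 1
  ring

theorem Preord.add_one_add_sq (hP : M.Preord) (hA : M.Aonz) (a : R) :
    M.nonneg (a + (1 + a * a)) := by
  refine hP.nonneg_of_add_self hA ?_
  convert hP.add (hP.sq (a + 1)) (hP.add (hP.sq 1) (hP.sq a)) using 1
  ring

/-- Each step lowers the exponent by two. For `b = a ^ (2m + 1)` and `c = a²`, the element `b (b² +
c)` is `a ^ (2m + 3)` times the square of `a ^ (2m)`, plus `a ^ (2m + 3)`. -/
theorem Preord.nonneg_of_odd_pow (hP : M.Preord) (hA : M.Aonz) {a : R} (m : ℕ)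
    (h : M.nonneg (a ^ m * a ^ m * a)) : M.nonneg a := by
  induction m with
  | zero => simpa using h
  | succ m ih =>
    refine ih (hA (hP.sq a) ?_)
    convert hP.add (hP.mul h (hP.sq (a ^ m * a ^ m))) h using 1
    ring

/-- The certificate excluded when `-a` is adjoined to the cone. By **Aso1** and odd powers it
suffices that `b = s u² a` is nonnegative, where `u = a ^ m`. **Aonz** with `c = q s t` yields this:
substituting the identity turns `b (b² + c)` into `s³ u⁴ (u² a³ + t) + s² u² t p`. -/
theorem Preord.nonneg_of_mul_eq (hP : M.Preord) (hA : M.Aonz) (h1 : M.Aso1) {a s p q : R}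
    (hs : M.pos s) (hs' : M.nonneg s) (hp : M.nonneg p) (hq : M.nonneg q) (m : ℕ)
    (h : s * (a ^ m * a ^ m) + p = q * a) : M.nonneg a := by
  refine hP.nonneg_of_odd_pow hA m (h1 hs ?_)
  set u := a ^ m
  -- With `r = u² a³` this is `1 + r²`, chosen so that both `t` and `r + t` are nonnegative.
  set t := 1 + (u * u * (a * a * a)) * (u * u * (a * a * a))
  have ht : M.nonneg t := hP.add (by simpa using hP.sq 1) (hP.sq _)
  refine hA (c := q * s * t) (hP.mul (hP.mul hq hs') ht) ?_
  convert hP.add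
    (hP.mul (hP.mul (hP.mul hs' (hP.sq s)) (hP.sq (u * u)))
      (hP.add_one_add_sq hA (u * u * (a * a * a))))
    (hP.mul (hP.mul (hP.sq (s * u)) ht) hp) using 1
  linear_combination -s ^ 2 * u ^ 2 * t * h

/-- Adjoin `-a` to the cone and keep the elements `s * a ^ (2m)` positive; having `a²` among them
excludes `φ a = 0`. No additive rule for `pos` is required, so the result also serves when `pos`
means equality with `1`. -/
theorem exists_hom_neg (hP : M.Preord) (hA : M.Aonz) (h1 : M.Aso1) (hone : M.pos 1)
    (hnn : ∀ {s}, M.pos s → M.nonneg s) (hmul : ∀ {s t}, M.pos s → M.pos t → M.pos (s * t))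
    {a : R} (ha : ¬ M.nonneg a) :
    ∃ (K : Type) (_ : Field K) (_ : LinearOrder K) (_ : IsStrictOrderedRing K),
      PolyIVT K ∧ ∃ φ : R →+* K, (∀ b, M.nonneg b → 0 ≤ φ b) ∧ (∀ s, M.pos s → 0 < φ s) ∧
        φ a < 0 := by
  let N : Submonoid R :=
    { carrier := {n | ∃ s m, M.pos s ∧ n = s * (a ^ m * a ^ m)}
      one_mem' := ⟨1, 0, hone, by simp⟩
      mul_mem' := by
        rintro _ _ ⟨s, m, hs, rfl⟩ ⟨s', m', hs', rfl⟩
        exact ⟨s * s', m + m', hmul hs hs', by ring⟩ }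
  have hC := hP.isCone
  obtain ⟨K, i1, i2, i3, hK, φ, hφ, hφN⟩ := (hC.adjoin (-a)).exists_hom N
    (by
      rintro _ ⟨s, m, hs, rfl⟩
      exact hC.subset_adjoin _ (hP.mul (hnn hs) (hP.sq _)))
    (by
      rintro _ ⟨s, m, hs, rfl⟩ ⟨p, hp, q, hq, h⟩
      exact ha (hP.nonneg_of_mul_eq hA h1 hs (hnn hs) hp hq m (by linear_combination -h)))
  refine ⟨K, i1, i2, i3, hK, φ, fun b hb => hφ b (hC.subset_adjoin _ hb),
    fun s hs => hφN s ⟨s, 0, hs, by simp⟩, ?_⟩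
  have h2 := hφ _ (hC.mem_adjoin (-a))
  have h3 := hφN (a * a) ⟨1, 1, hone, by simp⟩
  rw [map_neg, Left.nonneg_neg_iff] at h2
  refine lt_of_le_of_ne h2 fun h0 => ?_
  simp [h0] at h3

/-- If adjoining `-a` produced some `-s` with `s > 0`, then `q * a = s + p > 0` for some `p, q ≥ 0`,
and **Aso2** would give `a > 0`. -/
theorem exists_hom_nonpos (hP : M.Preord) (hS : M.Strict) (h2 : M.Aso2)
    {a : R} (ha : ¬ M.pos a) :
    ∃ (K : Type) (_ : Field K) (_ : LinearOrder K) (_ : IsStrictOrderedRing K),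
      PolyIVT K ∧ ∃ φ : R →+* K, (∀ b, M.nonneg b → 0 ≤ φ b) ∧ (∀ s, M.pos s → 0 < φ s) ∧
        φ a ≤ 0 := by
  let N : Submonoid R :=
    { carrier := {n | M.pos n}
      one_mem' := hS.one
      mul_mem' := hS.mul }
  have hC := hP.isCone
  obtain ⟨K, i1, i2, i3, hK, φ, hφ, hφN⟩ := (hC.adjoin (-a)).exists_hom N
    (fun s hs => hC.subset_adjoin _ (hS.nonneg hs))
    (by
      rintro s hs ⟨p, hp, q, hq, h⟩
      refine ha (h2 hq ?_)
      have h3 : q * a = s + p := by linear_combination h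
      rw [h3]
      exact hS.add hs hp)
  refine ⟨K, i1, i2, i3, hK, φ, fun b hb => hφ b (hC.subset_adjoin _ hb), hφN, ?_⟩
  simpa using hφ _ (hC.mem_adjoin (-a))

end Hom

/-! ### Ordered fields as structures -/

/-- The structure of an ordered field. -/
def ofField (K : Type) [Field K] [LinearOrder K] : Str K where
  nonneg a := 0 ≤ a
  pos a := 0 < a
  sup := max
  fr a b := min (max a (-a)) (max b (-b)) ^ 2 / max b (-b)

/-- The properties common to the reduced theories. -/
structure Reduced {R : Type} [CommRing R] (M : Str R) (S : Sig) : Prop where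
  preord : M.Preord
  gao : M.Gao
  aonz : M.Aonz
  aso1 : M.Aso1
  pos_one : M.pos 1
  pos_nonneg : ∀ {s}, M.pos s → M.nonneg s
  pos_mul : ∀ {s t}, M.pos s → M.pos t → M.pos (s * t)
  strict : S.hasPos = true → M.Strict ∧ M.Aso2
  fRing : S.hasSup = true → M.FRing
  isFr : S.hasFr = true → M.FRing ∧ M.IsFr

section Eval

variable {R : Type} [CommRing R] {M : Str R} {S : Sig} {V : Type}
  {K : Type} [Field K] [LinearOrder K] [IsStrictOrderedRing K] {φ : R →+* K}

theorem FRing.map_sup (hF : M.FRing) (hφ : ∀ b, M.nonneg b → 0 ≤ φ b) (a b : R) :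
    φ (M.sup a b) = max (φ a) (φ b) := by
  have h1 := hφ _ (hF.isSup.left a b)
  have h2 := hφ _ (hF.isSup.right a b)
  have h3 := congrArg φ (hF.sup_sub_mul a b)
  simp only [map_sub, map_mul, map_zero, mul_eq_zero, sub_nonneg, sub_eq_zero] at h1 h2 h3
  rcases h3 with h | h
  · rw [h, max_eq_left (h ▸ h2)]
  · rw [h, max_eq_right (h ▸ h1)]

/-- The product rule determines the value where `φ b ≠ 0`. Where `φ b = 0` the two bounds force `0`,
in agreement with division by zero in `ofField`. -/
theorem IsFr.map_fr (hI : M.IsFr) (hF : M.FRing) (hφ : ∀ b, M.nonneg b → 0 ≤ φ b) (a b : R) :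
    φ (M.fr a b) = min (max (φ a) (-φ a)) (max (φ b) (-φ b)) ^ 2 / max (φ b) (-φ b) := by
  have hinf : φ (M.infAbs a b) = min (max (φ a) (-φ a)) (max (φ b) (-φ b)) := by
    simp only [infAbs, map_neg, hF.map_sup hφ, max_neg_neg, neg_neg]
  have h1 := congrArg φ (hI.mul a b)
  have h2 := hφ _ (hI.nonneg a b)
  have h3 := hφ _ (hI.le a b)
  simp only [map_mul, map_sub, hF.map_sup hφ, hinf, map_neg, sub_nonneg] at h1 h3
  by_cases h0 : max (φ b) (-φ b) = 0
  · rw [h0, div_zero]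
    exact le_antisymm (h3.trans ((min_le_right _ _).trans_eq h0)) h2
  · rw [eq_div_iff h0, h1, sq]

theorem Reduced.map_eval (hM : M.Reduced S) (hφ : ∀ b, M.nonneg b → 0 ≤ φ b) (v : V → R)
    (t : Term S V) : φ (t.eval M v) = t.eval (ofField K) fun i => φ (v i) := by
  induction t with
  | sup h a b iha ihb =>
    simp only [Term.eval, (hM.fRing h).map_sup hφ, iha, ihb]
    rfl
  | fr h a b iha ihb =>
    simp only [Term.eval, (hM.isFr h).2.map_fr (hM.isFr h).1 hφ, iha, ihb]
    rfl
  | _ => simp_all [Term.eval]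

theorem Reduced.sat_map (hM : M.Reduced S) (hφ : ∀ b, M.nonneg b → 0 ≤ φ b)
    (hpos : ∀ b, M.pos b → 0 < φ b) (v : V → R) (A : Atom S V) (hA : A.Sat M v) :
    A.Sat (ofField K) fun i => φ (v i) := by
  cases A with
  | eqZero t =>
    have h : t.eval M v = 0 := hA
    rw [sat_eqZero, ← hM.map_eval hφ, h, map_zero]
  | nonneg t =>
    rw [sat_nonneg, ← hM.map_eval hφ]
    exact hφ _ hA
  | pos p t =>
    rw [sat_pos, ← hM.map_eval hφ]
    exact hpos _ hA

end Eval

/-- An algebraic rule which holds in the ordered fields with the intermediate value property holds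
in all reduced structures. -/
theorem Reduced.holds_alg {R : Type} [CommRing R] {M : Str R} {S : Sig} (hM : M.Reduced S)
    {V : Type} {Γ Δ : List (Atom S V)}
    (h : ∀ (K : Type) [Field K] [LinearOrder K] [IsStrictOrderedRing K], PolyIVT K →
      (ofField K).Holds (alg Γ Δ)) : M.Holds (alg Γ Δ) := by
  rw [Str.holds_alg]
  intro v hv A hA
  -- Nonnegativity is tested in fields: a term that is not nonnegative in `M` becomes negative under
  -- some homomorphism. Equalities are handled by testing `t` and `-t`.
  have hnn : ∀ t : Term S V, (∀ (K : Type) [Field K] [LinearOrder K] [IsStrictOrderedRing K],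
      ∀ φ : R →+* K, (∀ A : Atom S V, A.Sat M v → A.Sat (ofField K) fun i => φ (v i)) →
      PolyIVT K → 0 ≤ t.eval (ofField K) fun i => φ (v i)) → M.nonneg (t.eval M v) := by
    intro t ht
    by_contra hcon
    obtain ⟨K, i1, i2, i3, hK, φ, hφ, hpos, hlt⟩ :=
      exists_hom_neg hM.preord hM.aonz hM.aso1 hM.pos_one hM.pos_nonneg hM.pos_mul hcon
    have := ht K φ (fun A => hM.sat_map hφ hpos v A) hK
    rw [← hM.map_eval hφ] at this
    exact absurd hlt (not_lt.2 this)
  have hsat : ∀ (K : Type) [Field K] [LinearOrder K] [IsStrictOrderedRing K] (φ : R →+* K),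
      (∀ A : Atom S V, A.Sat M v → A.Sat (ofField K) fun i => φ (v i)) → PolyIVT K →
      A.Sat (ofField K) fun i => φ (v i) := by
    intro K _ _ _ φ hφ hK
    exact ((ofField K).holds_alg _ _).1 (h K hK) _ (fun B hB => hφ B (hv B hB)) A hA
  cases A with
  | eqZero t =>
    refine hM.gao (hnn t fun K _ _ _ φ hφ hK => ?_) (hnn (-t) fun K _ _ _ φ hφ hK => ?_)
    · exact (hsat K φ hφ hK).ge
    · have : t.eval (ofField K) (fun i => φ (v i)) = 0 := hsat K φ hφ hK
      simp [this]
  | nonneg t => exact hnn t fun K _ _ _ φ hφ hK => hsat K φ hφ hK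
  | pos p t =>
    by_contra hcon
    obtain ⟨K, i1, i2, i3, hK, φ, hφ, hpos, hle⟩ :=
      exists_hom_nonpos hM.preord (hM.strict p).1 (hM.strict p).2 hcon
    have : 0 < t.eval (ofField K) fun i => φ (v i) :=
      hsat K φ (fun A => hM.sat_map hφ hpos v A) hK
    rw [← hM.map_eval hφ] at this
    exact absurd this (not_lt.2 hle)

end Str

/-- Completeness of a theory for the ordered fields with the intermediate value property. -/
theorem Theory.proves_of_reduced {T : Theory} (hT : ∀ r ∈ acAx T.sig, T.Proves r)
    (hM : ∀ (R : Type) [CommRing R] (M : Str R), T.AlgModel M → M.Reduced T.sig)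
    {Γ Δ : List (Atom T.sig ℕ)}
    (h : ∀ (K : Type) [Field K] [LinearOrder K] [IsStrictOrderedRing K], PolyIVT K →
      (Str.ofField K).Holds (alg Γ Δ)) : T.Proves (alg Γ Δ) :=
  derives_of_models hT fun R _ M hMT v hv =>
    (M.holds_alg _ _).1 ((hM R M hMT).holds_alg h) v hv

end DynAlg

namespace DynAlg

open Atom Rule Theory

/-! ### The rules valid in ordered fields -/

namespace Str

section OfField

variable (K : Type) [Field K] [LinearOrder K] [IsStrictOrderedRing K]

theorem ofField_preord : (ofField K).Preord where
  zero := le_refl (0 : K)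
  add := fun {a b} (ha : 0 ≤ a) (hb : 0 ≤ b) => add_nonneg ha hb
  sq := mul_self_nonneg
  mul := fun {a b} (ha : 0 ≤ a) (hb : 0 ≤ b) => mul_nonneg ha hb

theorem ofField_gao : (ofField K).Gao := fun {a} (h : 0 ≤ a) (h' : 0 ≤ -a) =>
  le_antisymm (neg_nonneg.1 h') h

theorem ofField_anz : (ofField K).Anz := fun h => mul_self_eq_zero.1 h

theorem ofField_strict : (ofField K).Strict where
  one := one_pos (α := K)
  nonneg := fun {a} (h : 0 < a) => h.le
  add := fun {a b} (ha : 0 < a) (hb : 0 ≤ b) => add_pos_of_pos_of_nonneg ha hb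
  mul := fun {a b} (ha : 0 < a) (hb : 0 < b) => mul_pos ha hb

theorem ofField_col : (ofField K).Col := fun h => absurd h (lt_irrefl (0 : K))

theorem ofField_lv : (ofField K).Lv := fun {a b} h => by
  have : a ≠ 0 := by rintro rfl; simp at h
  exact mul_self_pos.2 this

theorem ofField_aso1 : (ofField K).Aso1 := fun {a b} (ha : 0 < a) (h : 0 ≤ a * b) =>
  (mul_nonneg_iff_of_pos_left ha).1 h

theorem ofField_aso2 : (ofField K).Aso2 := fun {a b} (ha : 0 ≤ a) (h : 0 < a * b) =>
  pos_of_mul_pos_right h ha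

theorem ofField_aonz : (ofField K).Aonz := fun {c a} (hc : 0 ≤ c) (h : 0 ≤ a * (a * a + c)) => by
  by_contra hcon
  have ha : a < 0 := not_le.1 hcon
  have h1 : 0 < a * a + c := add_pos_of_pos_of_nonneg (mul_pos_of_neg_of_neg ha ha) hc
  exact absurd h (not_le.2 (mul_neg_of_neg_of_pos ha h1))

theorem ofField_isSup : (ofField K).IsSup where
  left a b := sub_nonneg.2 (le_max_left a b)
  right a b := sub_nonneg.2 (le_max_right a b)
  le := fun {a b c} (h : 0 ≤ c - a) (h' : 0 ≤ c - b) =>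
    sub_nonneg.2 (max_le (sub_nonneg.1 h) (sub_nonneg.1 h'))

theorem ofField_afr : (ofField K).Afr := fun a b c =>
  mul_max_of_nonneg b c (le_max_right a 0)

theorem ofField_fRing : (ofField K).FRing :=
  (ofField_isSup K).fRing (ofField_gao K) (ofField_preord K) (ofField_afr K)

theorem ofField_isFr : (ofField K).IsFr := by
  have hinf : ∀ a b : K, (ofField K).infAbs a b = min (max a (-a)) (max b (-b)) := by
    intro a b
    change -max (-max a (-a)) (-max b (-b)) = _
    rw [max_neg_neg, neg_neg]
  have habs : ∀ a : K, 0 ≤ max a (-a) := fun a => abs_nonneg a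
  refine ⟨fun a b => ?_, fun a b => ?_, fun a b => ?_⟩
  · rw [hinf]
    change min (max a (-a)) (max b (-b)) ^ 2 / max b (-b) * max b (-b) = _
    -- At `b = 0` the minimum vanishes as well, so the identity survives the convention for division
    -- by zero.
    by_cases h : max b (-b) = 0
    · simp [h, min_eq_right (habs a)]
    · rw [div_mul_cancel₀ _ h, sq]
  · exact div_nonneg (sq_nonneg _) (habs b)
  · rw [hinf]
    change 0 ≤ min (max a (-a)) (max b (-b)) - min (max a (-a)) (max b (-b)) ^ 2 / max b (-b)
    have hm : 0 ≤ min (max a (-a)) (max b (-b)) := le_min (habs a) (habs b)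
    rw [sub_nonneg, sq, mul_div_assoc]
    exact mul_le_of_le_one_right hm (div_le_one_of_le₀ (min_le_right _ _) (habs b))

variable (S : Sig)

theorem ofField_OT : (ofField K).Holds (ruleOT S) := by
  rw [ruleOT, holds_disj]
  intro v _
  simpa [ofField] using le_total 0 (v 0)

variable (p : S.hasPos = true)

theorem ofField_ED : (ofField K).Holds (ruleED S p) := by
  rw [ruleED, holds_disj]
  intro v _
  by_cases h : v 0 = 0
  · left; simpa using h
  · right; simpa [ofField] using h

theorem ofField_OTF : (ofField K).Holds (ruleOTF S p) := by
  rw [ruleOTF, holds_disj]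
  intro v hv
  have h : 0 < v 0 + v 1 := by simpa [ofField] using hv
  by_cases h0 : 0 < v 0
  · left; simpa [ofField] using h0
  · right; simpa [ofField] using (by linarith : 0 < v 1)

theorem ofField_IV : (ofField K).Holds (ruleIV S p) := by
  rw [ruleIV, holds_ex]
  intro v hv
  have h : 0 < v 0 := by simpa [ofField] using hv
  refine ⟨(v 0)⁻¹, ?_⟩
  simp only [List.forall_mem_singleton, sat_eq, Term.eval_mul, Term.eval_subst, Term.eval_x,
    Term.eval_var, Term.eval_one]
  exact mul_inv_cancel₀ h.ne'

theorem ofField_RCF (hK : PolyIVT K) (n : ℕ) : (ofField K).Holds (ruleRCF S p n) := by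
  simp only [ruleRCF]
  rw [holds_ex]
  intro v hv
  simp only [List.forall_mem_cons, sat_lt, Term.eval_mul, Term.eval_poly, Term.eval_x,
    Term.eval_y, Term.eval_var, Term.eval_zero] at hv
  obtain ⟨h1, h2, -⟩ := hv
  let P : Polynomial K := ∑ i ∈ Finset.range (n + 1), Polynomial.C (v (i + 2)) * Polynomial.X ^ i
  have hP : ∀ t, P.eval t = ∑ i ∈ Finset.range (n + 1), v (i + 2) * t ^ i := fun t => by
    simp [P, Polynomial.eval_finsetSum]
  rw [← hP, ← hP, zero_sub] at h2
  obtain ⟨t, ht, hat, htb⟩ := hK P (v 0) (v 1) (sub_pos.1 h1) (neg_pos.1 h2)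
  refine ⟨t, ?_⟩
  rw [hP] at ht
  simp only [List.forall_mem_cons, sat_lt, sat_eqZero, Term.eval_poly, Term.eval_subst, Term.eval_x,
    Term.eval_y, Term.eval_var, Sum.elim_inl, Sum.elim_inr]
  exact ⟨ht, sub_pos.2 hat, sub_pos.2 htb, by simp⟩

theorem ofField_codAx : ∀ r ∈ codAx S p, (ofField K).Holds r := by
  simp only [codAx, Set.mem_union, Set.mem_insert_iff, Set.mem_singleton_iff, or_imp, forall_and,
    forall_eq, forall_apoAx, forall_asoDirect, holds_ruleCol, holds_ruleGao, holds_ruleLv]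
  exact ⟨⟨ofField_preord K, ofField_strict K⟩, ofField_col K, ofField_gao K, ofField_lv K,
    ofField_IV K S p, ofField_OT K S, ofField_ED K S p⟩

theorem ofField_crcdAx (hK : PolyIVT K) : ∀ r ∈ crcdAx S p, (ofField K).Holds r := by
  rintro r (hr | ⟨n, rfl⟩)
  · exact ofField_codAx K S p r hr
  · exact ofField_RCF K S p hK n

variable (s : S.hasSup = true)

theorem ofField_supAx : ∀ r ∈ supAx S s, (ofField K).Holds r :=
  (forall_supAx _ S s).2 (ofField_isSup K)

theorem ofField_frAx (f : S.hasFr = true) : ∀ r ∈ frAx S s f, (ofField K).Holds r :=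
  (forall_frAx _ S s f).2 (ofField_isFr K)

theorem ofField_co0Ax : ∀ r ∈ co0Ax S s p, (ofField K).Holds r := by
  simp only [co0Ax, Set.mem_union, Set.mem_insert_iff, Set.mem_singleton_iff, or_imp, forall_and,
    forall_eq, forall_apoAx, forall_asoDirect, forall_supAx, holds_ruleGrl, holds_ruleAfr,
    holds_ruleGao, holds_ruleAnz, holds_ruleAonz, holds_ruleLv, holds_ruleAso1, holds_ruleAso2]
  exact ⟨⟨⟨ofField_preord K, ofField_strict K⟩, ofField_isSup K⟩, (ofField_fRing K).grl,
    ofField_afr K, ofField_gao K, ofField_anz K, ofField_aonz K, ofField_lv K, ofField_aso1 K,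
    ofField_aso2 K, ofField_IV K S p, ofField_OTF K S p⟩

theorem ofField_aftrAx (f : S.hasFr = true) : ∀ r ∈ aftrAx S s p f, (ofField K).Holds r := by
  simp only [aftrAx, afrnzAx, Set.mem_union, Set.mem_insert_iff, Set.mem_singleton_iff, or_imp,
    forall_and, forall_eq, forall_afrAx, forall_frAx, holds_ruleAnz]
  refine ⟨⟨⟨ofField_fRing K, ofField_anz K⟩, ?_, ?_, ?_⟩, ofField_isFr K⟩
  · rw [holds_alg]
    intro v
    simpa using (ofField_strict K).nonneg
  · rw [holds_ex]
    intro v hv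
    have h : 0 < v 0 := by simpa [ofField] using hv
    refine ⟨(v 0)⁻¹, ?_⟩
    simp only [List.forall_mem_singleton, sat_eq, Term.eval_mul, Term.eval_subst, Term.eval_x,
      Term.eval_var, Term.eval_one]
    exact inv_mul_cancel₀ h.ne'
  · rw [holds_alg]
    intro v hv
    simp only [List.forall_mem_cons, sat_nonneg, sat_eq, Term.eval_mul, Term.eval_x, Term.eval_z,
      Term.eval_one] at hv
    obtain ⟨h1, h2, -⟩ := hv
    have h3 : v 0 ≠ 0 := by rintro h; simp [h] at h2
    have h4 : (ofField K).pos (v 0) := lt_of_le_of_ne h1 h3.symm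
    simpa using h4

end OfField

end Str

/-! ### Case distinctions and inverses in dynamical proofs -/

namespace Theory

variable {T : Theory} {V : Type}

section Split

variable (hT : ∀ r ∈ acAx T.sig, T.Proves r) {Γ Δ : List (Atom T.sig V)}

-- Models of the algebraic rules need not be totally ordered, so **OT** is applied in the proof tree
-- and each of the two branches is then checked in models.
include hT in
theorem derives_of_OT (hOT : T.Proves (ruleOT T.sig)) (t : Term T.sig V)
    (h : ∀ (K : Type) [CommRing K] (M : Str K), T.AlgModel M → ∀ v : V → K,
      (∀ A ∈ Γ, A.Sat M v) → (M.nonneg (t.eval M v) ∨ M.nonneg (-t.eval M v)) →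
      ∀ A ∈ Δ, A.Sat M v) : T.Derives Γ [plain Δ] := by
  have h1 := hOT.inst (fun _ => t) (Γ := Γ) (by simp [ruleOT, disj])
  simp only [ruleOT, disj, List.map_cons, List.map_nil, plain_subst] at h1
  refine h1.cut_plain₂ ?_ ?_ <;>
  · refine derives_of_models hT fun K _ M hM v hv => ?_
    rw [List.forall_mem_append, List.forall_mem_singleton, sat_subst] at hv
    refine h K M hM v hv.1 ?_
    first
      | exact Or.inl (by simpa using hv.2)
      | exact Or.inr (by simpa using hv.2)

include hT in
theorem derives_of_ED {p : T.sig.hasPos = true} (hED : T.Proves (ruleED T.sig p))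
    (t : Term T.sig V)
    (h : ∀ (K : Type) [CommRing K] (M : Str K), T.AlgModel M → ∀ v : V → K,
      (∀ A ∈ Γ, A.Sat M v) → (t.eval M v = 0 ∨ M.pos (t.eval M v * t.eval M v)) →
      ∀ A ∈ Δ, A.Sat M v) : T.Derives Γ [plain Δ] := by
  have h1 := hED.inst (fun _ => t) (Γ := Γ) (by simp [ruleED, disj])
  simp only [ruleED, disj, List.map_cons, List.map_nil, plain_subst] at h1
  refine h1.cut_plain₂ ?_ ?_ <;>
  · refine derives_of_models hT fun K _ M hM v hv => ?_
    rw [List.forall_mem_append, List.forall_mem_singleton, sat_subst] at hv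
    refine h K M hM v hv.1 ?_
    first
      | exact Or.inl (by simpa using hv.2)
      | exact Or.inr (by simpa using hv.2)

-- The inverse enters as a fresh variable of the extended context; in a model its value is the
-- element `u`. The positivity atom is first added by a cut, since an axiom can only be applied to
-- atoms present at the node.
include hT in
theorem derives_of_IV {p : T.sig.hasPos = true} (hIV : T.Proves (ruleIV T.sig p))
    (t : Term T.sig V) (ht : T.Thm Γ (pos p t))
    (h : ∀ (K : Type) [CommRing K] (M : Str K), T.AlgModel M → ∀ v : V → K,
      (∀ A ∈ Γ, A.Sat M v) → ∀ u, t.eval M v * u = 1 → ∀ A ∈ Δ, A.Sat M v) :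
    T.Derives Γ [plain Δ] := by
  refine Derives.cut_list (Γ := Γ) (Γ' := Γ ++ [pos p t]) ?_ ?_
  · rw [List.forall_mem_append, List.forall_mem_singleton]
    exact ⟨derives_plain_iff.1 (derives_plain_of_mem fun _ h => h), ht⟩
  have h1 := hIV.inst (fun _ => t) (Γ := Γ ++ [pos p t]) (by
    intro A hA
    obtain rfl := List.mem_singleton.1 hA
    exact List.mem_append_right _ (List.mem_singleton.2 rfl))
  refine h1.cut fun B hB => ?_
  simp only [ruleIV, ex, List.map_cons, List.map_nil, List.mem_singleton] at hB
  subst hB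
  simp only [List.map_cons, List.map_nil, plain_subst]
  refine derives_of_models hT fun K _ M hM v hv => ?_
  simp only [List.forall_mem_append, List.forall_mem_map, sat_subst, Term.eval_var,
    Branch.inst_eq, List.forall_mem_singleton, sat_eq, Term.eval_mul, Term.eval_subst,
    Term.eval_x, Term.eval_one] at hv ⊢
  refine h K M hM _ hv.1.1 (v (Sum.inr 0)) ?_
  simpa [Term.eval_subst] using hv.2

end Split

end Theory

end DynAlg

namespace DynAlg

open Atom Rule Theory

/-! ### Algebraic axioms -/

/-- The rules of the form `Γ ⊢ Δ`. -/
def IsAlg {S : Sig} (r : Rule S ℕ) : Prop := ∃ Γ Δ, r = alg Γ Δ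

section IsAlg

variable {S : Sig}

theorem isAlg_alg (Γ Δ : List (Atom S ℕ)) : IsAlg (alg Γ Δ) := ⟨Γ, Δ, rfl⟩

theorem isAlg_acAx : ∀ r ∈ acAx S, IsAlg r := by
  simp only [acAx, Set.mem_insert_iff, Set.mem_singleton_iff, or_imp, forall_and, forall_eq,
    isAlg_alg, and_self]

theorem isAlg_apoAx : ∀ r ∈ apoAx S, IsAlg r := by
  simp only [apoAx, Set.mem_union, Set.mem_insert_iff, Set.mem_singleton_iff, or_imp, forall_and,
    forall_eq, isAlg_alg, and_self, and_true]
  exact isAlg_acAx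

theorem isAlg_asoDirect (p : S.hasPos = true) : ∀ r ∈ asoDirect S p, IsAlg r := by
  simp only [asoDirect, Set.mem_insert_iff, Set.mem_singleton_iff, or_imp, forall_and, forall_eq,
    isAlg_alg, and_self]

theorem isAlg_supAx (s : S.hasSup = true) : ∀ r ∈ supAx S s, IsAlg r := by
  simp only [supAx, Set.mem_insert_iff, Set.mem_singleton_iff, or_imp, forall_and, forall_eq,
    isAlg_alg, and_self]

theorem isAlg_afrAx (s : S.hasSup = true) : ∀ r ∈ afrAx S s, IsAlg r := by
  simp only [afrAx, Set.mem_union, Set.mem_insert_iff, Set.mem_singleton_iff, or_imp, forall_and,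
    forall_eq, isAlg_alg, ruleGrl, ruleAfr, and_self, and_true]
  exact isAlg_acAx

theorem isAlg_frAx (s : S.hasSup = true) (f : S.hasFr = true) : ∀ r ∈ frAx S s f, IsAlg r := by
  simp only [frAx, Set.mem_insert_iff, Set.mem_singleton_iff, or_imp, forall_and, forall_eq,
    isAlg_alg, and_self]

theorem acAx_subset_apoAx : acAx S ⊆ apoAx S := Set.subset_union_left

theorem acAx_subset_afrAx (s : S.hasSup = true) : acAx S ⊆ afrAx S s := Set.subset_union_left

end IsAlg

namespace Theory

variable {T : Theory}

/-- All the rules of a set are valid in a theory. -/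
def ProvesAll (T : Theory) (X : Set (Rule T.sig ℕ)) : Prop := ∀ r ∈ X, T.Proves r

theorem ProvesAll.mono {X Y : Set (Rule T.sig ℕ)} (h : T.ProvesAll Y) (hXY : X ⊆ Y) :
    T.ProvesAll X := fun r hr => h r (hXY hr)

theorem provesAll_axioms : T.ProvesAll T.axioms := fun _ hr => proves_of_mem (Or.inl hr)

namespace AlgModel

variable {K : Type} [CommRing K] {M : Str K} (hM : T.AlgModel M)
include hM

theorem holds {r : Rule T.sig ℕ} (h : T.Proves r) (hr : IsAlg r) : M.Holds r := by
  obtain ⟨Γ, Δ, rfl⟩ := hr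
  exact hM.holds_alg Γ Δ h

theorem preord (h : T.ProvesAll (apoAx T.sig)) : M.Preord :=
  (M.forall_apoAx T.sig).1 fun r hr => hM.holds (h r hr) (isAlg_apoAx r hr)

theorem strict {p : T.sig.hasPos = true} (h : T.ProvesAll (asoDirect T.sig p)) : M.Strict :=
  (M.forall_asoDirect T.sig p).1 fun r hr => hM.holds (h r hr) (isAlg_asoDirect p r hr)

theorem isSup {s : T.sig.hasSup = true} (h : T.ProvesAll (supAx T.sig s)) : M.IsSup :=
  (M.forall_supAx T.sig s).1 fun r hr => hM.holds (h r hr) (isAlg_supAx s r hr)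

theorem fRing {s : T.sig.hasSup = true} (h : T.ProvesAll (afrAx T.sig s)) : M.FRing :=
  (M.forall_afrAx T.sig s).1 fun r hr => hM.holds (h r hr) (isAlg_afrAx s r hr)

theorem isFr {s : T.sig.hasSup = true} {f : T.sig.hasFr = true}
    (h : T.ProvesAll (frAx T.sig s f)) : M.IsFr :=
  (M.forall_frAx T.sig s f).1 fun r hr => hM.holds (h r hr) (isAlg_frAx s f r hr)

theorem gao (h : T.Proves (ruleGao T.sig)) : M.Gao :=
  (M.holds_ruleGao T.sig).1 (hM.holds h (isAlg_alg _ _))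

theorem anz (h : T.Proves (ruleAnz T.sig)) : M.Anz :=
  (M.holds_ruleAnz T.sig).1 (hM.holds h (isAlg_alg _ _))

theorem aonz (h : T.Proves (ruleAonz T.sig)) : M.Aonz :=
  (M.holds_ruleAonz T.sig).1 (hM.holds h (isAlg_alg _ _))

variable {p : T.sig.hasPos = true}

theorem col (h : T.Proves (ruleCol T.sig p)) : M.Col :=
  (M.holds_ruleCol T.sig p).1 (hM.holds h (isAlg_alg _ _))

theorem lv (h : T.Proves (ruleLv T.sig p)) : M.Lv :=
  (M.holds_ruleLv T.sig p).1 (hM.holds h (isAlg_alg _ _))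

theorem aso1 (h : T.Proves (ruleAso1 T.sig p)) : M.Aso1 :=
  (M.holds_ruleAso1 T.sig p).1 (hM.holds h (isAlg_alg _ _))

theorem aso2 (h : T.Proves (ruleAso2 T.sig p)) : M.Aso2 :=
  (M.holds_ruleAso2 T.sig p).1 (hM.holds h (isAlg_alg _ _))

theorem afr {s : T.sig.hasSup = true} (h : T.Proves (ruleAfr T.sig s)) : M.Afr :=
  (M.holds_ruleAfr T.sig s).1 (hM.holds h (isAlg_alg _ _))

end AlgModel

end Theory

namespace Str

variable {K : Type} [CommRing K] {M : Str K}

/-- The models of the algebraic rules for reduced strictly ordered rings, with **lv**. -/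
structure StrictReduced (M : Str K) : Prop where
  preord : M.Preord
  gao : M.Gao
  strict : M.Strict
  col : M.Col
  lv : M.Lv
  anz : M.Anz
  aonz : M.Aonz
  aso1 : M.Aso1
  aso2 : M.Aso2

theorem Aonz.anz (hA : M.Aonz) (hP : M.Preord) (hG : M.Gao) : M.Anz := by
  have key : ∀ {a : K}, a * a = 0 → M.nonneg a := fun {a} h => hA (c := 0) hP.zero (by
    have : a * (a * a + 0) = 0 := by rw [h]; ring
    rw [this]
    exact hP.zero)
  exact fun {a} h => hG (key h) (key (by rw [neg_mul_neg, h]))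

/-- Multiplying by `-a ≥ 0` gives `-a⁴ - c a² ≥ 0`, so `a⁴ = 0` and `a = 0`. This is the nontrivial
branch of **OT** when deriving **Aonz**. -/
theorem Preord.aonz_of_nonpos (hP : M.Preord) (hG : M.Gao) (hA : M.Anz) {c a : K}
    (hc : M.nonneg c) (h : M.nonneg (a * (a * a + c))) (ha : M.nonneg (-a)) : M.nonneg a := by
  have h1 : M.nonneg (-(a * a * (a * a)) - c * (a * a)) := by
    convert hP.mul ha h using 1
    ring
  have h2 : a * a * (a * a) = 0 := by
    refine hG (hP.sq _) ?_
    convert hP.add h1 (hP.mul hc (hP.sq a)) using 1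
    ring
  rw [hA (hA h2)]
  exact hP.zero

theorem eq_zero_of_col (hC : M.Col) (h : M.pos 0) (a : K) : a = 0 := by
  rw [← mul_one a, hC h, mul_zero]

theorem Preord.nonneg_of_mul_eq_one (hP : M.Preord) {a b : K} (ha : M.nonneg a)
    (h : a * b = 1) : M.nonneg b := by
  convert hP.mul (hP.sq b) ha using 1
  linear_combination -b * h

end Str

/-! ### Derived rules -/

namespace Theory

variable {T : Theory}

theorem proves_aonz_of_OT (h : T.ProvesAll (apoAx T.sig)) (hG : T.Proves (ruleGao T.sig))
    (hA : T.Proves (ruleAnz T.sig)) (hOT : T.Proves (ruleOT T.sig)) :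
    T.Proves (ruleAonz T.sig) := by
  refine derives_of_OT (h.mono acAx_subset_apoAx) hOT x fun K _ M hM v hv hor => ?_
  simp only [ruleAonz, alg, List.forall_mem_cons, sat_nonneg, Term.eval_mul, Term.eval_add,
    Term.eval_x, Term.eval_y] at hv hor ⊢
  refine ⟨hor.elim id ?_, by simp⟩
  exact (hM.preord h).aonz_of_nonpos (hM.gao hG) (hM.anz hA) hv.1 hv.2.1

section Cod

variable {p : T.sig.hasPos = true}

theorem proves_col_of_IV (hT : T.ProvesAll (acAx T.sig)) (hIV : T.Proves (ruleIV T.sig p)) :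
    T.Proves (ruleCol T.sig p) := by
  refine derives_of_IV hT hIV 0 (derives_plain_of_mem (fun _ h => h)) fun K _ M hM v _ u hu => ?_
  simpa using hu.symm

/-- If `u` inverts `x`, then `u = u² x` is nonnegative and `y = u (x y)`. -/
theorem proves_aso1_of_IV (h : T.ProvesAll (apoAx T.sig)) (hs : T.Proves (alg [pos p x] [nonneg x]))
    (hIV : T.Proves (ruleIV T.sig p)) : T.Proves (ruleAso1 T.sig p) := by
  refine derives_of_IV (h.mono acAx_subset_apoAx) hIV x
    (derives_plain_of_mem (by simp [ruleAso1, alg])) fun K _ M hM v hv u hu => ?_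
  have hP := hM.preord h
  simp only [ruleAso1, alg, List.forall_mem_cons, sat_nonneg, sat_pos, Term.eval_mul, Term.eval_x,
    Term.eval_y] at hv hu ⊢
  have hx : M.nonneg (v 0) := by
    simpa using (M.holds_alg _ _).1 (hM.holds hs (isAlg_alg _ _)) v (by simpa using hv.1)
  refine ⟨?_, by simp⟩
  convert hP.mul (hP.nonneg_of_mul_eq_one hx hu) hv.2.1 using 1
  linear_combination -v 1 * hu

variable (h : T.ProvesAll (codAx T.sig p))
include h

/-- In the second case of **ED**, `x² = 0` would be positive and the ring would collapse. -/
theorem proves_anz_of_cod : T.Proves (ruleAnz T.sig) := by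
  have hT : T.ProvesAll (acAx T.sig) := h.mono fun r hr => Or.inl (Or.inl (Or.inl hr))
  refine derives_of_ED hT (p := p) (h _ (by simp [codAx])) x fun K _ M hM v hv hor => ?_
  have hC : M.Col := hM.col (p := p) (h _ (by simp [codAx]))
  simp only [ruleAnz, alg, List.forall_mem_singleton, sat_eqZero, Term.eval_mul,
    Term.eval_x] at hv hor ⊢
  refine hor.elim id fun h1 => ?_
  rw [hv] at h1
  exact Str.eq_zero_of_col hC h1 _

/-- Compare `x` with `1`: either `x = x² + x (1 - x)` or `x = 1 + (x - 1)` has the form positive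
plus nonnegative. -/
theorem proves_pos_of_pos_sq : T.Proves (alg [nonneg x, pos p (x * x)] [pos p x]) := by
  have hP : T.ProvesAll (apoAx T.sig) := h.mono fun r hr => Or.inl (Or.inl hr)
  have hS : T.ProvesAll (asoDirect T.sig p) := h.mono fun r hr => Or.inl (Or.inr hr)
  refine derives_of_OT (hP.mono acAx_subset_apoAx) (h _ (by simp [codAx])) (1 - x)
    fun K _ M hM v hv hor => ?_
  have hP := hM.preord hP
  have hS := hM.strict hS
  simp only [alg, List.forall_mem_cons, sat_nonneg, sat_pos, Term.eval_mul,
    Term.eval_sub, Term.eval_one, Term.eval_x] at hv hor ⊢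
  refine ⟨?_, by simp⟩
  rcases hor with h1 | h1
  · convert hS.add hv.2.1 (hP.mul hv.1 h1) using 1
    ring
  · convert hS.add hS.one h1 using 1
    ring

/-- An inverse of `x * y` makes `y` invertible, and **lv** applies. -/
theorem proves_pos_sq_of_pos_mul : T.Proves (alg [pos p (x * y)] [pos p (y * y)]) := by
  have hT : T.ProvesAll (acAx T.sig) := h.mono fun r hr => Or.inl (Or.inl (Or.inl hr))
  refine derives_of_IV hT (p := p) (h _ (by simp [codAx])) (x * y)
    (derives_plain_of_mem (by simp [alg])) fun K _ M hM v hv u hu => ?_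
  have hlv : M.Lv := hM.lv (p := p) (h _ (by simp [codAx]))
  simp only [List.forall_mem_singleton, sat_pos, Term.eval_mul, Term.eval_x,
    Term.eval_y] at hu ⊢
  exact hlv (b := v 0 * u) (by linear_combination hu)

/-- Since `y² > 0`, the case `y ≥ 0` is already settled. In the case `y ≤ 0`, adding `x (-y) ≥ 0` to
`x y > 0` gives `0 > 0`. -/
theorem proves_aso2_of_cod : T.Proves (ruleAso2 T.sig p) := by
  have hP : T.ProvesAll (apoAx T.sig) := h.mono fun r hr => Or.inl (Or.inl hr)
  have hS : T.ProvesAll (asoDirect T.sig p) := h.mono fun r hr => Or.inl (Or.inr hr)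
  refine derives_of_OT (hP.mono acAx_subset_apoAx) (h _ (by simp [codAx])) y
    fun K _ M hM v hv hor => ?_
  have hP := hM.preord hP
  have hS := hM.strict hS
  have hC : M.Col := hM.col (p := p) (h _ (by simp [codAx]))
  simp only [ruleAso2, alg, List.forall_mem_cons, sat_nonneg, sat_pos, Term.eval_mul,
    Term.eval_x, Term.eval_y] at hv hor ⊢
  refine ⟨?_, by simp⟩
  obtain ⟨hx, hxy, -⟩ := hv
  have hsq : M.pos (v 1 * v 1) := by
    have := (M.holds_alg _ _).1 (hM.holds (proves_pos_sq_of_pos_mul h) (isAlg_alg _ _)) v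
    simpa [hxy] using this
  rcases hor with h1 | h1
  · have := (M.holds_alg _ _).1 (hM.holds (proves_pos_of_pos_sq h) (isAlg_alg _ _))
      (val (v 1) 0 0 0)
    simpa [hsq, h1] using this
  · have h0 : M.pos 0 := by
      convert hS.add hxy (hP.mul hx h1) using 1
      ring
    rw [Str.eq_zero_of_col hC h0 (v 1)]
    exact h0

theorem AlgModel.strictReduced_of_cod {K : Type} [CommRing K] {M : Str K} (hM : T.AlgModel M) :
    M.StrictReduced := by
  have hP : T.ProvesAll (apoAx T.sig) := h.mono fun r hr => Or.inl (Or.inl hr)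
  have hS : T.ProvesAll (asoDirect T.sig p) := h.mono fun r hr => Or.inl (Or.inr hr)
  have hG : T.Proves (ruleGao T.sig) := h _ (by simp [codAx])
  have hA := proves_anz_of_cod h
  exact ⟨hM.preord hP, hM.gao hG, hM.strict hS, hM.col (p := p) (h _ (by simp [codAx])),
    hM.lv (p := p) (h _ (by simp [codAx])), hM.anz hA,
    hM.aonz (proves_aonz_of_OT hP hG hA (h _ (by simp [codAx]))),
    hM.aso1 (p := p) (proves_aso1_of_IV hP (hS _ (by simp [asoDirect])) (h _ (by simp [codAx]))),
    hM.aso2 (proves_aso2_of_cod h)⟩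

/-- Once `y` and `z` are compared, both suprema are one of their arguments, on the same side. -/
theorem proves_afr_of_cod {s : T.sig.hasSup = true} (hs : T.ProvesAll (supAx T.sig s)) :
    T.Proves (ruleAfr T.sig s) := by
  have hP : T.ProvesAll (apoAx T.sig) := h.mono fun r hr => Or.inl (Or.inl hr)
  refine derives_of_OT (hP.mono acAx_subset_apoAx) (h _ (by simp [codAx])) (y - z)
    fun K _ M hM v hv hor => ?_
  have hP := hM.preord hP
  have hS := hM.isSup hs
  have hG : M.Gao := hM.gao (h _ (by simp [codAx]))
  have h0 := hS.right (v 0) 0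
  rw [sub_zero] at h0
  simp only [List.forall_mem_singleton, sat_eq, Term.eval_mul, Term.eval_sub, Term.eval_sup,
    Term.eval_pos, Term.eval_x, Term.eval_y, Term.eval_z] at hor ⊢
  have hl : ∀ a b : K, M.nonneg (a - b) → M.sup a b = a := fun a b hab =>
    (Str.Gao.sub hG (hS.left a b) (hS.le (by simpa using hP.zero) hab)).symm ▸ rfl
  have hr : ∀ a b : K, M.nonneg (b - a) → M.sup a b = b := fun a b hab =>
    Str.Gao.sub hG (hS.right a b) (hS.le hab (by simpa using hP.zero))
  rcases hor with h1 | h1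
  · rw [hl (v 1) (v 2) h1, hl (M.sup (v 0) 0 * v 1) (M.sup (v 0) 0 * v 2)
      (by rw [← mul_sub]; exact hP.mul h0 h1)]
  · rw [neg_sub] at h1
    rw [hr (v 1) (v 2) h1, hr (M.sup (v 0) 0 * v 1) (M.sup (v 0) 0 * v 2)
      (by rw [← mul_sub]; exact hP.mul h0 h1)]

theorem AlgModel.fRing_of_cod {s : T.sig.hasSup = true} (hs : T.ProvesAll (supAx T.sig s))
    {K : Type} [CommRing K] {M : Str K} (hM : T.AlgModel M) : M.FRing :=
  have hR := hM.strictReduced_of_cod h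
  (hM.isSup hs).fRing hR.gao hR.preord (hM.afr (proves_afr_of_cod h hs))

end Cod

section Co0

variable {p : T.sig.hasPos = true} {s : T.sig.hasSup = true} (h : T.ProvesAll (co0Ax T.sig s p))
include h

theorem AlgModel.strictReduced_of_co0 {K : Type} [CommRing K] {M : Str K} (hM : T.AlgModel M) :
    M.StrictReduced := by
  have hP : T.ProvesAll (apoAx T.sig) := h.mono fun r hr => Or.inl (Or.inl (Or.inl hr))
  have hS : T.ProvesAll (asoDirect T.sig p) := h.mono fun r hr => Or.inl (Or.inl (Or.inr hr))
  exact ⟨hM.preord hP, hM.gao (h _ (by simp [co0Ax])), hM.strict hS,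
    hM.col (proves_col_of_IV (p := p) (hP.mono acAx_subset_apoAx) (h _ (by simp [co0Ax]))),
    hM.lv (p := p) (h _ (by simp [co0Ax])), hM.anz (h _ (by simp [co0Ax])),
    hM.aonz (h _ (by simp [co0Ax])), hM.aso1 (p := p) (h _ (by simp [co0Ax])),
    hM.aso2 (p := p) (h _ (by simp [co0Ax]))⟩

theorem AlgModel.fRing_of_co0 {K : Type} [CommRing K] {M : Str K} (hM : T.AlgModel M) :
    M.FRing :=
  have hR := hM.strictReduced_of_co0 h
  (hM.isSup (h.mono fun _ hr => Or.inl (Or.inr hr))).fRing hR.gao hR.preord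
    (hM.afr (s := s) (h _ (by simp [co0Ax])))

end Co0

end Theory

end DynAlg

namespace DynAlg

open Atom Rule Theory

namespace Str

variable {K : Type} [CommRing K] {M : Str K}

theorem FRing.sup_eq_left (hF : M.FRing) {a b : K} (h : M.nonneg (a - b)) : M.sup a b = a :=
  (hF.le_iff b a).1 h

theorem FRing.abs_eq (hF : M.FRing) {a : K} (h : M.nonneg a) : M.sup a (-a) = a :=
  hF.sup_eq_left (by simpa using hF.add_nonneg h h)

/-- Here the infimum of the absolute values of `a` and `a + b` is `a`. The identity exhibits `a²` as
a multiple of `a + b`. -/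
theorem FRing.fr_add_mul (hF : M.FRing) (hI : M.IsFr) {a b : K} (ha : M.nonneg a)
    (hb : M.nonneg b) : M.fr a (a + b) * (a + b) = a * a := by
  have h := hI.mul a (a + b)
  rw [infAbs, hF.abs_eq ha, hF.abs_eq (hF.add_nonneg ha hb),
    hF.sup_eq_left (a := -a) (by simpa using hb), neg_neg] at h
  exact h

end Str

namespace Theory

variable {T : Theory}

/-! ### Strongly real rings -/

theorem Proves.ex_mono (hT : T.ProvesAll (acAx T.sig)) {Γ : List (Atom T.sig ℕ)}
    {Δ Δ' : (Term T.sig ℕ → Term T.sig (ℕ ⊕ Fin 1)) → Term T.sig (ℕ ⊕ Fin 1) →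
      List (Atom T.sig (ℕ ⊕ Fin 1))} (h : T.Proves (ex Γ Δ))
    (hΔ : ∀ (K : Type) [CommRing K] (M : Str K) (v : ℕ ⊕ Fin 1 → K),
      (∀ A ∈ Δ (Term.subst lift) (Term.var (Sum.inr 0)), A.Sat M v) →
      ∀ A ∈ Δ' (Term.subst lift) (Term.var (Sum.inr 0)), A.Sat M v) : T.Proves (ex Γ Δ') := by
  refine Derives.cut h fun B hB => ?_
  obtain rfl := List.mem_singleton.1 hB
  refine Derives.cut_plain (Δ := Δ' (Term.subst lift) (Term.var (Sum.inr 0)))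
    (derives_of_models hT fun K _ M _ v hv => ?_) ?_
  · exact hΔ K M v (List.forall_mem_append.1 hv).2
  · refine .leaf _ (List.mem_map_of_mem (List.mem_singleton.2 rfl))
      (fun i => Term.var (Sum.inr i)) fun A hA => ?_
    obtain ⟨A, hA₀, rfl⟩ := List.mem_map.1 hA
    refine List.mem_append_right _ ?_
    convert hA₀ using 1
    rw [Atom.subst_subst]
    convert Atom.subst_var A using 2
    funext i
    cases i <;> rfl

theorem proves_of_models (hT : T.ProvesAll (acAx T.sig)) {r : Rule T.sig ℕ} (hr : IsAlg r)
    (h : ∀ (K : Type) [CommRing K] (M : Str K), T.AlgModel M → M.Holds r) : T.Proves r := by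
  obtain ⟨Γ, Δ, rfl⟩ := hr
  exact derives_of_models hT fun K _ M hM => (M.holds_alg _ _).1 (h K M hM)

section Aftr

variable {p : T.sig.hasPos = true} {s : T.sig.hasSup = true} {f : T.sig.hasFr = true}
  (h : T.ProvesAll (aftrAx T.sig s p f))
include h

theorem provesAll_afrAx_of_aftr : T.ProvesAll (afrAx T.sig s) :=
  h.mono fun _ hr => Or.inl (Or.inl (Or.inl hr))

theorem provesAll_acAx_of_aftr : T.ProvesAll (acAx T.sig) :=
  (provesAll_afrAx_of_aftr h).mono (acAx_subset_afrAx s)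

theorem proves_IV_of_aftr : T.Proves (ruleIV T.sig p) := by
  refine Proves.ex_mono (provesAll_acAx_of_aftr h)
    (h _ (Or.inl (Or.inr (Or.inr (Or.inl rfl))))) fun K _ M v hv => ?_
  simpa [mul_comm] using hv

section Model

variable {K : Type} [CommRing K] {M : Str K} (hM : T.AlgModel M)
include hM

theorem AlgModel.fRing_of_aftr : M.FRing := hM.fRing (provesAll_afrAx_of_aftr h)

theorem AlgModel.isFr_of_aftr : M.IsFr :=
  hM.isFr (s := s) (f := f) (h.mono fun _ hr => Or.inr hr)

theorem AlgModel.nonneg_of_pos_of_aftr {a : K} (ha : M.pos a) : M.nonneg a := by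
  have := (M.holds_alg _ _).1 (hM.holds (h (alg [pos p x] [nonneg x])
    (Or.inl (Or.inr (Or.inl rfl)))) (isAlg_alg _ _)) (val a a a a)
  simpa [ha] using this

theorem AlgModel.pos_of_aftr {a b : K} (ha : M.nonneg a) (hb : b * a = 1) : M.pos a := by
  have := (M.holds_alg _ _).1 (hM.holds (h (alg [nonneg x, eq (z * x) 1] [pos p x])
    (Or.inl (Or.inr (Or.inr (Or.inr rfl))))) (isAlg_alg _ _)) (val a a b a)
  simpa [ha, hb] using this

end Model

/-- Positivity means nonnegative and invertible here, and `Fr` supplies the inverse of the sum: if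
`u` inverts `x`, it is `u² Fr(x, x + y)`. -/
theorem proves_pos_add_of_aftr : T.Proves (alg [pos p x, nonneg y] [pos p (x + y)]) := by
  refine derives_of_IV (provesAll_acAx_of_aftr h) (proves_IV_of_aftr h) x
    (derives_plain_of_mem (by simp [alg])) fun K _ M hM v hv u hu => ?_
  simp only [alg, List.forall_mem_cons, sat_nonneg, sat_pos,
    Term.eval_add, Term.eval_x, Term.eval_y] at hv hu ⊢
  obtain ⟨hx, hy, -⟩ := hv
  have hF := hM.fRing_of_aftr h
  have hx := hM.nonneg_of_pos_of_aftr h hx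
  have h1 := hF.fr_add_mul (hM.isFr_of_aftr h) hx hy
  refine ⟨hM.pos_of_aftr h (b := u * u * M.fr (v 0) (v 0 + v 1)) (hF.add_nonneg hx hy) ?_, by simp⟩
  linear_combination u * u * h1 + (v 0 * u + 1) * hu

/-- Two inverses are needed for a product, but each appeal to `derives_of_IV` provides one. The
inverse of `y` is therefore a hypothesis here and is discharged in `proves_pos_mul_of_aftr`. -/
theorem proves_pos_mul_of_inverse_of_aftr :
    T.Proves (alg [pos p x, nonneg y, eq (y * z) 1] [pos p (x * y)]) := by
  refine derives_of_IV (provesAll_acAx_of_aftr h) (proves_IV_of_aftr h) x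
    (derives_plain_of_mem (by simp [alg])) fun K _ M hM v hv u hu => ?_
  simp only [alg, List.forall_mem_cons, sat_nonneg, sat_pos, sat_eq,
    Term.eval_mul, Term.eval_one, Term.eval_x, Term.eval_y, Term.eval_z] at hv hu ⊢
  obtain ⟨hx, hy, hz, -⟩ := hv
  have hx := hM.nonneg_of_pos_of_aftr h hx
  refine ⟨hM.pos_of_aftr h (b := u * v 2) ((hM.fRing_of_aftr h).mul_nonneg hx hy) ?_, by simp⟩
  linear_combination v 0 * u * hz + hu

theorem proves_pos_mul_of_aftr : T.Proves (alg [pos p x, pos p y] [pos p (x * y)]) := by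
  refine derives_of_IV (provesAll_acAx_of_aftr h) (proves_IV_of_aftr h) y
    (derives_plain_of_mem (by simp [alg])) fun K _ M hM v hv u hu => ?_
  have h1 := (M.holds_alg _ _).1 (hM.holds (proves_pos_mul_of_inverse_of_aftr h) (isAlg_alg _ _))
    (val (v 0) (v 1) u 0)
  simp only [alg, List.forall_mem_cons, sat_nonneg, sat_pos, sat_eq,
    Term.eval_mul, Term.eval_one, Term.eval_x, Term.eval_y, Term.eval_z, val_zero, val_one,
    val_two] at hv hu h1 ⊢
  exact ⟨(h1 ⟨hv.1, hM.nonneg_of_pos_of_aftr h hv.2.1, hu, by simp⟩).1, by simp⟩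

/-- If `u` inverts `x y`, then `u ≥ 0`, so `y = y² (x u)` is nonnegative, and `x u` inverts `y`. -/
theorem proves_aso2_of_aftr : T.Proves (ruleAso2 T.sig p) := by
  refine derives_of_IV (provesAll_acAx_of_aftr h) (proves_IV_of_aftr h) (x * y)
    (derives_plain_of_mem (by simp [ruleAso2, alg])) fun K _ M hM v hv u hu => ?_
  simp only [ruleAso2, alg, List.forall_mem_cons, sat_nonneg, sat_pos,
    Term.eval_mul, Term.eval_x, Term.eval_y] at hv hu ⊢
  obtain ⟨hx, hxy, -⟩ := hv
  have hP := (hM.fRing_of_aftr h).preord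
  have hu0 := hP.nonneg_of_mul_eq_one (hM.nonneg_of_pos_of_aftr h hxy) hu
  have hy : M.nonneg (v 1) := by
    convert hP.mul (hP.sq (v 1)) (hP.mul hx hu0) using 1
    linear_combination -v 1 * hu
  exact ⟨hM.pos_of_aftr h (b := v 0 * u) hy (by linear_combination hu), by simp⟩

theorem AlgModel.strictReduced_of_aftr {K : Type} [CommRing K] {M : Str K} (hM : T.AlgModel M) :
    M.StrictReduced := by
  have hF := hM.fRing_of_aftr h
  have hP := hF.preord
  have hA : M.Anz := hM.anz (h _ (Or.inl (Or.inl (Or.inr rfl))))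
  refine ⟨hP, hF.gao, ⟨?_, hM.nonneg_of_pos_of_aftr h, ?_, ?_⟩, ?_, ?_, hA, hF.aonz hA, ?_,
    hM.aso2 (proves_aso2_of_aftr h)⟩
  · exact hM.pos_of_aftr h hF.one_nonneg (mul_one 1)
  · intro a b ha hb
    have := (M.holds_alg _ _).1 (hM.holds (proves_pos_add_of_aftr h) (isAlg_alg _ _))
      (val a b 0 0)
    simpa [ha, hb] using this
  · intro a b ha hb
    have := (M.holds_alg _ _).1 (hM.holds (proves_pos_mul_of_aftr h) (isAlg_alg _ _))
      (val a b 0 0)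
    simpa [ha, hb] using this
  · exact hM.col (proves_col_of_IV (provesAll_acAx_of_aftr h) (proves_IV_of_aftr h))
  · exact fun {a b} hab => hM.pos_of_aftr h (b := b * b) (hP.sq a)
      (by linear_combination (a * b + 1) * hab)
  · refine hM.aso1 (proves_aso1_of_IV (fun r hr => proves_of_models (provesAll_acAx_of_aftr h)
      (isAlg_apoAx r hr) fun K _ M hM => ?_) (h _ (Or.inl (Or.inr (Or.inl rfl))))
      (proves_IV_of_aftr h))
    exact (M.forall_apoAx T.sig).2 (hM.fRing_of_aftr h).preord r hr

end Aftr

end Theory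

end DynAlg

namespace DynAlg

open Atom Rule Theory

/-! ### Reduced structures -/

namespace Str

variable {K : Type} [CommRing K] {M : Str K} {S : Sig}

/-- Reading `pos` as equality with `1` makes the unconditional requirements on it trivial, so
signatures without `· > 0` need no separate completeness argument. -/
theorem reduced_of_pos_iff (hP : M.Preord) (hG : M.Gao) (hA : M.Aonz) (hp : ∀ a, M.pos a ↔ a = 1)
    (hS : ¬ S.hasPos = true) (hF : S.hasSup = true → M.FRing)
    (hI : S.hasFr = true → M.FRing ∧ M.IsFr) : M.Reduced S where
  preord := hP
  gao := hG
  aonz := hA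
  aso1 := fun {a b} ha hab => by rwa [(hp a).1 ha, one_mul] at hab
  pos_one := (hp 1).2 rfl
  pos_nonneg := fun {a} ha => by
    rw [(hp a).1 ha, ← mul_one 1]
    exact hP.sq 1
  pos_mul := fun {a b} ha hb => (hp _).2 (by rw [(hp a).1 ha, (hp b).1 hb, mul_one])
  strict h := absurd h hS
  fRing := hF
  isFr := hI

theorem StrictReduced.reduced (h : M.StrictReduced) (hF : S.hasSup = true → M.FRing)
    (hI : S.hasFr = true → M.FRing ∧ M.IsFr) : M.Reduced S where
  preord := h.preord
  gao := h.gao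
  aonz := h.aonz
  aso1 := h.aso1
  pos_one := h.strict.one
  pos_nonneg := h.strict.nonneg
  pos_mul := h.strict.mul
  strict _ := ⟨h.strict, h.aso2⟩
  fRing := hF
  isFr := hI

theorem StrictReduced.holds_asoAx (h : M.StrictReduced) (S : Sig) (p : S.hasPos = true) :
    ∀ r ∈ asoAx S p ∪ {ruleAonz S}, M.Holds r := by
  simp only [asoAx, Set.mem_union, Set.mem_insert_iff, Set.mem_singleton_iff, or_imp,
    forall_and, forall_eq, forall_apoAx, forall_asoDirect, holds_ruleCol, holds_ruleGao,
    holds_ruleAso1, holds_ruleAso2, holds_ruleAonz]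
  exact ⟨⟨⟨h.preord, h.strict⟩, h.col, h.gao, h.aso1, h.aso2⟩, h.aonz⟩

theorem FRing.holds_afrnzAx (hF : M.FRing) (hA : M.Anz) (S : Sig) (s : S.hasSup = true) :
    ∀ r ∈ afrnzAx S s, M.Holds r := by
  simp only [afrnzAx, Set.mem_union, Set.mem_singleton_iff, or_imp, forall_and, forall_eq,
    forall_afrAx, holds_ruleAnz]
  exact ⟨hF, hA⟩

theorem StrictReduced.holds_asrAx (h : M.StrictReduced) (hF : M.FRing) (S : Sig)
    (p : S.hasPos = true) (s : S.hasSup = true) :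
    ∀ r ∈ asrAx S s p ∪ {ruleAnz S}, M.Holds r := by
  simp only [asrAx, Set.mem_union, Set.mem_insert_iff, Set.mem_singleton_iff, or_imp,
    forall_and, forall_eq, forall_afrAx, forall_asoDirect, holds_ruleCol, holds_ruleLv,
    holds_ruleAso1, holds_ruleAso2, forall_supAx, holds_ruleAnz]
  exact ⟨⟨⟨⟨hF, h.strict⟩, h.col, h.lv, h.aso1, h.aso2⟩, hF.isSup⟩, h.anz⟩

theorem StrictReduced.holds_pos (h : M.StrictReduced) (S : Sig) (p : S.hasPos = true) :
    ∀ r ∈ ({alg [.pos p x] [.nonneg x],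
      alg [.nonneg x, eq (z * x) 1] [.pos p x]} : Set (Rule S ℕ)),
      M.Holds r := by
  rintro r (rfl | rfl)
  · rw [Str.holds_alg]
    intro v
    simpa using h.strict.nonneg
  · rw [Str.holds_alg]
    intro v hv
    simp only [List.forall_mem_cons, sat_nonneg, sat_eq, Term.eval_mul, Term.eval_x,
      Term.eval_z, Term.eval_one] at hv
    have h1 : M.pos (v 0 * v 0) := h.lv (b := v 2) (by linear_combination hv.2.1)
    simpa using h.aso2 hv.1 h1

end Str

theorem isAlg_afrnzAx {S : Sig} (s : S.hasSup = true) : ∀ r ∈ afrnzAx S s, IsAlg r := by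
  rintro r (hr | rfl)
  · exact isAlg_afrAx s r hr
  · exact isAlg_alg _ _

namespace Theory

variable {T : Theory}

/-! ### Extensions of theories -/

theorem map_alg {S S' : Sig} (h : S ≤ S') (Γ Δ : List (Atom S ℕ)) :
    (alg Γ Δ).map h = alg (Γ.map (Atom.map h)) (Δ.map (Atom.map h)) := by
  simp [alg, Rule.map, plain, Branch.map, Function.comp_def, Atom.map_subst, Term.map]

theorem _root_.DynAlg.IsAlg.map {S S' : Sig} (h : S ≤ S') {r : Rule S ℕ} (hr : IsAlg r) :
    IsAlg (r.map h) := by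
  obtain ⟨Γ, Δ, rfl⟩ := hr
  exact ⟨_, _, map_alg h Γ Δ⟩

/-- Reduces an extension of theories with algebraic axioms to checking those axioms in the models
for the larger theory. -/
theorem proves_map_of_models {S : Sig} (h : S ≤ T.sig) (hT : T.ProvesAll (acAx T.sig))
    {X : Set (Rule S ℕ)} (hX : ∀ r ∈ X, IsAlg r)
    (hM : ∀ (K : Type) [CommRing K] (M : Str K), T.AlgModel M → ∀ r ∈ X, M.Holds r) :
    ∀ r ∈ X, T.Proves (r.map h) := fun r hr =>
  proves_of_models hT ((hX r hr).map h) fun K _ M hMT => (M.holds_map h r).2 (hM K M hMT r hr)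

theorem Aonz_le (hT : T.ProvesAll (acAx T.sig))
    (hM : ∀ (K : Type) [CommRing K] (M : Str K), T.AlgModel M → M.Preord ∧ M.Gao ∧ M.Aonz) :
    Aonz ≤ T := by
  refine ⟨⟨nofun, nofun, nofun⟩, proves_map_of_models (S := sigA) (X := aoAx sigA ∪ {ruleAonz sigA})
    _ hT ?_ fun K _ M hMT => ?_⟩
  · simp only [aoAx, Set.mem_union, Set.mem_singleton_iff, or_imp, forall_and, forall_eq]
    exact ⟨⟨isAlg_apoAx, isAlg_alg _ _⟩, isAlg_alg _ _⟩
  · simp only [aoAx, Set.mem_union, Set.mem_singleton_iff, or_imp, forall_and, forall_eq,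
      Str.forall_apoAx, Str.holds_ruleGao, Str.holds_ruleAonz, and_assoc]
    exact hM K M hMT

theorem Asonz_le (hp : T.sig.hasPos = true) (hT : T.ProvesAll (acAx T.sig))
    (hM : ∀ (K : Type) [CommRing K] (M : Str K), T.AlgModel M → M.StrictReduced) :
    Asonz ≤ T := by
  refine ⟨⟨fun _ => hp, nofun, nofun⟩, proves_map_of_models (S := sigAPos)
    (X := asoAx sigAPos rfl ∪ {ruleAonz sigAPos}) _ hT ?_
    fun K _ M hMT => (hM K M hMT).holds_asoAx sigAPos rfl⟩
  simp only [asoAx, Set.mem_union, Set.mem_insert_iff, Set.mem_singleton_iff, or_imp,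
    forall_and, forall_eq]
  exact ⟨⟨⟨isAlg_apoAx, isAlg_asoDirect _⟩, isAlg_alg _ _, isAlg_alg _ _, isAlg_alg _ _,
    isAlg_alg _ _⟩, isAlg_alg _ _⟩

theorem Afrnz_le (hs : T.sig.hasSup = true) (hT : T.ProvesAll (acAx T.sig))
    (hM : ∀ (K : Type) [CommRing K] (M : Str K), T.AlgModel M → M.FRing ∧ M.Anz) :
    Afrnz ≤ T :=
  ⟨⟨nofun, fun _ => hs, nofun⟩, proves_map_of_models (S := sigASup)
    (X := afrnzAx sigASup rfl) _ hT (isAlg_afrnzAx _)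
    fun K _ M hMT => (hM K M hMT).1.holds_afrnzAx (hM K M hMT).2 sigASup rfl⟩

theorem Asrnz_le (hp : T.sig.hasPos = true) (hs : T.sig.hasSup = true)
    (hT : T.ProvesAll (acAx T.sig))
    (hM : ∀ (K : Type) [CommRing K] (M : Str K), T.AlgModel M → M.StrictReduced ∧ M.FRing) :
    Asrnz ≤ T := by
  refine ⟨⟨fun _ => hp, fun _ => hs, nofun⟩, proves_map_of_models (S := sigAPosSup)
    (X := asrAx sigAPosSup rfl rfl ∪ {ruleAnz sigAPosSup}) _ hT ?_
    fun K _ M hMT => (hM K M hMT).1.holds_asrAx (hM K M hMT).2 sigAPosSup rfl rfl⟩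
  simp only [asrAx, Set.mem_union, Set.mem_insert_iff, Set.mem_singleton_iff, or_imp,
    forall_and, forall_eq]
  exact ⟨⟨⟨⟨isAlg_afrAx _, isAlg_asoDirect _⟩, isAlg_alg _ _, isAlg_alg _ _, isAlg_alg _ _,
    isAlg_alg _ _⟩, isAlg_supAx _⟩, isAlg_alg _ _⟩

theorem Aftr_le {T : Theory} (hp : T.sig.hasPos = true) (hs : T.sig.hasSup = true)
    (hf : T.sig.hasFr = true) (hT : T.ProvesAll (acAx T.sig))
    (hIV : T.Proves (ruleIV T.sig hp))
    (hM : ∀ (K : Type) [CommRing K] (M : Str K), T.AlgModel M →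
      M.StrictReduced ∧ M.FRing ∧ M.IsFr) : Aftr ≤ T := by
  let hS : sigAPosSupFr ≤ T.sig := ⟨fun _ => hp, fun _ => hs, fun _ => hf⟩
  have h1 := proves_map_of_models hS hT (isAlg_afrnzAx rfl)
    fun K _ M hMT => (hM K M hMT).2.1.holds_afrnzAx (hM K M hMT).1.anz _ _
  have h2 := proves_map_of_models hS hT (isAlg_frAx rfl rfl)
    fun K _ M hMT => (M.forall_frAx _ _ _).2 (hM K M hMT).2.2
  have h3 := proves_map_of_models hS hT
    (X := {alg [pos rfl x] [nonneg x], alg [nonneg x, eq (z * x) 1] [pos rfl x]})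
    (by
      rintro r (rfl | rfl)
      · exact isAlg_alg _ _
      · exact isAlg_alg _ _)
    fun K _ M hMT => (hM K M hMT).1.holds_pos sigAPosSupFr rfl
  refine ⟨hS, ?_⟩
  rintro r ((hr | rfl | rfl | rfl) | hr)
  · exact h1 r hr
  · exact h3 _ (Or.inl rfl)
  -- The one axiom with `∃`: it is **IV** with the factors exchanged.
  · exact Proves.ex_mono hT hIV (Γ := [pos hp x]) (Δ' := fun ι t => [eq (t * ι x) 1])
      fun K _ M v hv => by simpa [mul_comm] using hv
  · exact h3 _ (Or.inr rfl)
  · exact h2 r hr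

/-! ### Theories valid in real closed fields -/

/-- The axioms are valid in the ordered fields with the intermediate value property. -/
def Sound (T : Theory) : Prop :=
  ∀ (K : Type) [Field K] [LinearOrder K] [IsStrictOrderedRing K], PolyIVT K →
    ∀ r ∈ T.axioms, (Str.ofField K).Holds r

theorem Sound.holds (h : T.Sound) {r : Rule T.sig ℕ} (hr : T.Proves r) (K : Type) [Field K]
    [LinearOrder K] [IsStrictOrderedRing K] (hK : PolyIVT K) : (Str.ofField K).Holds r :=
  Str.sound (h K hK) hr

theorem Sound.of_le {T' : Theory} (h : T'.Sound) (hT : T ≤ T') : T.Sound := by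
  obtain ⟨hS, hT⟩ := hT
  intro K _ _ _ hK r hr
  exact ((Str.ofField K).holds_map hS r).1 (h.holds (hT r hr) K hK)

theorem Crcdsup_sound : Crcdsup.Sound := by
  rintro K _ _ _ hK r (hr | hr)
  · exact Str.ofField_crcdAx K _ _ hK r hr
  · exact Str.ofField_supAx K _ _ r hr

theorem CrcdsupFr_sound : CrcdsupFr.Sound := by
  rintro K _ _ _ hK r ((hr | hr) | hr)
  · exact Str.ofField_crcdAx K _ _ hK r hr
  · exact Str.ofField_supAx K _ _ r hr
  · exact Str.ofField_frAx K _ _ _ r hr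

theorem Cod_sound : Cod.Sound := fun K _ _ _ _ => Str.ofField_codAx K _ _

theorem Codsup_sound : Codsup.Sound := by
  rintro K _ _ _ hK r (hr | hr)
  · exact Str.ofField_codAx K _ _ r hr
  · exact Str.ofField_supAx K _ _ r hr

theorem CodsupFr_sound : CodsupFr.Sound := by
  rintro K _ _ _ hK r ((hr | hr) | hr)
  · exact Str.ofField_codAx K _ _ r hr
  · exact Str.ofField_supAx K _ _ r hr
  · exact Str.ofField_frAx K _ _ _ r hr

theorem Co0_sound : Co0.Sound := fun K _ _ _ _ => Str.ofField_co0Ax K _ _ _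

theorem Co_sound : Co.Sound := by
  rintro K _ _ _ hK r (hr | hr)
  · exact Str.ofField_co0Ax K _ _ _ r hr
  · exact Str.ofField_frAx K _ _ _ r hr

theorem Aftr_sound : Aftr.Sound := fun K _ _ _ _ => Str.ofField_aftrAx K _ _ _ _

theorem Atonz_sound : Atonz.Sound := by
  rintro K _ _ _ hK r ((hr | rfl) | rfl | rfl)
  · exact ((Str.ofField K).forall_apoAx _).2 (Str.ofField_preord K) r hr
  · exact ((Str.ofField K).holds_ruleGao _).2 (Str.ofField_gao K)
  · exact Str.ofField_OT K _
  · exact ((Str.ofField K).holds_ruleAnz _).2 (Str.ofField_anz K)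

/-! ### Models of the theories -/

section Models

variable {K : Type} [CommRing K] {M : Str K}

theorem Aonz_acAx : Aonz.ProvesAll (acAx Aonz.sig) :=
  provesAll_axioms.mono fun _ hr => Or.inl (Or.inl (Or.inl hr))

theorem Aonz_models (hM : Aonz.AlgModel M) : M.Preord ∧ M.Gao ∧ M.Aonz :=
  ⟨hM.preord (provesAll_axioms.mono fun _ hr => Or.inl (Or.inl hr)),
    hM.gao (provesAll_axioms _ (Or.inl (Or.inr rfl))), hM.aonz (provesAll_axioms _ (Or.inr rfl))⟩

theorem Atonz_apoAx : Atonz.ProvesAll (apoAx Atonz.sig) :=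
  provesAll_axioms.mono fun _ hr => Or.inl (Or.inl hr)

theorem Atonz_models (hM : Atonz.AlgModel M) : M.Preord ∧ M.Gao ∧ M.Aonz := by
  have hG : Atonz.Proves (ruleGao Atonz.sig) := provesAll_axioms _ (Or.inl (Or.inr rfl))
  exact ⟨hM.preord Atonz_apoAx, hM.gao hG, hM.aonz (proves_aonz_of_OT Atonz_apoAx hG
    (provesAll_axioms _ (Or.inr (Or.inr rfl))) (provesAll_axioms _ (Or.inr (Or.inl rfl))))⟩

theorem Asonz_acAx : Asonz.ProvesAll (acAx Asonz.sig) :=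
  provesAll_axioms.mono fun _ hr => Or.inl (Or.inl (Or.inl (Or.inl hr)))

theorem Asonz_models (hM : Asonz.AlgModel M) : M.StrictReduced := by
  have hP := hM.preord (provesAll_axioms.mono fun _ hr => Or.inl (Or.inl (Or.inl hr)))
  have hS : M.Strict := hM.strict (p := rfl)
    (provesAll_axioms.mono fun _ hr => Or.inl (Or.inl (Or.inr hr)))
  have hG : M.Gao := hM.gao (provesAll_axioms _ (Or.inl (Or.inr (Or.inr (Or.inl rfl)))))
  have hA : M.Aonz := hM.aonz (provesAll_axioms _ (Or.inr rfl))
  have h2 : M.Aso2 := hM.aso2 (p := rfl)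
    (provesAll_axioms _ (Or.inl (Or.inr (Or.inr (Or.inr (Or.inr rfl))))))
  refine ⟨hP, hG, hS, hM.col (p := rfl) (provesAll_axioms _ (Or.inl (Or.inr (Or.inl rfl)))),
    fun {a b} hab => h2 (hP.sq b) ?_, hA.anz hP hG, hA,
    hM.aso1 (p := rfl) (provesAll_axioms _ (Or.inl (Or.inr (Or.inr (Or.inr (Or.inl rfl)))))), h2⟩
  -- **lv** is not an axiom here; it follows from **Aso2**, because `b² a² = 1 > 0` and `b² ≥ 0`.
  convert hS.one using 1
  linear_combination (a * b + 1) * hab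

theorem Cod_acAx : Cod.ProvesAll (acAx Cod.sig) :=
  provesAll_axioms.mono fun _ hr => Or.inl (Or.inl (Or.inl hr))

theorem Cod_models (hM : Cod.AlgModel M) : M.StrictReduced :=
  hM.strictReduced_of_cod (p := rfl) provesAll_axioms

theorem Afrnz_acAx : Afrnz.ProvesAll (acAx Afrnz.sig) :=
  provesAll_axioms.mono fun _ hr => Or.inl (Or.inl hr)

theorem Afrnz_models (hM : Afrnz.AlgModel M) : M.FRing ∧ M.Anz :=
  ⟨hM.fRing (s := rfl) (provesAll_axioms.mono fun _ hr => Or.inl hr),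
    hM.anz (provesAll_axioms _ (Or.inr rfl))⟩

theorem Asrnz_acAx : Asrnz.ProvesAll (acAx Asrnz.sig) :=
  provesAll_axioms.mono fun _ hr => Or.inl (Or.inl (Or.inl (Or.inl (Or.inl hr))))

theorem Asrnz_models (hM : Asrnz.AlgModel M) : M.StrictReduced ∧ M.FRing := by
  have hF : M.FRing := hM.fRing (s := rfl)
    (provesAll_axioms.mono fun _ hr => Or.inl (Or.inl (Or.inl (Or.inl hr))))
  have hA : M.Anz := hM.anz (provesAll_axioms _ (Or.inr rfl))
  have h : Asrnz.ProvesAll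
      {ruleCol _ rfl, ruleLv _ rfl, ruleAso1 Asrnz.sig rfl, ruleAso2 Asrnz.sig rfl} :=
    provesAll_axioms.mono fun _ hr => Or.inl (Or.inl (Or.inr hr))
  exact ⟨⟨hF.preord, hF.gao, hM.strict (p := rfl)
      (provesAll_axioms.mono fun _ hr => Or.inl (Or.inl (Or.inl (Or.inr hr)))),
    hM.col (h _ (Or.inl rfl)), hM.lv (h _ (Or.inr (Or.inl rfl))), hA, hF.aonz hA,
    hM.aso1 (h _ (Or.inr (Or.inr (Or.inl rfl)))), hM.aso2 (h _ (Or.inr (Or.inr (Or.inr rfl))))⟩, hF⟩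

theorem Co0_acAx : Co0.ProvesAll (acAx Co0.sig) :=
  provesAll_axioms.mono fun _ hr => Or.inl (Or.inl (Or.inl (Or.inl hr)))

theorem Co0_models (hM : Co0.AlgModel M) : M.StrictReduced ∧ M.FRing :=
  ⟨hM.strictReduced_of_co0 (p := rfl) (s := rfl) provesAll_axioms,
    hM.fRing_of_co0 (p := rfl) (s := rfl) provesAll_axioms⟩

theorem Co_co0Ax : Co.ProvesAll (co0Ax Co.sig rfl rfl) :=
  provesAll_axioms.mono fun _ hr => Or.inl hr

theorem Co_acAx : Co.ProvesAll (acAx Co.sig) :=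
  Co_co0Ax.mono fun _ hr => Or.inl (Or.inl (Or.inl (Or.inl hr)))

theorem Co_models (hM : Co.AlgModel M) : M.StrictReduced ∧ M.FRing ∧ M.IsFr :=
  ⟨hM.strictReduced_of_co0 Co_co0Ax, hM.fRing_of_co0 Co_co0Ax,
    hM.isFr (s := rfl) (f := rfl) (provesAll_axioms.mono fun _ hr => Or.inr hr)⟩

theorem Codsup_codAx : Codsup.ProvesAll (codAx Codsup.sig rfl) :=
  provesAll_axioms.mono fun _ hr => Or.inl hr

theorem Codsup_acAx : Codsup.ProvesAll (acAx Codsup.sig) :=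
  Codsup_codAx.mono fun _ hr => Or.inl (Or.inl (Or.inl hr))

theorem Codsup_models (hM : Codsup.AlgModel M) : M.StrictReduced ∧ M.FRing :=
  ⟨hM.strictReduced_of_cod Codsup_codAx, hM.fRing_of_cod (s := rfl) Codsup_codAx
    (provesAll_axioms.mono fun _ hr => Or.inr hr)⟩

theorem Crcdsup_codAx : Crcdsup.ProvesAll (codAx Crcdsup.sig rfl) :=
  provesAll_axioms.mono fun _ hr => Or.inl (Or.inl hr)

theorem Crcdsup_acAx : Crcdsup.ProvesAll (acAx Crcdsup.sig) :=
  Crcdsup_codAx.mono fun _ hr => Or.inl (Or.inl (Or.inl hr))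

theorem Crcdsup_models (hM : Crcdsup.AlgModel M) : M.StrictReduced ∧ M.FRing :=
  ⟨hM.strictReduced_of_cod Crcdsup_codAx, hM.fRing_of_cod (s := rfl) Crcdsup_codAx
    (provesAll_axioms.mono fun _ hr => Or.inr hr)⟩

theorem CodsupFr_codAx : CodsupFr.ProvesAll (codAx CodsupFr.sig rfl) :=
  provesAll_axioms.mono fun _ hr => Or.inl (Or.inl hr)

theorem CodsupFr_acAx : CodsupFr.ProvesAll (acAx CodsupFr.sig) :=
  CodsupFr_codAx.mono fun _ hr => Or.inl (Or.inl (Or.inl hr))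

theorem CodsupFr_models (hM : CodsupFr.AlgModel M) : M.StrictReduced ∧ M.FRing ∧ M.IsFr :=
  ⟨hM.strictReduced_of_cod CodsupFr_codAx, hM.fRing_of_cod (s := rfl) CodsupFr_codAx
    (provesAll_axioms.mono fun _ hr => Or.inl (Or.inr hr)),
    hM.isFr (s := rfl) (f := rfl) (provesAll_axioms.mono fun _ hr => Or.inr hr)⟩

theorem CrcdsupFr_codAx : CrcdsupFr.ProvesAll (codAx CrcdsupFr.sig rfl) :=
  provesAll_axioms.mono fun _ hr => Or.inl (Or.inl (Or.inl hr))

theorem CrcdsupFr_acAx : CrcdsupFr.ProvesAll (acAx CrcdsupFr.sig) :=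
  CrcdsupFr_codAx.mono fun _ hr => Or.inl (Or.inl (Or.inl hr))

theorem CrcdsupFr_models (hM : CrcdsupFr.AlgModel M) : M.StrictReduced ∧ M.FRing ∧ M.IsFr :=
  ⟨hM.strictReduced_of_cod CrcdsupFr_codAx, hM.fRing_of_cod (s := rfl) CrcdsupFr_codAx
    (provesAll_axioms.mono fun _ hr => Or.inl (Or.inr hr)),
    hM.isFr (s := rfl) (f := rfl) (provesAll_axioms.mono fun _ hr => Or.inr hr)⟩

theorem Aftr_acAx : Aftr.ProvesAll (acAx Aftr.sig) :=
  provesAll_acAx_of_aftr (p := rfl) (s := rfl) (f := rfl) provesAll_axioms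

theorem Aftr_models (hM : Aftr.AlgModel M) : M.StrictReduced ∧ M.FRing ∧ M.IsFr :=
  ⟨hM.strictReduced_of_aftr (p := rfl) (s := rfl) (f := rfl) provesAll_axioms,
    hM.fRing_of_aftr (p := rfl) (s := rfl) (f := rfl) provesAll_axioms,
    hM.isFr_of_aftr (p := rfl) (s := rfl) (f := rfl) provesAll_axioms⟩

end Models

/-! ### The algebraic rules of the theories -/

theorem _root_.DynAlg.Rule.IsAlgebraic.isAlg {S : Sig} {r : Rule S ℕ} (h : r.IsAlgebraic) :
    IsAlg r := by
  obtain ⟨Γ, C⟩ := r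
  obtain ⟨⟨k, L⟩, hB, hk⟩ := h
  obtain rfl : k = 0 := hk
  obtain rfl : C = _ := hB
  refine ⟨Γ, L.map (Atom.subst (Sum.elim Term.var Fin.elim0)), ?_⟩
  simp only [alg, plain, List.map_map]
  congr
  refine (List.map_id'' (fun A => ?_) L).symm
  rw [Function.comp_apply, Atom.subst_subst]
  convert Atom.subst_var A using 2
  funext i
  rcases i with i | i
  · rfl
  · exact i.elim0

/-- Every member of `F` is compared with `T₁`. Proofs in `T₁` translate upwards; conversely, a rule
proved in a sound extension holds in the fields, hence is provable in `T₁` by completeness. -/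
theorem proveSameAlgebraicRules {T₁ : Theory} (hT₁ : T₁.ProvesAll (acAx T₁.sig))
    (hM : ∀ (R : Type) [CommRing R] (M : Str R), T₁.AlgModel M → M.Reduced T₁.sig) {S : Sig}
    (hS : S ≤ T₁.sig) {F : Set Theory} (hF : ∀ T ∈ F, T₁ ≤ T ∧ T.Sound) :
    ProveSameAlgebraicRules S F := by
  have key : ∀ T ∈ F, ∃ h : S ≤ T.sig, ∀ r : Rule S ℕ, r.IsAlgebraic →
      (T.Proves (r.map h) ↔ T₁.Proves (r.map hS)) := by
    intro T hT
    obtain ⟨⟨h', hax⟩, hs⟩ := hF T hT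
    have h : S ≤ T.sig :=
      ⟨fun a => h'.1 (hS.1 a), fun a => h'.2.1 (hS.2.1 a), fun a => h'.2.2 (hS.2.2 a)⟩
    refine ⟨h, fun r hr => ⟨fun hp => ?_, fun hp => ?_⟩⟩
    · obtain ⟨Γ, Δ, hr'⟩ := hr.isAlg.map hS
      rw [hr']
      refine proves_of_reduced hT₁ hM fun K _ _ _ hK => ?_
      rw [← hr', Str.holds_map, ← (Str.ofField K).holds_map h]
      exact hs.holds hp K hK
    · rw [← Rule.map_map hS h' h]
      exact Proves.translate hax hp
  intro T₂ h₂ T₃ h₃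
  obtain ⟨k₂, e₂⟩ := key T₂ h₂
  obtain ⟨k₃, e₃⟩ := key T₃ h₃
  exact ⟨k₂, k₃, fun r hr => (e₂ r hr).trans (e₃ r hr).symm⟩

end Theory

end DynAlg

/-! ### The items of the theorem -/

namespace DynAlg

open Theory

theorem le_and_sound_of_mem_between {T₁ T₂ T : Theory} (h₂ : T₂.Sound) (hT : T ∈ between T₁ T₂) :
    T₁ ≤ T ∧ T.Sound := ⟨hT.1, h₂.of_le hT.2⟩

theorem proveSameAlgebraicRules_sigA : ProveSameAlgebraicRules sigA
    ({Aonz, Afrnz, Atonz, Cod, Co0, Crcdsup} ∪ between Aonz Crcdsup ∪ between Aonz CrcdsupFr) := by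
  refine proveSameAlgebraicRules Aonz_acAx (fun R _ M hM => ?_) ⟨id, id, id⟩ ?_
  · obtain ⟨hP, hG, hA⟩ := Aonz_models hM
    exact Str.reduced_of_pos_iff hP hG hA (hM.pos_iff nofun) nofun nofun nofun
  have key : ∀ {K : Type} [CommRing K] {M : Str K}, M.StrictReduced → M.Preord ∧ M.Gao ∧ M.Aonz :=
    fun h => ⟨h.preord, h.gao, h.aonz⟩
  -- Besides placing `Crcdsup` in the family, this yields the soundness of `Aonz` by `Sound.of_le`.
  have hC : Aonz ≤ Crcdsup := Aonz_le Crcdsup_acAx fun K _ M hM => key (Crcdsup_models hM).1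
  rintro T (((rfl | rfl | rfl | rfl | rfl | rfl) | hT) | hT)
  · have h : Aonz ≤ Aonz := Aonz_le Aonz_acAx fun K _ M => Aonz_models
    exact ⟨h, Crcdsup_sound.of_le hC⟩
  · have h : Afrnz ≤ Crcdsup := Afrnz_le rfl Crcdsup_acAx fun K _ M hM =>
      ⟨(Crcdsup_models hM).2, (Crcdsup_models hM).1.anz⟩
    exact ⟨Aonz_le Afrnz_acAx fun K _ M hM =>
      have ⟨hF, hA⟩ := Afrnz_models hM
      ⟨hF.preord, hF.gao, hF.aonz hA⟩, Crcdsup_sound.of_le h⟩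
  · exact ⟨Aonz_le (Atonz_apoAx.mono acAx_subset_apoAx) fun K _ M => Atonz_models, Atonz_sound⟩
  · exact ⟨Aonz_le Cod_acAx fun K _ M hM => key (Cod_models hM), Cod_sound⟩
  · exact ⟨Aonz_le Co0_acAx fun K _ M hM => key (Co0_models hM).1, Co0_sound⟩
  · exact ⟨hC, Crcdsup_sound⟩
  · exact le_and_sound_of_mem_between Crcdsup_sound hT
  · exact le_and_sound_of_mem_between CrcdsupFr_sound hT

theorem proveSameAlgebraicRules_sigAPos : ProveSameAlgebraicRules sigAPos
    ({Asonz, Asrnz, Cod, Co0, Crcdsup} ∪ between Asonz Crcdsup ∪ between Asonz CrcdsupFr) := by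
  refine proveSameAlgebraicRules Asonz_acAx
    (fun R _ M hM => (Asonz_models hM).reduced nofun nofun) ⟨id, id, id⟩ ?_
  have hC : Asonz ≤ Crcdsup := Asonz_le rfl Crcdsup_acAx fun K _ M hM => (Crcdsup_models hM).1
  rintro T (((rfl | rfl | rfl | rfl | rfl) | hT) | hT)
  · exact ⟨Asonz_le rfl Asonz_acAx fun K _ M => Asonz_models, Crcdsup_sound.of_le hC⟩
  · exact ⟨Asonz_le rfl Asrnz_acAx fun K _ M hM => (Asrnz_models hM).1,
      Crcdsup_sound.of_le (Asrnz_le rfl rfl Crcdsup_acAx fun K _ M => Crcdsup_models)⟩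
  · exact ⟨Asonz_le rfl Cod_acAx fun K _ M => Cod_models, Cod_sound⟩
  · exact ⟨Asonz_le rfl Co0_acAx fun K _ M hM => (Co0_models hM).1, Co0_sound⟩
  · exact ⟨hC, Crcdsup_sound⟩
  · exact le_and_sound_of_mem_between Crcdsup_sound hT
  · exact le_and_sound_of_mem_between CrcdsupFr_sound hT

theorem proveSameAlgebraicRules_sigASup : ProveSameAlgebraicRules sigASup
    ({Afrnz, Asrnz, Co0, Crcdsup} ∪ between Afrnz Crcdsup ∪ between Afrnz CrcdsupFr) := by
  refine proveSameAlgebraicRules Afrnz_acAx (fun R _ M hM => ?_) ⟨id, id, id⟩ ?_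
  · obtain ⟨hF, hA⟩ := Afrnz_models hM
    exact Str.reduced_of_pos_iff hF.preord hF.gao (hF.aonz hA) (hM.pos_iff nofun) nofun
      (fun _ => hF) nofun
  have key : ∀ {K : Type} [CommRing K] {M : Str K}, M.StrictReduced ∧ M.FRing → M.FRing ∧ M.Anz :=
    fun h => ⟨h.2, h.1.anz⟩
  have hC : Afrnz ≤ Crcdsup := Afrnz_le rfl Crcdsup_acAx fun K _ M hM => key (Crcdsup_models hM)
  rintro T (((rfl | rfl | rfl | rfl) | hT) | hT)
  · exact ⟨Afrnz_le rfl Afrnz_acAx fun K _ M => Afrnz_models, Crcdsup_sound.of_le hC⟩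
  · exact ⟨Afrnz_le rfl Asrnz_acAx fun K _ M hM => key (Asrnz_models hM),
      Crcdsup_sound.of_le (Asrnz_le rfl rfl Crcdsup_acAx fun K _ M => Crcdsup_models)⟩
  · exact ⟨Afrnz_le rfl Co0_acAx fun K _ M hM => key (Co0_models hM), Co0_sound⟩
  · exact ⟨hC, Crcdsup_sound⟩
  · exact le_and_sound_of_mem_between Crcdsup_sound hT
  · exact le_and_sound_of_mem_between CrcdsupFr_sound hT

theorem proveSameAlgebraicRules_sigAPosSup : ProveSameAlgebraicRules sigAPosSup
    ({Asrnz, Co0, Co, Codsup, Crcdsup} ∪ between Asrnz Crcdsup ∪ between Asrnz CrcdsupFr) := by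
  refine proveSameAlgebraicRules Asrnz_acAx
    (fun R _ M hM => (Asrnz_models hM).1.reduced (fun _ => (Asrnz_models hM).2) nofun)
    ⟨id, id, id⟩ ?_
  have hC : Asrnz ≤ Crcdsup := Asrnz_le rfl rfl Crcdsup_acAx fun K _ M => Crcdsup_models
  rintro T (((rfl | rfl | rfl | rfl | rfl) | hT) | hT)
  · exact ⟨Asrnz_le rfl rfl Asrnz_acAx fun K _ M => Asrnz_models, Crcdsup_sound.of_le hC⟩
  · exact ⟨Asrnz_le rfl rfl Co0_acAx fun K _ M => Co0_models, Co0_sound⟩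
  · exact ⟨Asrnz_le rfl rfl Co_acAx fun K _ M hM => ⟨(Co_models hM).1, (Co_models hM).2.1⟩,
      Co_sound⟩
  · exact ⟨Asrnz_le rfl rfl Codsup_acAx fun K _ M => Codsup_models, Codsup_sound⟩
  · exact ⟨hC, Crcdsup_sound⟩
  · exact le_and_sound_of_mem_between Crcdsup_sound hT
  · exact le_and_sound_of_mem_between CrcdsupFr_sound hT

/-- Completeness is established for the full signature, so the rules with and without `· > 0` are
covered together. -/
theorem proveSameAlgebraicRules_of_le_sigAPosSupFr {S : Sig} (hS : S ≤ sigAPosSupFr) :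
    ProveSameAlgebraicRules S ({Aftr, Co, CodsupFr, CrcdsupFr} ∪ between Aftr CrcdsupFr) := by
  refine proveSameAlgebraicRules Aftr_acAx
    (fun R _ M hM => (Aftr_models hM).1.reduced (fun _ => (Aftr_models hM).2.1)
      fun _ => (Aftr_models hM).2) hS ?_
  rintro T ((rfl | rfl | rfl | rfl) | hT)
  · exact ⟨Aftr_le rfl rfl rfl Aftr_acAx (proves_IV_of_aftr provesAll_axioms)
      fun K _ M => Aftr_models, Aftr_sound⟩
  · exact ⟨Aftr_le rfl rfl rfl Co_acAx (Co_co0Ax _ (by simp [co0Ax]))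
      fun K _ M => Co_models, Co_sound⟩
  · exact ⟨Aftr_le rfl rfl rfl CodsupFr_acAx (CodsupFr_codAx _ (by simp [codAx]))
      fun K _ M => CodsupFr_models, CodsupFr_sound⟩
  · exact ⟨Aftr_le rfl rfl rfl CrcdsupFr_acAx (CrcdsupFr_codAx _ (by simp [codAx]))
      fun K _ M => CrcdsupFr_models, CrcdsupFr_sound⟩
  · exact le_and_sound_of_mem_between CrcdsupFr_sound hT

end DynAlg

theorem mainTheorem1 :
    DynAlg.ProveSameAlgebraicRules DynAlg.sigA
      ({DynAlg.Aonz, DynAlg.Afrnz, DynAlg.Atonz, DynAlg.Cod, DynAlg.Co0, DynAlg.Crcdsup} ∪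
        DynAlg.between DynAlg.Aonz DynAlg.Crcdsup ∪
        DynAlg.between DynAlg.Aonz DynAlg.CrcdsupFr) ∧
    DynAlg.ProveSameAlgebraicRules DynAlg.sigAPos
      ({DynAlg.Asonz, DynAlg.Asrnz, DynAlg.Cod, DynAlg.Co0, DynAlg.Crcdsup} ∪
        DynAlg.between DynAlg.Asonz DynAlg.Crcdsup ∪
        DynAlg.between DynAlg.Asonz DynAlg.CrcdsupFr) ∧
    DynAlg.ProveSameAlgebraicRules DynAlg.sigASup
      ({DynAlg.Afrnz, DynAlg.Asrnz, DynAlg.Co0, DynAlg.Crcdsup} ∪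
        DynAlg.between DynAlg.Afrnz DynAlg.Crcdsup ∪
        DynAlg.between DynAlg.Afrnz DynAlg.CrcdsupFr) ∧
    DynAlg.ProveSameAlgebraicRules DynAlg.sigAPosSup
      ({DynAlg.Asrnz, DynAlg.Co0, DynAlg.Co, DynAlg.Codsup, DynAlg.Crcdsup} ∪
        DynAlg.between DynAlg.Asrnz DynAlg.Crcdsup ∪
        DynAlg.between DynAlg.Asrnz DynAlg.CrcdsupFr) ∧
    DynAlg.ProveSameAlgebraicRules DynAlg.sigASupFr
      ({DynAlg.Aftr, DynAlg.Co, DynAlg.CodsupFr, DynAlg.CrcdsupFr} ∪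
        DynAlg.between DynAlg.Aftr DynAlg.CrcdsupFr) ∧
    DynAlg.ProveSameAlgebraicRules DynAlg.sigAPosSupFr
      ({DynAlg.Aftr, DynAlg.Co, DynAlg.CodsupFr, DynAlg.CrcdsupFr} ∪
        DynAlg.between DynAlg.Aftr DynAlg.CrcdsupFr) :=
  ⟨DynAlg.proveSameAlgebraicRules_sigA, DynAlg.proveSameAlgebraicRules_sigAPos,
    DynAlg.proveSameAlgebraicRules_sigASup, DynAlg.proveSameAlgebraicRules_sigAPosSup,
    DynAlg.proveSameAlgebraicRules_of_le_sigAPosSupFr ⟨nofun, id, id⟩,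
    DynAlg.proveSameAlgebraicRules_of_le_sigAPosSupFr ⟨id, id, id⟩⟩
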